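/- **Setting.** A *looped neural network* is a feedforward network $f_\theta:\mathbb R^n\to\mathbb R^n$, $n\ge 3$, with any number $L\ge 1$ of affine layers (weights and biases, arbitrary hidden widths) and ReLU between consecutive layers. Here $\theta=(\theta_1,\dots,\theta_d)$ lists all weights and biases; $L$, the widths, $n$ and $d$ belong to the network and are not bounded in advance. It is run from $x_0=0$ by $x_{t+1}=f_\theta(x_t)$. At each iteration $t\ge 1$: if the first coordinate of $x_t$ (halt) is positive, it halts; otherwise, if the second coordinate (emit) is positive, it appends the bit $\mathbf 1[(x_t)_3>0]$ to its output. It *outputs* $s\in\{0,1\}^*$ if it halts and the bits appended until then form $s$. For reals $0<\delta\le M$ let $\Theta_{\delta,M}$ be the set of parameter vectors (of any finite length) with all entries in $\delta\mathbb Z\cap[-M,M]$. Let $\|\theta\|_0$ be the number of non-zero entries of $\theta$, let $\|\theta\|_p=(\sum_i|\theta_i|^p)^{1/p}$, and let $$\mathcal N_p(s)=\inf\{\|\theta\|_p:\ \theta\in\Theta_{\delta,M},\ \theta\text{ outputs }s\},\qquad \inf\emptyset=\infty .$$ Let $U$ be a universal self-delimiting machine: a partial recursive function on $\{0,1\}^*$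 with prefix-free domain such that for every partial recursive function $V$ on $\{0,1\}^*$ with prefix-free domain there is a string $q$ with $U(qw)=V(w)$ for all $w$ (both sides being undefined at the same $w$). Let $K(s)=\min\{|w|: U(w)=s\}$. **Proposition ($L_p$ sandwich).** Let $0<\delta\le M$ be real numbers and $U$ a universal self-delimiting machine. There are constants $c_U,c_d\ge 0$, depending only on $U$, $\delta$ and $M$, such that for every real $p\ge 1$: 1. $\delta^p\|\theta\|_0\le\|\theta\|_p^p\le M^p\|\theta\|_0$ for every looped network with $\theta\in\Theta_{\delta,M}$. 2. For every $s\in\{0,1\}^*$, $\mathcal N_p(s)<\infty$ and $$\mathcal N_p(s)^p\le M^p\,(K(s)+c_U).$$ 3. If moreover $\delta$ is a computable real number, then for every $s\in\{0,1\}^*$ $$K(s)\le\frac{c_d}{\delta^p}\,\mathcal N_p(s)^p\,\log_2\!\Big(\frac{\mathcal N_p(s)^p}{\delta^p}\Big)+c_d .$$ -/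

import Mathlib

open scoped ENNReal

namespace LoopedNet

/-! ### Prefix Kolmogorov complexity -/

/-- A set of binary strings is prefix-free: no element is a proper prefix of another one. -/
def PrefixFree (A : Set (List Bool)) : Prop :=
  ∀ p ∈ A, ∀ q ∈ A, p <+: q → p = q

/-- A self-delimiting machine: a partial recursive function on binary strings whose
halting set is prefix-free. -/
structure IsPrefixMachine (V : List Bool →. List Bool) : Prop where
  partrec : Partrec V
  prefixFree : PrefixFree V.Dom

/-- A universal self-delimiting machine: it simulates every self-delimiting machine `V`,
the program of `V` being preceded by a fixed string that names `V`. -/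
structure IsUniversal (U : List Bool →. List Bool) : Prop where
  isPrefixMachine : IsPrefixMachine U
  simulates : ∀ V : List Bool →. List Bool, IsPrefixMachine V →
    ∃ q : List Bool, ∀ p : List Bool, U (q ++ p) = V p

/-- `K(s)`: the length of a shortest program on which `U` halts with output `s`. -/
noncomputable def kolmogorov (U : List Bool →. List Bool) (s : List Bool) : ℕ :=
  sInf {k | ∃ p : List Bool, p.length = k ∧ s ∈ U p}

/-- Over a universal machine every string has a program, so that the infimum that defines
`kolmogorov` is a minimum over a nonempty set. -/
theorem IsUniversal.exists_program {U : List Bool →. List Bool} (hU : IsUniversal U)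
    (s : List Bool) : ∃ p : List Bool, s ∈ U p := by
  let V : List Bool →. List Bool := fun p => bif p.isEmpty then Part.some s else Part.none
  have hdom : ∀ p ∈ V.Dom, p = [] := by
    intro p hp
    rcases p with _ | ⟨a, p⟩
    · rfl
    · exact hp.elim
  have hV : IsPrefixMachine V := by
    refine ⟨?_, ?_⟩
    · refine Partrec.cond ?_ (Computable.const s).partrec Partrec.none
      have h : Primrec fun p : List Bool => decide (p.length = 0) :=
        (Primrec.eq.comp Primrec.list_length (Primrec.const 0)).decide
      refine h.to_comp.of_eq fun p => ?_
      cases p <;> simp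
    · intro p hp q hq _
      rw [hdom p hp, hdom q hq]
  obtain ⟨q, hq⟩ := hU.simulates V hV
  refine ⟨q ++ [], ?_⟩
  rw [hq]
  exact Part.mem_some s

/-! ### Feedforward ReLU networks -/

/-- Feedforward networks `ℝ^m → ℝ^k` with any positive number of affine layers (weights and
biases) of arbitrary widths, ReLU being applied between consecutive layers. The value holds
the parameters of the network. -/
inductive FFNet : ℕ → ℕ → Type
  | last {m k : ℕ} (W : Matrix (Fin k) (Fin m) ℝ) (b : Fin k → ℝ) : FFNet m k
  | cons {m l k : ℕ} (W : Matrix (Fin l) (Fin m) ℝ) (b : Fin l → ℝ) (rest : FFNet l k) :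
      FFNet m k

/-- The function computed by a feedforward network. -/
def FFNet.eval : {m k : ℕ} → FFNet m k → (Fin m → ℝ) → (Fin k → ℝ)
  | _, _, .last W b, x => W.mulVec x + b
  | _, _, .cons W b rest, x => rest.eval fun i => max ((W.mulVec x + b) i) 0

/-- The list of the parameters of one affine layer: all weights and all biases. -/
def layerParams {m k : ℕ} (W : Matrix (Fin k) (Fin m) ℝ) (b : Fin k → ℝ) : List ℝ :=
  (List.ofFn fun i => List.ofFn (W i)).flatten ++ List.ofFn b

/-- The parameter vector `θ = (θ_1, …, θ_d)` of a feedforward network. -/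
def FFNet.params : {m k : ℕ} → FFNet m k → List ℝ
  | _, _, .last W b => layerParams W b
  | _, _, .cons W b rest => layerParams W b ++ rest.params

/-! ### Looped networks -/

/-- A looped network: a feedforward block `f_θ : ℝ^n → ℝ^n` whose state has (at least) the
three designated coordinates halt, emit and bit. -/
structure LNN where
  n : ℕ
  three_le : 3 ≤ n
  block : FFNet n n

namespace LNN

variable (N : LNN)

/-- The halt channel, the first coordinate. -/
def haltCh : Fin N.n := ⟨0, by have := N.three_le; omega⟩

/-- The emit channel, the second coordinate. -/
def emitCh : Fin N.n := ⟨1, by have := N.three_le; omega⟩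

/-- The bit channel, the third coordinate. -/
def bitCh : Fin N.n := ⟨2, by have := N.three_le; omega⟩

/-- The state `x_t`: `x_0 = 0` and `x_{t+1} = f_θ(x_t)`. -/
def state : ℕ → Fin N.n → ℝ
  | 0 => 0
  | t + 1 => N.block.eval (state t)

open Classical in
/-- The bits appended to the output at the iterations `1, …, t`, in order, if none of these
iterations halts. -/
noncomputable def emitted : ℕ → List Bool
  | 0 => []
  | t + 1 => emitted t ++
      if 0 < N.state (t + 1) N.emitCh then [decide (0 < N.state (t + 1) N.bitCh)] else []

/-- The network outputs `s`: the first iteration `τ ≥ 1` at which the halt channel is positive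
exists (`τ = t + 1`), and the bits appended before it form `s`. -/
def Outputs (s : List Bool) : Prop :=
  ∃ t : ℕ, 0 < N.state (t + 1) N.haltCh ∧
    (∀ i < t, ¬ 0 < N.state (i + 1) N.haltCh) ∧ N.emitted t = s

/-- `θ ∈ Θ_{δ,M}`: all parameters lie in `δℤ ∩ [-M, M]`. -/
def FixedPrecision (δ M : ℝ) : Prop :=
  ∀ a ∈ N.block.params, (∃ z : ℤ, a = δ * z) ∧ |a| ≤ M

open Classical in
/-- `‖θ‖₀`: the number of non-zero parameters. -/
noncomputable def zeroNorm : ℕ := N.block.params.countP fun a => a ≠ 0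

/-- `‖θ‖_p = (∑ |θ_i|^p)^(1/p)`. -/
noncomputable def lpNorm (p : ℝ) : ℝ :=
  ((N.block.params.map fun a => |a| ^ p).sum) ^ (1 / p)

end LNN

/-- `𝒩_p(s)`: the infimum of `‖θ‖_p` over all looped networks with parameters in `Θ_{δ,M}` that
output `s`; it is `∞` if there is no such network. -/
noncomputable def minLpNorm (δ M p : ℝ) (s : List Bool) : ℝ≥0∞ :=
  ⨅ (N : LNN) (_ : N.FixedPrecision δ M) (_ : N.Outputs s), ENNReal.ofReal (N.lpNorm p)

/-- `x` is a computable real number: some algorithm produces, on input `k`, an integer `a` with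
`|x - a / 2^k| ≤ 1 / 2^k`. -/
def IsComputableReal (x : ℝ) : Prop :=
  ∃ f : ℕ → ℤ, Computable f ∧ ∀ k : ℕ, |x - f k / 2 ^ k| ≤ 1 / 2 ^ k

end LoopedNet

/-! Every nonzero entry of `θ` has absolute value between `δ` and `M`, so `‖θ‖_p^p` is comparable
with the number `k` of nonzero entries (`lpNorm_bounds`). It remains to compare `K(s)` with the
least `k` of a network that outputs `s`, and the constants found there do not involve `p`.

Networks from programs (`exists_network`). A shortest program `w` of `s` is stored in the weights of
a network that runs `U`. The machine `U` is compiled to a finite multi-stack machine; a stack is a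
fraction in a large base `B`, and ReLU layers with integer weights perform one machine step per
iteration. The coefficient of `K(s)` must be `1`: the input tape holds five symbols per cell, a cell
costs five nonzero weights, and the rest of the network does not depend on `w`. An integer weight
`a` is realized by weights `± δ` from `|a|` copies of its source. This scales the state by `δ ^ 4`
per iteration, which is harmless because the channels are only tested for positivity. Division by
`B` is avoided by a unit `v` that is multiplied by `B ^ 5` at each iteration, a stack being stored
as `v` times its fraction. The unit outgrows the bias, which therefore acts only once, as the pulse
that starts the network.

Programs from networks (`exists_kolmogorov_le_zeroNorm`). Only nonzero weights matter, whatever the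
widths and the depth. They form a straight-line program of `O(k)` instructions which mentions `O(k)`
names, so a prefix code of it takes `O(k log k)` bits. A machine can decode and run it exactly: all
values are integer polynomials in `δ`, and only their signs decide what happens. At a computable `δ`
these signs are decidable (`computablePred_expVal_pos`), since both vanishing and positivity can be
certified by search. Finally `δ ^ p * k ≤ 𝒩_p(s) ^ p` for the least `k`, and `x log x` is increasing
for `x ≥ 1`. -/

namespace LoopedNet

/-! ### Deciding the sign of a polynomial at a computable real number -/

section Sign

open Polynomial Filter Topology

theorem primrec_nat_pow : Primrec₂ ((· ^ ·) : ℕ → ℕ → ℕ) :=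
  Primrec₂.unpaired'.1 Nat.Primrec.pow

theorem primrec_list_sum : Primrec (List.sum : List ℕ → ℕ) :=
  (Primrec.list_foldr Primrec.id (Primrec.const 0)
    (Primrec.nat_add.comp (Primrec.fst.comp Primrec.snd) (Primrec.snd.comp Primrec.snd)).to₂).of_eq
    fun l => by simp [List.sum]

/-- The sign denoted by a Boolean. -/
def sgn (b : Bool) : ℤ := bif b then 1 else -1

/-- The polynomial `∑ ± X ^ e` given by a list of signed exponents. -/
noncomputable def expPoly (L : List (Bool × ℕ)) : ℤ[X] :=
  (L.map fun x => monomial x.2 (sgn x.1)).sum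

/-- The real number `∑ ± δ ^ e` given by a list of signed exponents. -/
noncomputable def expVal (δ : ℝ) (L : List (Bool × ℕ)) : ℝ :=
  (L.map fun x => (sgn x.1 : ℝ) * δ ^ x.2).sum

theorem aeval_expPoly (δ : ℝ) (L : List (Bool × ℕ)) : aeval δ (expPoly L) = expVal δ L := by
  induction L with
  | nil => simp [expPoly, expVal]
  | cons x L ih =>
    simp only [expPoly, expVal, List.map_cons, List.sum_cons, map_add] at ih ⊢
    rw [ih, aeval_monomial]
    simp

@[simp] theorem expPoly_append (L L' : List (Bool × ℕ)) :
    expPoly (L ++ L') = expPoly L + expPoly L' := by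
  simp [expPoly]

@[simp] theorem expVal_append (δ : ℝ) (L L' : List (Bool × ℕ)) :
    expVal δ (L ++ L') = expVal δ L + expVal δ L' := by
  simp [expVal]

/-- Negation of a list of signed exponents. -/
def expNeg (L : List (Bool × ℕ)) : List (Bool × ℕ) := L.map fun x => (!x.1, x.2)

@[simp] theorem sgn_not (b : Bool) : sgn (!b) = -sgn b := by cases b <;> rfl

@[simp] theorem expPoly_neg (L : List (Bool × ℕ)) : expPoly (expNeg L) = -expPoly L := by
  induction L with
  | nil => simp [expPoly, expNeg]
  | cons x L ih =>
    simp only [expPoly, expNeg, List.map_cons, List.sum_cons, neg_add] at ih ⊢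
    rw [ih]
    simp

theorem expVal_neg (δ : ℝ) (L : List (Bool × ℕ)) : expVal δ (expNeg L) = -expVal δ L := by
  rw [← aeval_expPoly, ← aeval_expPoly, expPoly_neg, map_neg]

/-- Product of lists of signed exponents. -/
def expMul (L L' : List (Bool × ℕ)) : List (Bool × ℕ) :=
  L.flatMap fun x => L'.map fun y => (x.1 == y.1, x.2 + y.2)

theorem sgn_beq (a b : Bool) : sgn (a == b) = sgn a * sgn b := by
  cases a <;> cases b <;> rfl

@[simp] theorem expPoly_mul (L L' : List (Bool × ℕ)) :
    expPoly (expMul L L') = expPoly L * expPoly L' := by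
  induction L with
  | nil => simp [expPoly, expMul]
  | cons x L ih =>
    have h : expPoly (L'.map fun y => (x.1 == y.1, x.2 + y.2)) =
        monomial x.2 (sgn x.1) * expPoly L' := by
      clear ih
      induction L' with
      | nil => simp [expPoly]
      | cons y L' ih =>
        simp only [expPoly, List.map_cons, List.sum_cons, mul_add] at ih ⊢
        rw [ih, monomial_mul_monomial, sgn_beq]
    have h2 : expMul (x :: L) L' =
        (L'.map fun y => (x.1 == y.1, x.2 + y.2)) ++ expMul L L' := by
      simp [expMul]
    rw [h2, expPoly_append, h, ih]
    simp [expPoly, add_mul]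

/-- Makes a search over lists as good as a search over polynomials. A coefficient `a` becomes `|a|`
repeated terms. -/
theorem exists_expPoly_eq (P : ℤ[X]) : ∃ L, expPoly L = P := by
  induction P using Polynomial.induction_on' with
  | add p q hp hq =>
    obtain ⟨L, rfl⟩ := hp
    obtain ⟨L', rfl⟩ := hq
    exact ⟨L ++ L', by simp⟩
  | monomial n a =>
    refine ⟨List.replicate a.natAbs (decide (0 ≤ a), n), ?_⟩
    simp only [expPoly, List.map_replicate, List.sum_replicate]
    rw [← map_nsmul]
    congr 1
    rcases le_total 0 a with h | h
    · simp [sgn, h]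
    · rcases h.eq_or_lt with rfl | h
      · simp
      · simp [sgn, not_le.2 h, abs_of_neg h]

/-- Whether a list of signed exponents cancels out formally. -/
def expCancels (L : List (Bool × ℕ)) : Prop :=
  ∀ x ∈ L, (L.filter fun y => y = (true, x.2)).length = (L.filter fun y => y = (false, x.2)).length

theorem expPoly_coeff (L : List (Bool × ℕ)) (e : ℕ) :
    (expPoly L).coeff e = ((L.filter fun y => y = (true, e)).length : ℤ) -
      (L.filter fun y => y = (false, e)).length := by
  induction L with
  | nil => simp [expPoly]
  | cons x L ih =>
    simp only [expPoly, List.map_cons, List.sum_cons, coeff_add] at ih ⊢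
    rw [ih, coeff_monomial]
    rcases x with ⟨b, f⟩
    by_cases hf : f = e <;> cases b <;> simp [hf, sgn] <;> ring

/-- A coefficient can be nonzero only at an exponent that occurs in the list, so finitely many
comparisons of counts decide whether the polynomial vanishes. -/
theorem expCancels_iff (L : List (Bool × ℕ)) : expCancels L ↔ expPoly L = 0 := by
  constructor
  · intro h
    ext e
    rw [expPoly_coeff, coeff_zero]
    by_cases he : ∃ x ∈ L, x.2 = e
    · obtain ⟨x, hx, rfl⟩ := he
      rw [h x hx, sub_self]
    · have : ∀ b, L.filter (fun y => y = (b, e)) = [] := by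
        intro b
        rw [List.filter_eq_nil_iff]
        intro y hy hy'
        exact he ⟨y, hy, by simp at hy'; simp [hy']⟩
      rw [this, this, sub_self]
  · intro h x _
    have := expPoly_coeff L x.2
    rw [h, coeff_zero] at this
    omega

theorem primrecPred_expCancels : PrimrecPred expCancels := by
  have hc : ∀ b : Bool, Primrec₂ fun (x : Bool × ℕ) (L : List (Bool × ℕ)) =>
      (L.filter fun y => y = (b, x.2)).length := by
    intro b
    have hR : PrimrecRel fun (y : Bool × ℕ) (x : Bool × ℕ) => y = (b, x.2) :=
      Primrec.eq.comp Primrec.fst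
        (Primrec.pair (Primrec.const b) (Primrec.snd.comp Primrec.snd))
    exact (Primrec.list_length.comp ((hR.listFilter).comp Primrec.snd Primrec.fst))
  have hR : PrimrecRel fun (x : Bool × ℕ) (L : List (Bool × ℕ)) =>
      (L.filter fun y => y = (true, x.2)).length = (L.filter fun y => y = (false, x.2)).length :=
    Primrec.eq.comp (hc true) (hc false)
  exact (hR.forall_mem_list).comp Primrec.id Primrec.id

theorem primrec_expNeg : Primrec expNeg :=
  Primrec.list_map Primrec.id
    (Primrec.pair (Primrec.not.comp (Primrec.fst.comp Primrec.snd))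
      (Primrec.snd.comp Primrec.snd)).to₂

theorem primrec_expMul : Primrec₂ expMul := by
  refine Primrec.list_flatMap Primrec.fst (Primrec.list_map (Primrec.snd.comp Primrec.fst) ?_)
  have hx : Primrec fun q : ((List (Bool × ℕ) × List (Bool × ℕ)) × (Bool × ℕ)) × (Bool × ℕ) =>
      q.1.2 := Primrec.snd.comp Primrec.fst
  have hy : Primrec fun q : ((List (Bool × ℕ) × List (Bool × ℕ)) × (Bool × ℕ)) × (Bool × ℕ) =>
      q.2 := Primrec.snd
  exact Primrec.pair (Primrec.beq.comp (Primrec.fst.comp hx) (Primrec.fst.comp hy))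
    (Primrec.nat_add.comp (Primrec.snd.comp hx) (Primrec.snd.comp hy))

/-- The zeros of integer polynomials at `δ` are the formal divisors of multiples of one fixed
polynomial. -/
theorem exists_annihilator (δ : ℝ) : ∃ m : ℤ[X], aeval δ m = 0 ∧
    ∀ P : ℤ[X], aeval δ P = 0 → ∃ c : ℕ, 0 < c ∧ ∃ Q : ℤ[X], (c : ℤ[X]) * P = m * Q := by
  -- For transcendental `δ` the minimal polynomial is `0`, hence `m = 0`, and the divisibility below
  -- says that `P` itself vanishes. No case distinction is needed.
  obtain ⟨b, hbM, hb⟩ := IsLocalization.integerNormalization_spec (nonZeroDivisors ℤ)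
    (minpoly ℚ δ)
  set m := IsLocalization.integerNormalization (nonZeroDivisors ℤ) (minpoly ℚ δ) with hm
  have hb0 : b ≠ 0 := nonZeroDivisors.ne_zero hbM
  refine ⟨m, ?_, fun P hP => ?_⟩
  · have h1 : aeval δ (m.map (algebraMap ℤ ℚ)) = aeval δ m := aeval_map_algebraMap ℚ δ m
    rw [← h1, hb]
    simp
  · have h1 : aeval δ (P.map (algebraMap ℤ ℚ)) = 0 := by rw [aeval_map_algebraMap, hP]
    obtain ⟨R, hR⟩ := minpoly.dvd ℚ δ h1
    obtain ⟨d, hdM, hd⟩ := IsLocalization.integerNormalization_spec (nonZeroDivisors ℤ) R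
    set R' := IsLocalization.integerNormalization (nonZeroDivisors ℤ) R
    have hd0 : d ≠ 0 := nonZeroDivisors.ne_zero hdM
    have key : ((b : ℤ[X]) * d) * P = m * R' := by
      apply Polynomial.map_injective (algebraMap ℤ ℚ) (algebraMap ℤ ℚ).injective_int
      rw [Polynomial.map_mul, Polynomial.map_mul, Polynomial.map_mul, hb, hd, hR]
      simp only [Polynomial.map_intCast, zsmul_eq_mul]
      ring
    have hbd : b * d ≠ 0 := mul_ne_zero hb0 hd0
    rcases lt_or_gt_of_ne hbd with h | h
    · refine ⟨(b * d).natAbs, Int.natAbs_pos.2 hbd, -R', ?_⟩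
      have : (((b * d).natAbs : ℤ) : ℤ[X]) = -((b : ℤ[X]) * d) := by
        rw [← Int.cast_mul, ← Int.cast_neg, ← abs_of_neg h, Int.natCast_natAbs]
      rw [← Int.cast_natCast, this, neg_mul, key]
      ring
    · refine ⟨(b * d).natAbs, Int.natAbs_pos.2 hbd, R', ?_⟩
      have : (((b * d).natAbs : ℤ) : ℤ[X]) = ((b : ℤ[X]) * d) := by
        rw [← Int.cast_mul, Int.natCast_natAbs, abs_of_pos h]
      rw [← Int.cast_natCast, this, key]

theorem rePred_exists {α β : Type*} [Primcodable α] [Primcodable β] {R : α → β → Prop}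
    (hR : ComputablePred fun p : α × β => R p.1 p.2) : REPred fun a => ∃ b, R a b := by
  obtain ⟨f, hf, hfR⟩ := ComputablePred.computable_iff.1 hR
  have hRf : ∀ a b, R a b ↔ f (a, b) = true := fun a b => iff_of_eq (congrFun hfR (a, b))
  simp only [hRf]
  have hf : Computable₂ fun (a : α) (n : ℕ) =>
      (Encodable.decode (α := β) n).bind fun b =>
        bif f (a, b) then some true else (none : Option Bool) := by
    have h1 : Computable fun p : (α × ℕ) × β => f (p.1.1, p.2) :=
      hf.comp (Computable.pair (Computable.fst.comp Computable.fst) Computable.snd)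
    have h2 : Computable fun p : (α × ℕ) × β =>
        bif f (p.1.1, p.2) then some true else (none : Option Bool) :=
      Computable.cond h1 (Computable.const (some true)) (Computable.const none)
    have h3 : Computable fun p : α × ℕ => (Encodable.decode p.2 : Option β) :=
      Computable.decode.comp Computable.snd
    exact Computable.option_bind h3 h2.to₂
  refine (Partrec.rfindOpt hf).dom_re.of_eq fun a => ?_
  rw [Nat.rfindOpt_dom]
  constructor
  · rintro ⟨n, _, h⟩
    simp only [Option.mem_def, Option.bind_eq_some_iff] at h
    obtain ⟨b, _, h⟩ := h
    exact ⟨b, by cases hb : f (a, b) <;> simp_all⟩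
  · rintro ⟨b, hb⟩
    exact ⟨Encodable.encode b, true, by simp [hb]⟩

theorem rePred_or {α : Type*} [Primcodable α] {p q : α → Prop} (hp : REPred p) (hq : REPred q) :
    REPred fun a => p a ∨ q a := by
  obtain ⟨k, hk, h⟩ := Partrec.merge' hp hq
  refine hk.dom_re.of_eq fun a => ?_
  rw [(h a).2]
  simp [Part.assert]

theorem rePred_comp {α β : Type*} [Primcodable α] [Primcodable β] {p : β → Prop} (hp : REPred p)
    {f : α → β} (hf : Computable f) : REPred fun a => p (f a) :=
  Partrec.comp hp hf

/-- Vanishing at `δ` is certified by a finite identity `c P = m Q` of integer polynomials, and such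
identities can be searched for. The polynomial `m` is built into the algorithm; it is not computed
from `δ`. -/
theorem rePred_expVal_eq_zero (δ : ℝ) : REPred fun L => expVal δ L = 0 := by
  obtain ⟨m, hm0, hm⟩ := exists_annihilator δ
  obtain ⟨ml, rfl⟩ := exists_expPoly_eq m
  -- The list of `c + 1` terms `(true, 0)` codes a positive integer, so the factor in front of `P`
  -- cannot be `0`.
  have hR : ComputablePred fun p : List (Bool × ℕ) × (ℕ × List (Bool × ℕ)) =>
      expCancels (expMul ((true, 0) :: (List.range p.2.1).map fun _ => (true, 0)) p.1 ++
        expNeg (expMul ml p.2.2)) := by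
    refine (primrecPred_expCancels.comp ?_).computablePred
    refine Primrec.list_append.comp (primrec_expMul.comp ?_ Primrec.fst)
      (primrec_expNeg.comp (primrec_expMul.comp (Primrec.const ml)
        (Primrec.snd.comp Primrec.snd)))
    exact Primrec.list_cons.comp (Primrec.const _)
      (Primrec.list_map (Primrec.list_range.comp (Primrec.fst.comp Primrec.snd))
        (Primrec.const _).to₂)
  refine (rePred_exists (R := fun (L : List (Bool × ℕ)) (q : ℕ × List (Bool × ℕ)) => expCancels
    (expMul ((true, 0) :: (List.range q.1).map fun _ => (true, 0)) L ++
        expNeg (expMul ml q.2))) hR).of_eq fun L => ?_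
  have hone : ∀ c, expPoly ((true, 0) :: (List.range c).map fun _ => (true, 0)) =
      ((c + 1 : ℕ) : ℤ[X]) := by
    intro c
    simp [expPoly, sgn, add_comm]
  simp only [expCancels_iff, expPoly_append, expPoly_mul, expPoly_neg, hone]
  constructor
  · rintro ⟨⟨c, Q⟩, h⟩
    have h2 := congrArg (aeval δ) h
    simp only [map_add, map_mul, map_neg, map_natCast, hm0, zero_mul, neg_zero, add_zero,
      map_zero, aeval_expPoly] at h2
    exact (mul_eq_zero.1 h2).resolve_left (by positivity)
  · intro h
    rw [← aeval_expPoly] at h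
    obtain ⟨c, hc, Q, hQ⟩ := hm _ h
    obtain ⟨Ql, rfl⟩ := exists_expPoly_eq Q
    refine ⟨(c - 1, Ql), ?_⟩
    simp only [Nat.sub_add_cancel hc]
    rw [hQ, add_neg_cancel]

/-- A lower bound, in units of `2 ^ (-k * E)`, of the positive terms of `∑ ± δ ^ e`, where
`a / 2 ^ k` approximates `δ`. -/
def posLower (a k E : ℕ) (L : List (Bool × ℕ)) : ℕ :=
  (L.map fun x => bif x.1 then (a - 1) ^ x.2 * 2 ^ (k * (E - x.2)) else 0).sum

/-- An upper bound, in units of `2 ^ (-k * E)`, of the absolute value of the negative terms of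
`∑ ± δ ^ e`, where `a / 2 ^ k` approximates `δ`. -/
def negUpper (a k E : ℕ) (L : List (Bool × ℕ)) : ℕ :=
  (L.map fun x => bif x.1 then 0 else (a + 1) ^ x.2 * 2 ^ (k * (E - x.2))).sum

theorem negUpper_lt_posLower_iff {a k E : ℕ} {L : List (Bool × ℕ)} (hE : ∀ x ∈ L, x.2 ≤ E) :
    negUpper a k E L < posLower a k E L ↔
      0 < (L.map fun x => if x.1 then (((a - 1 : ℕ) : ℝ) / 2 ^ k) ^ x.2
        else -(((a + 1 : ℕ) : ℝ) / 2 ^ k) ^ x.2).sum := by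
  have key : ((posLower a k E L : ℝ) - negUpper a k E L) / 2 ^ (k * E) =
      (L.map fun x => if x.1 then (((a - 1 : ℕ) : ℝ) / 2 ^ k) ^ x.2
        else -(((a + 1 : ℕ) : ℝ) / 2 ^ k) ^ x.2).sum := by
    induction L with
    | nil => simp [posLower, negUpper]
    | cons x L ih =>
      have ih := ih fun y hy => hE y (List.mem_cons_of_mem _ hy)
      have hx : x.2 ≤ E := hE x List.mem_cons_self
      have h2 : (2 : ℝ) ^ (k * E) = (2 ^ k) ^ x.2 * 2 ^ (k * (E - x.2)) := by
        rw [← pow_mul, ← pow_add, ← mul_add, Nat.add_sub_cancel' hx]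
      rw [List.map_cons, List.sum_cons, ← ih]
      rcases x with ⟨b, e⟩
      have hp : (0 : ℝ) < 2 ^ k := by positivity
      have hq : (0 : ℝ) < 2 ^ (k * (E - e)) := by positivity
      cases b
      · simp only [posLower, negUpper, List.map_cons, List.sum_cons, cond_false, Nat.cast_add,
          Nat.cast_mul, Nat.cast_pow, Nat.cast_zero, Nat.cast_ofNat, Bool.false_eq_true, if_false]
        rw [h2, div_pow]
        field_simp
        ring
      · simp only [posLower, negUpper, List.map_cons, List.sum_cons, cond_true, Nat.cast_add,
          Nat.cast_mul, Nat.cast_pow, Nat.cast_zero, Nat.cast_ofNat, if_true]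
        rw [h2, div_pow]
        field_simp
        ring
  rw [← key, lt_div_iff₀ (by positivity), zero_mul, sub_pos, Nat.cast_lt]

theorem expVal_pos_of_lt {δ : ℝ} (hδ : 0 < δ) {a k E : ℕ} (ha : |δ - a / 2 ^ k| ≤ 1 / 2 ^ k)
    {L : List (Bool × ℕ)} (hE : ∀ x ∈ L, x.2 ≤ E)
    (h : negUpper a k E L < posLower a k E L) : 0 < expVal δ L := by
  refine ((negUpper_lt_posLower_iff hE).1 h).trans_le ?_
  rw [abs_le] at ha
  refine List.sum_le_sum fun x _ => ?_
  rcases x with ⟨b, e⟩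
  cases b
  · simp only [Bool.false_eq_true, if_false, sgn, cond_false, Int.cast_neg, Int.cast_one, neg_mul,
      one_mul, neg_le_neg_iff]
    gcongr
    rw [Nat.cast_add, Nat.cast_one, add_div]
    linarith
  · simp only [if_true, sgn, cond_true, Int.cast_one, one_mul]
    gcongr
    -- For `a = 0` the truncated `a - 1` is `0`, still a lower bound because `δ` is positive.
    rcases Nat.eq_zero_or_pos a with rfl | h0
    · simpa using hδ.le
    · rw [Nat.cast_sub h0, Nat.cast_one, sub_div]
      linarith

/-- Both `(a k - 1) / 2 ^ k` and `(a k + 1) / 2 ^ k` tend to `δ`, so the certified lower bound tends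
to `expVal δ L` and becomes positive. -/
theorem exists_lt_of_expVal_pos {δ : ℝ} (hδ : 0 < δ) {a : ℕ → ℕ}
    (ha : ∀ k, |δ - a k / 2 ^ k| ≤ 1 / 2 ^ k) {E : ℕ} {L : List (Bool × ℕ)}
    (hE : ∀ x ∈ L, x.2 ≤ E) (h : 0 < expVal δ L) :
    ∃ k, negUpper (a k) k E L < posLower (a k) k E L := by
  have h2 : Tendsto (fun k : ℕ => (1 : ℝ) / 2 ^ k) atTop (𝓝 0) := by
    simpa using tendsto_pow_atTop_nhds_zero_of_lt_one (r := (1 / 2 : ℝ)) (by norm_num)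
      (by norm_num)
  have hmid : Tendsto (fun k => (a k : ℝ) / 2 ^ k) atTop (𝓝 δ) := by
    have : Tendsto (fun k => δ - (a k : ℝ) / 2 ^ k) atTop (𝓝 0) :=
      squeeze_zero_norm (fun k => by simpa using ha k) h2
    simpa using this.const_sub δ
  have hhi : Tendsto (fun k => ((a k + 1 : ℕ) : ℝ) / 2 ^ k) atTop (𝓝 δ) := by
    have := hmid.add h2
    rw [add_zero] at this
    refine this.congr fun k => ?_
    rw [Nat.cast_add, Nat.cast_one, add_div]
  have hlo : Tendsto (fun k => ((a k - 1 : ℕ) : ℝ) / 2 ^ k) atTop (𝓝 δ) := by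
    have := hmid.sub h2
    rw [sub_zero] at this
    -- The truncated subtraction is exact once `a k ≥ 1`, which holds eventually since the limit `δ`
    -- is positive.
    refine this.congr' ?_
    filter_upwards [hmid.eventually (lt_mem_nhds hδ)] with k hk
    have h0 : 1 ≤ a k := by
      by_contra h0
      simp [show a k = 0 by omega] at hk
    rw [Nat.cast_sub h0, Nat.cast_one, sub_div]
  have hsum : Tendsto (fun k => (L.map fun x =>
      if x.1 then (((a k - 1 : ℕ) : ℝ) / 2 ^ k) ^ x.2
        else -(((a k + 1 : ℕ) : ℝ) / 2 ^ k) ^ x.2).sum) atTop (𝓝 (expVal δ L)) := by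
    clear h hE
    induction L with
    | nil => simp [expVal]
    | cons x L ih =>
      simp only [expVal, List.map_cons, List.sum_cons] at ih ⊢
      refine Tendsto.add ?_ ih
      rcases x with ⟨b, e⟩
      cases b
      · simpa [sgn] using (hhi.pow e).neg
      · simpa [sgn] using hlo.pow e
  obtain ⟨k, hk⟩ := (hsum.eventually (lt_mem_nhds h)).exists
  exact ⟨k, (negUpper_lt_posLower_iff hE).2 hk⟩

theorem computable_int_toNat : Computable Int.toNat := by
  have h : Primrec fun z : ℤ => (Encodable.encode z) := Primrec.encode
  have h2 : ∀ z : ℤ, Int.toNat z =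
      bif (Encodable.encode z).bodd then 0 else (Encodable.encode z).div2 := by
    intro z
    cases z with
    | ofNat n =>
      have : Encodable.encode (Int.ofNat n) = 2 * n := rfl
      rw [this]
      simp
    | negSucc n =>
      have : Encodable.encode (Int.negSucc n) = 2 * n + 1 := rfl
      rw [this]
      simp
  exact ((Primrec.cond (Primrec.nat_bodd.comp h) (Primrec.const 0)
    (Primrec.nat_div2.comp h)).of_eq fun z => (h2 z).symm).to_comp

/-- Replacing a negative approximation by `0` only brings it closer to a positive number. -/
theorem IsComputableReal.exists_nat {δ : ℝ} (hc : IsComputableReal δ) (hδ : 0 < δ) :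
    ∃ a : ℕ → ℕ, Computable a ∧ ∀ k, |δ - a k / 2 ^ k| ≤ 1 / 2 ^ k := by
  obtain ⟨f, hf, hfδ⟩ := hc
  refine ⟨fun k => (f k).toNat, computable_int_toNat.comp hf, fun k => ?_⟩
  rcases le_total 0 (f k) with h | h
  · have : (((f k).toNat : ℕ) : ℝ) = f k := by
      rw [← Int.cast_natCast, Int.toNat_of_nonneg h]
    rw [this]
    exact hfδ k
  · have h0 : (f k).toNat = 0 := Int.toNat_of_nonpos h
    have h1 := (abs_le.1 (hfδ k)).2
    have h2 : (f k : ℝ) / 2 ^ k ≤ 0 :=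
      div_nonpos_of_nonpos_of_nonneg (by exact_mod_cast h) (by positivity)
    simp only [h0, Nat.cast_zero, zero_div, sub_zero, abs_of_pos hδ]
    linarith

/-- The test, on rational approximations, that certifies `0 < ∑ ± δ ^ e`. -/
def approxPos (q : (ℕ × ℕ × ℕ) × List (Bool × ℕ)) : Bool :=
  decide (negUpper q.1.1 q.1.2.1 q.1.2.2 q.2 < posLower q.1.1 q.1.2.1 q.1.2.2 q.2)

theorem primrec_approxPos : Primrec approxPos := by
  have hterm : ∀ g : ℕ → ℕ, Primrec g → Primrec fun q : (ℕ × ℕ × ℕ) × ℕ =>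
      g q.1.1 ^ q.2 * 2 ^ (q.1.2.1 * (q.1.2.2 - q.2)) := by
    intro g hg
    refine Primrec.nat_mul.comp (primrec_nat_pow.comp (hg.comp (Primrec.fst.comp Primrec.fst))
      Primrec.snd) (primrec_nat_pow.comp (Primrec.const 2) (Primrec.nat_mul.comp
        (Primrec.fst.comp (Primrec.snd.comp Primrec.fst)) (Primrec.nat_sub.comp
          (Primrec.snd.comp (Primrec.snd.comp Primrec.fst)) Primrec.snd)))
  have hargs : Primrec fun q : ((ℕ × ℕ × ℕ) × List (Bool × ℕ)) × (Bool × ℕ) =>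
      (q.1.1, q.2.2) :=
    Primrec.pair (Primrec.fst.comp Primrec.fst) (Primrec.snd.comp Primrec.snd)
  have hsgn : Primrec fun q : ((ℕ × ℕ × ℕ) × List (Bool × ℕ)) × (Bool × ℕ) => q.2.1 :=
    Primrec.fst.comp Primrec.snd
  have hlow : Primrec fun q : (ℕ × ℕ × ℕ) × List (Bool × ℕ) =>
      posLower q.1.1 q.1.2.1 q.1.2.2 q.2 :=
    primrec_list_sum.comp (Primrec.list_map Primrec.snd
      (Primrec.cond hsgn ((hterm _ Primrec.pred).comp hargs) (Primrec.const 0)).to₂)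
  have hup : Primrec fun q : (ℕ × ℕ × ℕ) × List (Bool × ℕ) =>
      negUpper q.1.1 q.1.2.1 q.1.2.2 q.2 :=
    primrec_list_sum.comp (Primrec.list_map Primrec.snd
      (Primrec.cond hsgn (Primrec.const 0) ((hterm _ Primrec.succ).comp hargs)).to₂)
  exact (Primrec.nat_lt.comp hup hlow).decide

theorem rePred_expVal_pos {δ : ℝ} (hδ : 0 < δ) (hc : IsComputableReal δ) :
    REPred fun L => 0 < expVal δ L := by
  obtain ⟨a, hac, ha⟩ := hc.exists_nat hδ
  have hE : Primrec fun L : List (Bool × ℕ) => (L.map Prod.snd).sum :=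
    primrec_list_sum.comp (Primrec.list_map Primrec.id (Primrec.snd.comp Primrec.snd).to₂)
  have htest : Computable fun p : List (Bool × ℕ) × ℕ =>
      approxPos ((a p.2, p.2, (p.1.map Prod.snd).sum), p.1) := by
    have h1 : Computable fun p : List (Bool × ℕ) × ℕ => a p.2 := hac.comp Computable.snd
    have h2 : Computable fun p : List (Bool × ℕ) × ℕ => (p.1.map Prod.snd).sum :=
      (hE.comp Primrec.fst).to_comp
    have h3 : Computable fun p : List (Bool × ℕ) × ℕ => (p.2, (p.1.map Prod.snd).sum) :=
      Computable.pair Computable.snd h2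
    have harg : Computable fun p : List (Bool × ℕ) × ℕ =>
        ((a p.2, p.2, (p.1.map Prod.snd).sum), p.1) :=
      Computable.pair (Computable.pair h1 h3) Computable.fst
    exact primrec_approxPos.to_comp.comp harg
  have hbound : ∀ L : List (Bool × ℕ), ∀ x ∈ L, x.2 ≤ (L.map Prod.snd).sum := fun L x hx =>
    List.single_le_sum (fun _ _ => Nat.zero_le _) _ (List.mem_map_of_mem hx)
  refine (rePred_exists (R := fun (L : List (Bool × ℕ)) (k : ℕ) =>
    approxPos ((a k, k, (L.map Prod.snd).sum), L) = true) ?_).of_eq fun L => ?_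
  · exact ComputablePred.computable_iff.2 ⟨_, htest, rfl⟩
  simp only [approxPos, decide_eq_true_eq]
  constructor
  · rintro ⟨k, hk⟩
    exact expVal_pos_of_lt hδ (ha k) (hbound L) hk
  · exact exists_lt_of_expVal_pos hδ ha (hbound L)

/-- The sign of an integer polynomial at a positive computable real number is decidable. -/
theorem computablePred_expVal_pos {δ : ℝ} (hδ : 0 < δ) (hc : IsComputableReal δ) :
    ComputablePred fun L => 0 < expVal δ L := by
  have hpos := rePred_expVal_pos hδ hc
  refine ComputablePred.computable_iff_re_compl_re'.2 ⟨hpos, ?_⟩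
  -- By Post's theorem it suffices to enumerate the complement: a nonpositive value either vanishes
  -- or has a positive negative.
  refine (rePred_or (rePred_expVal_eq_zero δ)
    (rePred_comp hpos primrec_expNeg.to_comp)).of_eq fun L => ?_
  rw [expVal_neg, neg_pos, not_lt, le_iff_eq_or_lt]

end Sign

end LoopedNet

namespace LoopedNet

/-! ### Programs for a universal machine from prefix codes -/

/-- Decoding by exhaustive search: injectivity makes the first preimage found the only one. No
decoder has to be written for any of the codes below. -/
theorem exists_partrec_inverse {α β : Type*} [Primcodable α] [Primcodable β] {f : α → β}
    (hf : Computable f) (hinj : Function.Injective f) :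
    ∃ g : β →. α, Partrec g ∧ ∀ b a, a ∈ g b ↔ f a = b := by
  classical
  have h1 : Computable fun p : (β × ℕ) × α => f p.2 := hf.comp Computable.snd
  have h2 : Computable fun p : (β × ℕ) × α => decide (f p.2 = p.1.1) :=
    (Primrec.eq.decide.to_comp).comp h1 (Computable.fst.comp Computable.fst)
  have h3 : Computable fun p : (β × ℕ) × α =>
      bif decide (f p.2 = p.1.1) then some p.2 else none :=
    Computable.cond h2 (Computable.option_some.comp Computable.snd) (Computable.const none)
  have h4 : Computable fun p : β × ℕ => (Encodable.decode p.2 : Option α) :=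
    Computable.decode.comp Computable.snd
  have h5 : Computable₂ fun (b : β) (n : ℕ) => (Encodable.decode (α := α) n).bind fun a =>
      bif decide (f a = b) then some a else none :=
    Computable.option_bind h4 h3.to₂
  have key : ∀ (b : β) (n : ℕ) (a : α), a ∈ ((Encodable.decode (α := α) n).bind fun a =>
      bif decide (f a = b) then some a else none) → f a = b := by
    intro b n a h
    simp only [Option.mem_def, Option.bind_eq_some_iff] at h
    obtain ⟨a', _, h⟩ := h
    by_cases hb : f a' = b
    · simp only [hb, decide_true, cond_true, Option.some.injEq] at h
      rw [← h, hb]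
    · simp [hb] at h
  refine ⟨_, Partrec.rfindOpt h5, fun b a => ⟨fun h => ?_, fun h => ?_⟩⟩
  · obtain ⟨n, hn⟩ := Nat.rfindOpt_spec h
    exact key b n a hn
  · have hdom : (Nat.rfindOpt fun n => (Encodable.decode (α := α) n).bind fun a =>
        bif decide (f a = b) then some a else none).Dom :=
      Nat.rfindOpt_dom.2 ⟨Encodable.encode a, a, by simp [h]⟩
    obtain ⟨a', ha'⟩ := Part.dom_iff_mem.1 hdom
    obtain ⟨n, hn⟩ := Nat.rfindOpt_spec ha'
    have : a' = a := hinj ((key b n a' hn).trans h.symm)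
    exact this ▸ ha'

theorem kolmogorov_le {U : List Bool →. List Bool} {s p : List Bool} (h : s ∈ U p) :
    kolmogorov U s ≤ p.length :=
  Nat.sInf_le ⟨p, rfl, h⟩

/-- The outputs of a partial recursive function have complexity at most the length of a
prefix code of the argument, up to a constant. -/
theorem exists_kolmogorov_le {U : List Bool →. List Bool} (hU : IsUniversal U) {α : Type*}
    [Primcodable α] {enc : α → List Bool} (henc : Computable enc)
    (hpre : ∀ a b, enc a <+: enc b → a = b) {F : α →. List Bool} (hF : Partrec F) :
    ∃ c : ℕ, ∀ a s, s ∈ F a → kolmogorov U s ≤ (enc a).length + c := by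
  obtain ⟨g, hg, hgi⟩ := exists_partrec_inverse henc fun a b h => hpre a b (h ▸ List.prefix_rfl)
  -- This machine decodes its program and applies `F`. Its domain consists of code words, so it
  -- inherits prefix-freeness from `enc`.
  have hV : IsPrefixMachine fun p => (g p).bind F := by
    refine ⟨hg.bind (hF.comp Computable.snd).to₂, fun p hp q hq hpq => ?_⟩
    obtain ⟨a, ha⟩ := Part.dom_iff_mem.1 (Part.bind_dom.1 hp).1
    obtain ⟨b, hb⟩ := Part.dom_iff_mem.1 (Part.bind_dom.1 hq).1
    rw [hgi] at ha hb
    subst ha hb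
    rw [hpre a b hpq]
  obtain ⟨q, hq⟩ := hU.simulates _ hV
  refine ⟨q.length, fun a s hs => ?_⟩
  have : s ∈ U (q ++ enc a) := by
    rw [hq]
    exact Part.mem_bind_iff.2 ⟨a, (hgi _ _).2 rfl, hs⟩
  refine (kolmogorov_le this).trans ?_
  rw [List.length_append, add_comm]

/-! ### Straight-line programs over a computable real number -/

/-- An instruction of a straight-line program: destination, source, whether the source is the
constant `1`, whether it is a value of the previous round, and the sign. -/
abbrev Instr (α : Type*) := α × α × Bool × Bool × Bool

section Real

variable {α : Type*} [DecidableEq α]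

/-- The value that an instruction reads. -/
noncomputable def srcVal (P V : α → ℝ) (I : Instr α) : ℝ :=
  bif I.2.2.1 then 1 else bif I.2.2.2.1 then P I.2.1 else max (V I.2.1) 0

/-- One instruction adds `± δ` times the value read to its destination. -/
noncomputable def instrStep (δ : ℝ) (P V : α → ℝ) (I : Instr α) : α → ℝ :=
  Function.update V I.1 (V I.1 + sgn I.2.2.2.2 * δ * srcVal P V I)

/-- One round of a program, started with the values `V`. -/
noncomputable def execReal (δ : ℝ) (P V : α → ℝ) (prog : List (Instr α)) : α → ℝ :=
  prog.foldl (instrStep δ P) V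

/-- The values after `t` rounds. -/
noncomputable def progState (δ : ℝ) (prog : List (Instr α)) : ℕ → α → ℝ
  | 0 => 0
  | t + 1 => execReal δ (progState δ prog t) 0 prog

open Classical in
/-- The bits emitted in a sequence of states, read off at `emit` and `bit`. -/
noncomputable def emittedBits (emit bit : ℕ → ℝ) : ℕ → List Bool
  | 0 => []
  | t + 1 => emittedBits emit bit t ++
      if 0 < emit (t + 1) then [decide (0 < bit (t + 1))] else []

end Real

/-! ### Exact symbolic execution of programs over polynomials in `δ` -/

section Symbolic

/-- The signed exponents stored for a name. -/
def envAt {α : Type*} [DecidableEq α] (E : List (α × Bool × ℕ)) (a : α) : List (Bool × ℕ) :=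
  E.filterMap fun x => bif x.1 = a then some x.2 else none

variable (pos : List (Bool × ℕ) → Bool) {α : Type*} [DecidableEq α]

/-- The polynomial that an instruction reads. -/
def srcExp (P V : List (α × Bool × ℕ)) (I : Instr α) : List (Bool × ℕ) :=
  bif I.2.2.1 then [(true, 0)] else bif I.2.2.2.1 then envAt P I.2.1 else
    bif pos (envAt V I.2.1) then envAt V I.2.1 else []

/-- Symbolic execution of an instruction. -/
def instrExp (P V : List (α × Bool × ℕ)) (I : Instr α) : List (α × Bool × ℕ) :=
  V ++ (srcExp pos P V I).map fun y => (I.1, y.1 == I.2.2.2.2, y.2 + 1)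

/-- Symbolic execution of a round. -/
def execExp (P V : List (α × Bool × ℕ)) (prog : List (Instr α)) : List (α × Bool × ℕ) :=
  prog.foldl (instrExp pos P) V

/-- Symbolic state after `t` rounds. -/
def progStateExp (prog : List (Instr α)) (t : ℕ) : List (α × Bool × ℕ) :=
  Nat.rec [] (fun _ P => execExp pos P [] prog) t

/-- Bits emitted by the symbolic execution. -/
def emittedExp (emit bit : α) (prog : List (Instr α)) (t : ℕ) : List Bool :=
  Nat.rec [] (fun t l => l ++ bif pos (envAt (progStateExp pos prog (t + 1)) emit)
    then [pos (envAt (progStateExp pos prog (t + 1)) bit)] else []) t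

/-- The output of a program. -/
def progOutput (halt emit bit : α) (prog : List (Instr α)) : Part (List Bool) :=
  (Nat.rfind fun t => Part.some (pos (envAt (progStateExp pos prog (t + 1)) halt))).map
    fun t => emittedExp pos emit bit prog t

variable {pos} {δ : ℝ}

/-- The real values denoted by a symbolic environment. -/
noncomputable def envVal (δ : ℝ) (E : List (α × Bool × ℕ)) (a : α) : ℝ := expVal δ (envAt E a)

/-- Within a round, ReLU is the only operation that needs a numerical value, and it needs only the
sign. Everything else is formal arithmetic with signed exponents. -/
theorem srcVal_envVal (hpos : ∀ L, pos L = true ↔ 0 < expVal δ L)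
    (P V : List (α × Bool × ℕ)) (I : Instr α) :
    srcVal (envVal δ P) (envVal δ V) I = expVal δ (srcExp pos P V I) := by
  rcases I with ⟨d, s, c, p, b⟩
  cases c <;> cases p <;> simp only [srcVal, srcExp, cond_true, cond_false, envVal]
  · by_cases h : 0 < expVal δ (envAt V s)
    · rw [(hpos _).2 h, max_eq_left h.le, cond_true]
    · have : pos (envAt V s) = false := by rwa [← Bool.not_eq_true, hpos]
      rw [this, max_eq_right (not_lt.1 h), cond_false]
      simp [expVal]
  all_goals simp [expVal, sgn]

theorem instrStep_envVal (hpos : ∀ L, pos L = true ↔ 0 < expVal δ L)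
    (P V : List (α × Bool × ℕ)) (I : Instr α) :
    instrStep δ (envVal δ P) (envVal δ V) I = envVal δ (instrExp pos P V I) := by
  funext a
  have h1 : ∀ L : List (Bool × ℕ),
      expVal δ (L.map fun y => (y.1 == I.2.2.2.2, y.2 + 1)) =
        sgn I.2.2.2.2 * δ * expVal δ L := by
    intro L
    induction L with
    | nil => simp [expVal]
    | cons y L ih =>
      simp only [expVal, List.map_cons, List.sum_cons] at ih ⊢
      rw [ih, sgn_beq]
      push_cast
      ring
  rw [instrStep, srcVal_envVal hpos]
  by_cases h : a = I.1
  · subst h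
    simp only [Function.update_self, envVal, instrExp, envAt, List.filterMap_append,
      List.filterMap_map, expVal_append]
    congr 1
    rw [← h1]
    congr 1
    rw [← List.filterMap_eq_map]
    congr 1
    funext y
    simp
  · rw [Function.update_of_ne h]
    have : List.filterMap (fun x : α × Bool × ℕ => bif x.1 = a then some x.2 else none)
        ((srcExp pos P V I).map fun y => (I.1, y.1 == I.2.2.2.2, y.2 + 1)) = [] := by
      rw [List.filterMap_map, List.filterMap_eq_nil_iff]
      intro y _
      simp [Ne.symm h]
    simp only [envVal, instrExp, envAt, List.filterMap_append, this, List.append_nil]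

theorem execReal_envVal (hpos : ∀ L, pos L = true ↔ 0 < expVal δ L)
    (P V : List (α × Bool × ℕ)) (prog : List (Instr α)) :
    execReal δ (envVal δ P) (envVal δ V) prog = envVal δ (execExp pos P V prog) := by
  induction prog generalizing V with
  | nil => rfl
  | cons I prog ih =>
    simp only [execReal, execExp, List.foldl_cons] at ih ⊢
    rw [instrStep_envVal hpos, ih]

theorem progState_eq (hpos : ∀ L, pos L = true ↔ 0 < expVal δ L) (prog : List (Instr α)) (t : ℕ) :
    progState δ prog t = envVal δ (progStateExp pos prog t) := by
  have h0 : envVal δ ([] : List (α × Bool × ℕ)) = 0 := by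
    funext a
    simp [envVal, envAt, expVal]
  induction t with
  | zero => exact h0.symm
  | succ t ih =>
    rw [progState, ih, ← h0, execReal_envVal hpos]
    rfl

/-- Halt, emit and bit are sign tests too, so the symbolic run takes the same decisions as the real
one. -/
theorem mem_progOutput (hpos : ∀ L, pos L = true ↔ 0 < expVal δ L) {halt emit bit : α}
    {prog : List (Instr α)} {t : ℕ} (h1 : 0 < progState δ prog (t + 1) halt)
    (h2 : ∀ i < t, ¬ 0 < progState δ prog (i + 1) halt) :
    emittedBits (fun i => progState δ prog i emit) (fun i => progState δ prog i bit) t ∈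
      progOutput pos halt emit bit prog := by
  have hb : ∀ i a, pos (envAt (progStateExp pos prog i) a) = true ↔ 0 < progState δ prog i a := by
    intro i a
    rw [hpos, progState_eq hpos]
    rfl
  refine (Part.mem_map_iff _).2 ⟨t, ?_, ?_⟩
  · refine Nat.mem_rfind.2 ⟨?_, fun {m} hm => ?_⟩
    · rw [Part.mem_some_iff, eq_comm, hb]
      exact h1
    · rw [Part.mem_some_iff, eq_comm, ← Bool.not_eq_true, hb]
      exact h2 m hm
  · clear h1 h2
    induction t with
    | zero => rfl
    | succ t ih =>
      rw [emittedBits, ← ih]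
      change emittedExp pos emit bit prog t ++ _ = _
      congr 1
      by_cases h : 0 < progState δ prog (t + 1) emit
      · rw [(hb _ _).2 h, if_pos h, cond_true]
        congr 1
        rw [Bool.eq_iff_iff, hb, decide_eq_true_iff]
      · have h' := h
        rw [← hb, Bool.not_eq_true] at h'
        rw [if_neg h, h', cond_false]

end Symbolic

/-! ### Computability of the symbolic execution -/

section Computability

/-- A recursion on the index into the list. The version for computable steps is needed because the
sign test is known only to be computable, not primitive recursive. -/
theorem computable_list_foldl {α β σ : Type*} [Primcodable α] [Primcodable β] [Primcodable σ]
    {f : α → List β} {g : α → σ} {h : α → σ × β → σ} (hf : Computable f) (hg : Computable g)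
    (hh : Computable₂ h) : Computable fun a => (f a).foldl (fun s b => h a (s, b)) (g a) := by
  have h1 : Computable₂ fun (a : α) (p : ℕ × σ) =>
      (Option.casesOn ((f a)[p.1]?) p.2 fun b => h a (p.2, b) : σ) := by
    have ha : Computable fun q : α × ℕ × σ => (f q.1)[q.2.1]? :=
      Computable.list_getElem?.comp (hf.comp Computable.fst) (Computable.fst.comp Computable.snd)
    have hb : Computable fun q : (α × ℕ × σ) × β => h q.1.1 (q.1.2.2, q.2) :=
      hh.comp (Computable.fst.comp Computable.fst)
        (Computable.pair (Computable.snd.comp (Computable.snd.comp Computable.fst))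
          Computable.snd)
    exact Computable.option_casesOn ha (Computable.snd.comp Computable.snd) hb.to₂
  refine (Computable.nat_rec (Computable.list_length.comp hf) hg h1).of_eq fun a => ?_
  have key : ∀ n ≤ (f a).length, (Nat.rec (g a) (fun i s =>
      (Option.casesOn ((f a)[i]?) s fun b => h a (s, b) : σ)) n : σ) =
        ((f a).take n).foldl (fun s b => h a (s, b)) (g a) := by
    intro n
    induction n with
    | zero => intro _; simp
    | succ n ih =>
      intro hn
      change (Option.casesOn ((f a)[n]?) _ _ : σ) = _
      rw [List.take_add_one, List.foldl_append, ← ih (by omega),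
        List.getElem?_eq_getElem (show n < (f a).length by omega)]
      rfl
  rw [key _ le_rfl, List.take_length]

variable {α : Type*} [DecidableEq α] [Primcodable α]

theorem primrec_envAt : Primrec₂ (envAt : List (α × Bool × ℕ) → α → List (Bool × ℕ)) := by
  refine Primrec.listFilterMap Primrec.fst ?_
  have h1 : Primrec fun q : (List (α × Bool × ℕ) × α) × (α × Bool × ℕ) =>
      decide (q.2.1 = q.1.2) :=
    Primrec.eq.decide.comp (Primrec.fst.comp Primrec.snd) (Primrec.snd.comp Primrec.fst)
  exact (Primrec.cond h1 (Primrec.option_some.comp (Primrec.snd.comp Primrec.snd))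
    (Primrec.const none)).to₂

variable {pos : List (Bool × ℕ) → Bool}

theorem computable_instrExp (hpos : Computable pos) {β : Type*} [Primcodable β]
    {P V : β → List (α × Bool × ℕ)} {I : β → Instr α} (hP : Computable P) (hV : Computable V)
    (hI : Computable I) : Computable fun q => instrExp pos (P q) (V q) (I q) := by
  have hs : Computable fun q => (I q).2.1 := Computable.fst.comp (Computable.snd.comp hI)
  have hPs : Computable fun q => envAt (P q) (I q).2.1 := primrec_envAt.to_comp.comp hP hs
  have hVs : Computable fun q => envAt (V q) (I q).2.1 := primrec_envAt.to_comp.comp hV hs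
  have hc : Computable fun q => (I q).2.2.1 :=
    Computable.fst.comp (Computable.snd.comp (Computable.snd.comp hI))
  have hp : Computable fun q => (I q).2.2.2.1 :=
    Computable.fst.comp (Computable.snd.comp (Computable.snd.comp (Computable.snd.comp hI)))
  have hsrc : Computable fun q => srcExp pos (P q) (V q) (I q) :=
    Computable.cond hc (Computable.const _)
      (Computable.cond hp hPs (Computable.cond (hpos.comp hVs) hVs (Computable.const _)))
  have hmap : Primrec₂ fun (I : Instr α) (L : List (Bool × ℕ)) =>
      L.map fun y => (I.1, y.1 == I.2.2.2.2, y.2 + 1) := by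
    refine Primrec.list_map Primrec.snd ?_
    have hI : Primrec fun q : (Instr α × List (Bool × ℕ)) × (Bool × ℕ) => q.1.1 :=
      Primrec.fst.comp Primrec.fst
    exact (Primrec.pair (Primrec.fst.comp hI) (Primrec.pair
      (Primrec.beq.comp (Primrec.fst.comp Primrec.snd)
        (Primrec.snd.comp (Primrec.snd.comp (Primrec.snd.comp (Primrec.snd.comp hI)))))
      (Primrec.succ.comp (Primrec.snd.comp Primrec.snd)))).to₂
  exact Computable.list_append.comp hV (hmap.to_comp.comp hI hsrc)

theorem computable_execExp (hpos : Computable pos) {β : Type*} [Primcodable β]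
    {P : β → List (α × Bool × ℕ)} {prog : β → List (Instr α)} (hP : Computable P)
    (hprog : Computable prog) : Computable fun q => execExp pos (P q) [] (prog q) := by
  have h : Computable fun q : β × (List (α × Bool × ℕ) × Instr α) =>
      instrExp pos (P q.1) q.2.1 q.2.2 :=
    computable_instrExp hpos (hP.comp Computable.fst) (Computable.fst.comp Computable.snd)
      (Computable.snd.comp Computable.snd)
  exact computable_list_foldl hprog (Computable.const []) h.to₂

theorem computable_progStateExp (hpos : Computable pos) :
    Computable₂ fun (prog : List (Instr α)) (t : ℕ) => progStateExp pos prog t := by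
  have h : Computable fun q : (List (Instr α) × ℕ) × (ℕ × List (α × Bool × ℕ)) =>
      execExp pos q.2.2 [] q.1.1 :=
    computable_execExp hpos (Computable.snd.comp Computable.snd)
      (Computable.fst.comp Computable.fst)
  exact Computable.nat_rec Computable.snd (Computable.const []) h.to₂

theorem computable_pos_progStateExp (hpos : Computable pos) (a : α) :
    Computable₂ fun (prog : List (Instr α)) (t : ℕ) =>
      pos (envAt (progStateExp pos prog (t + 1)) a) := by
  have h : Computable fun q : List (Instr α) × ℕ => progStateExp pos q.1 (q.2 + 1) :=
    (computable_progStateExp hpos).comp Computable.fst (Computable.succ.comp Computable.snd)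
  exact (hpos.comp (primrec_envAt.to_comp.comp h (Computable.const a))).to₂

theorem computable_emittedExp (hpos : Computable pos) (emit bit : α) :
    Computable₂ fun (prog : List (Instr α)) (t : ℕ) => emittedExp pos emit bit prog t := by
  have harg : Computable fun q : (List (Instr α) × ℕ) × (ℕ × List Bool) => (q.1.1, q.2.1) :=
    Computable.pair (Computable.fst.comp Computable.fst) (Computable.fst.comp Computable.snd)
  have he := (computable_pos_progStateExp hpos emit).comp (Computable.fst.comp harg)
    (Computable.snd.comp harg)
  have hb := (computable_pos_progStateExp hpos bit).comp (Computable.fst.comp harg)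
    (Computable.snd.comp harg)
  have h : Computable fun q : (List (Instr α) × ℕ) × (ℕ × List Bool) =>
      q.2.2 ++ bif pos (envAt (progStateExp pos q.1.1 (q.2.1 + 1)) emit)
        then [pos (envAt (progStateExp pos q.1.1 (q.2.1 + 1)) bit)] else [] :=
    Computable.list_append.comp (Computable.snd.comp Computable.snd)
      (Computable.cond he (Computable.list_cons.comp hb (Computable.const []))
        (Computable.const []))
  exact Computable.nat_rec Computable.snd (Computable.const []) h.to₂

theorem partrec_progOutput (hpos : Computable pos) (halt emit bit : α) :
    Partrec fun prog : List (Instr α) => progOutput pos halt emit bit prog :=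
  (Partrec.rfind (computable_pos_progStateExp hpos halt).partrec₂).map
    (computable_emittedExp hpos emit bit)

end Computability

/-! ### A prefix code for programs -/

section Code

/-- A self-delimiting code of binary strings. -/
def encName : List Bool → List Bool
  | [] => [false]
  | b :: l => true :: b :: encName l

/-- A self-delimiting code of instructions whose names are binary strings. -/
def encInstr (I : Instr (List Bool)) : List Bool :=
  encName I.1 ++ (encName I.2.1 ++ [I.2.2.1, I.2.2.2.1, I.2.2.2.2])

/-- A self-delimiting code of programs whose names are binary strings. -/
def encProg : List (Instr (List Bool)) → List Bool
  | [] => [false]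
  | I :: l => true :: (encInstr I ++ encProg l)

theorem length_encName (l : List Bool) : (encName l).length = 2 * l.length + 1 := by
  induction l with
  | nil => rfl
  | cons b l ih => simp only [encName, List.length_cons, ih]; ring

theorem encName_append_inj {a b r r' : List Bool} (h : encName a ++ r = encName b ++ r') :
    a = b ∧ r = r' := by
  induction a generalizing b with
  | nil => cases b <;> simp_all [encName]
  | cons x a ih =>
    cases b with
    | nil => simp [encName] at h
    | cons y b =>
      simp only [encName, List.cons_append, List.cons.injEq, true_and] at h
      obtain ⟨h1, h2⟩ := ih h.2
      exact ⟨by rw [h.1, h1], h2⟩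

/-- A code announces its own end, so it can be split off from whatever follows. The arbitrary
remainders carry the induction and give prefix-freeness. -/
theorem encProg_append_inj {a b : List (Instr (List Bool))} {r r' : List Bool}
    (h : encProg a ++ r = encProg b ++ r') : a = b ∧ r = r' := by
  induction a generalizing b with
  | nil => cases b <;> simp_all [encProg]
  | cons I a ih =>
    cases b with
    | nil => simp [encProg] at h
    | cons J b =>
      simp only [encProg, encInstr, List.cons_append, List.append_assoc, List.cons.injEq,
        true_and] at h
      obtain ⟨h1, h⟩ := encName_append_inj h
      obtain ⟨h2, h⟩ := encName_append_inj h
      simp only [List.cons.injEq, List.nil_append] at h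
      obtain ⟨h6, h7⟩ := ih h.2.2.2
      refine ⟨?_, h7⟩
      rw [h6]
      congr 1
      ext1
      · exact h1
      · ext1
        · exact h2
        · ext1
          · exact h.1
          · ext1
            · exact h.2.1
            · exact h.2.2.1

theorem encProg_prefix {a b : List (Instr (List Bool))} (h : encProg a <+: encProg b) :
    a = b := by
  obtain ⟨t, ht⟩ := h
  exact (encProg_append_inj (ht.trans (List.append_nil _).symm)).1

theorem primrec_encName : Primrec encName := by
  refine (Primrec.list_foldr (f := id) (g := fun _ => [false])
    (h := fun _ p => true :: p.1 :: p.2) Primrec.id (Primrec.const _) ?_).of_eq fun l => ?_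
  · exact (Primrec.list_cons.comp (Primrec.const true) (Primrec.list_cons.comp
      (Primrec.fst.comp Primrec.snd) (Primrec.snd.comp Primrec.snd))).to₂
  · induction l with
    | nil => rfl
    | cons b l ih => simpa [encName] using ih

theorem primrec_encInstr : Primrec encInstr := by
  have h2 : Primrec fun I : Instr (List Bool) => I.2.2 := Primrec.snd.comp Primrec.snd
  have hb : Primrec fun q : Bool × Bool × Bool => [q.1, q.2.1, q.2.2] := Primrec.dom_finite _
  exact Primrec.list_append.comp (primrec_encName.comp Primrec.fst)
    (Primrec.list_append.comp (primrec_encName.comp (Primrec.fst.comp Primrec.snd))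
      (hb.comp h2))

theorem primrec_encProg : Primrec encProg := by
  refine (Primrec.list_foldr (f := id) (g := fun _ => [false])
    (h := fun _ p => true :: (encInstr p.1 ++ p.2)) Primrec.id (Primrec.const _) ?_).of_eq
      fun l => ?_
  · exact (Primrec.list_cons.comp (Primrec.const true) (Primrec.list_append.comp
      (primrec_encInstr.comp (Primrec.fst.comp Primrec.snd))
      (Primrec.snd.comp Primrec.snd))).to₂
  · induction l with
    | nil => rfl
    | cons b l ih => simpa [encProg] using ih

theorem length_encProg_le {prog : List (Instr (List Bool))} {b : ℕ}
    (h : ∀ I ∈ prog, I.1.length ≤ b ∧ I.2.1.length ≤ b) :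
    (encProg prog).length ≤ prog.length * (4 * b + 6) + 1 := by
  induction prog with
  | nil => simp [encProg]
  | cons I prog ih =>
    have h1 := h I List.mem_cons_self
    have h2 := ih fun J hJ => h J (List.mem_cons_of_mem _ hJ)
    simp only [encProg, encInstr, List.length_cons, List.length_append, length_encName,
      List.length_nil]
    rw [add_mul]
    omega

end Code

end LoopedNet

namespace LoopedNet

/-! ### Networks as straight-line programs -/

section Flatten

theorem sum_map_flatMap {α β : Type*} (l : List α) (f : α → List β) (g : β → ℝ) :
    ((l.flatMap f).map g).sum = (l.map fun x => ((f x).map g).sum).sum := by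
  induction l with
  | nil => rfl
  | cons x l ih => simp [ih]

variable {α : Type*}

/-- The instructions of a parameter `w ∈ δℤ`. -/
noncomputable def paramProg (δ w : ℝ) (d s : α) (c p : Bool) : List (Instr α) :=
  List.replicate ⌊w / δ⌋.natAbs (d, s, c, p, decide (0 ≤ ⌊w / δ⌋))

theorem mem_paramProg {δ w : ℝ} {d s : α} {c p : Bool} {I : Instr α}
    (h : I ∈ paramProg δ w d s c p) : I.1 = d ∧ I.2.1 = s ∧ I.2.2.1 = c ∧ I.2.2.2.1 = p := by
  rw [List.eq_of_mem_replicate h]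
  exact ⟨rfl, rfl, rfl, rfl⟩

/-- The instructions of an affine layer. Each source comes with a Boolean which tells whether it
is a value of the previous round. -/
noncomputable def layerProg (δ : ℝ) {m k : ℕ} (W : Matrix (Fin k) (Fin m) ℝ) (b : Fin k → ℝ)
    (src : Fin m → α × Bool) (dst : Fin k → α) : List (Instr α) :=
  ((List.finRange k).flatMap fun i => (List.finRange m).flatMap fun j =>
      paramProg δ (W i j) (dst i) (src j).1 false (src j).2) ++
    (List.finRange k).flatMap fun i => paramProg δ (b i) (dst i) (dst i) true false

theorem mem_layerProg {δ : ℝ} {m k : ℕ} {W : Matrix (Fin k) (Fin m) ℝ} {b : Fin k → ℝ}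
    {src : Fin m → α × Bool} {dst : Fin k → α} {I : Instr α}
    (h : I ∈ layerProg δ W b src dst) :
    (∃ i, I.1 = dst i) ∧
      (I.2.2.1 = false → ∃ j, I.2.1 = (src j).1 ∧ I.2.2.2.1 = (src j).2) := by
  simp only [layerProg, List.mem_append, List.mem_flatMap, List.mem_finRange, true_and] at h
  rcases h with ⟨i, j, h⟩ | ⟨i, h⟩
  · obtain ⟨h1, h2, _, h4⟩ := mem_paramProg h
    exact ⟨⟨i, h1⟩, fun _ => ⟨j, h2, h4⟩⟩
  · obtain ⟨h1, _, h3, _⟩ := mem_paramProg h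
    exact ⟨⟨i, h1⟩, fun h => by simp [h3] at h⟩

/-- The number of instructions is the sum of the absolute values of the integers `w / δ`. -/
theorem length_layerProg (δ : ℝ) {m k : ℕ} (W : Matrix (Fin k) (Fin m) ℝ) (b : Fin k → ℝ)
    (src : Fin m → α × Bool) (dst : Fin k → α) :
    (layerProg δ W b src dst).length =
      ((layerParams W b).map fun w => ⌊w / δ⌋.natAbs).sum := by
  simp only [layerProg, layerParams, paramProg, List.length_append, List.length_flatMap,
    List.length_replicate, List.map_append, List.sum_append, List.map_flatten, List.sum_flatten,
    List.map_ofFn, Function.comp_def, List.sum_ofFn, ← Fin.sum_univ_def]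

variable [DecidableEq α]

theorem execReal_append (δ : ℝ) (P V : α → ℝ) (l l' : List (Instr α)) :
    execReal δ P V (l ++ l') = execReal δ P (execReal δ P V l) l' :=
  List.foldl_append

/-- No value of the current round is both read and written here. So every instruction reads its
source as it was in `V`, and the contributions simply add up. -/
theorem execReal_apply {δ : ℝ} {P : α → ℝ} {prog : List (Instr α)}
    (h : ∀ I ∈ prog, ∀ J ∈ prog, J.2.2.1 = false → J.2.2.2.1 = false → J.2.1 ≠ I.1)
    (V : α → ℝ) (a : α) :
    execReal δ P V prog a =
      V a + (prog.map fun I => if I.1 = a then sgn I.2.2.2.2 * δ * srcVal P V I else 0).sum := by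
  induction prog generalizing V with
  | nil => simp [execReal]
  | cons I prog ih =>
    have ih := ih (fun J hJ K hK => h J (List.mem_cons_of_mem _ hJ) K (List.mem_cons_of_mem _ hK))
      (instrStep δ P V I)
    have hsrc : ∀ J ∈ prog, srcVal P (instrStep δ P V I) J = srcVal P V J := by
      intro J hJ
      have h1 := h I List.mem_cons_self J (List.mem_cons_of_mem _ hJ)
      rcases J with ⟨d, s, c, p, b⟩
      cases c <;> cases p <;> simp only [srcVal, cond_true, cond_false]
      rw [instrStep, Function.update_of_ne (h1 rfl rfl)]
    have hmap : (prog.map fun J => if J.1 = a then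
          sgn J.2.2.2.2 * δ * srcVal P (instrStep δ P V I) J else 0) =
        prog.map fun J => if J.1 = a then sgn J.2.2.2.2 * δ * srcVal P V J else 0 :=
      List.map_congr_left fun J hJ => by rw [hsrc J hJ]
    have hcons : execReal δ P V (I :: prog) = execReal δ P (instrStep δ P V I) prog := rfl
    rw [hcons, ih, hmap, List.map_cons, List.sum_cons, ← add_assoc]
    congr 1
    by_cases ha : I.1 = a
    · subst ha
      simp [instrStep]
    · rw [if_neg ha, add_zero, instrStep, Function.update_of_ne (Ne.symm ha)]

/-- A weight `δ z` acts as `|z|` instructions of weight `± δ`. In particular a zero weight costs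
nothing. -/
theorem sum_paramProg {δ w : ℝ} (hδ : 0 < δ) (hw : ∃ z : ℤ, w = δ * z) (d s : α) (c p : Bool)
    (P V : α → ℝ) (a : α) :
    ((paramProg δ w d s c p).map fun I =>
      if I.1 = a then sgn I.2.2.2.2 * δ * srcVal P V I else 0).sum =
        if d = a then w * (bif c then 1 else bif p then P s else max (V s) 0) else 0 := by
  obtain ⟨z, rfl⟩ := hw
  have hz : ⌊δ * z / δ⌋ = z := by
    rw [mul_div_cancel_left₀ _ hδ.ne', Int.floor_intCast]
  rw [paramProg, hz, List.map_replicate, List.sum_replicate]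
  split_ifs
  · rw [nsmul_eq_mul, srcVal, ← mul_assoc]
    congr 1
    rw [mul_comm δ, ← mul_assoc]
    congr 1
    rcases le_total 0 z with h | h
    · rw [decide_eq_true h, Nat.cast_natAbs, abs_of_nonneg h]
      simp [sgn]
    · rcases h.eq_or_lt with rfl | h
      · simp
      · rw [decide_eq_false (not_le.2 h), Nat.cast_natAbs, abs_of_neg h]
        simp [sgn]
  · simp

theorem execReal_layerProg {δ : ℝ} (hδ : 0 < δ) {m k : ℕ} {W : Matrix (Fin k) (Fin m) ℝ}
    {b : Fin k → ℝ} {src : Fin m → α × Bool} {dst : Fin k → α}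
    (hW : ∀ i j, ∃ z : ℤ, W i j = δ * z) (hb : ∀ i, ∃ z : ℤ, b i = δ * z)
    (hsrc : ∀ j, (src j).2 = false → ∀ i, (src j).1 ≠ dst i) (P V : α → ℝ) (a : α) :
    execReal δ P V (layerProg δ W b src dst) a = V a + ∑ i, if dst i = a then
      (W.mulVec (fun j => bif (src j).2 then P (src j).1 else max (V (src j).1) 0) + b) i
        else 0 := by
  rw [execReal_apply]
  · congr 1
    simp only [layerProg, List.map_append, List.sum_append, sum_map_flatMap,
      sum_paramProg hδ (hW _ _), sum_paramProg hδ (hb _), ← Fin.sum_univ_def,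
      ← Finset.sum_add_distrib]
    refine Finset.sum_congr rfl fun i _ => ?_
    split_ifs
    · simp [Matrix.mulVec, dotProduct]
    · simp
  · intro I hI J hJ hc hp
    obtain ⟨⟨i, hi⟩, _⟩ := mem_layerProg hI
    obtain ⟨_, h⟩ := mem_layerProg hJ
    obtain ⟨j, hj1, hj2⟩ := h hc
    rw [hi, hj1]
    exact hsrc j (hj2 ▸ hp) i

/-- The instructions of a network. Names are pairs of a layer and an index; the names of the
output layer have first component `0`. -/
noncomputable def FFNet.prog (δ : ℝ) : {m k : ℕ} → FFNet m k → ℕ → (Fin m → (ℕ × ℕ) × Bool) →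
    List (Instr (ℕ × ℕ))
  | _, _, .last W b, _, src => layerProg δ W b src fun i => (0, i)
  | _, _, .cons W b rest, l, src => layerProg δ W b src (fun i => (l, i)) ++
      rest.prog δ (l + 1) fun i => ((l, i), false)

theorem FFNet.length_prog (δ : ℝ) {m k : ℕ} (N : FFNet m k) (l : ℕ)
    (src : Fin m → (ℕ × ℕ) × Bool) :
    (N.prog δ l src).length = (N.params.map fun w => ⌊w / δ⌋.natAbs).sum := by
  induction N generalizing l with
  | last W b => exact length_layerProg δ W b _ _
  | cons W b rest ih =>
    simp only [FFNet.prog, FFNet.params, List.length_append, length_layerProg, List.map_append,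
      List.sum_append, ih]

theorem mem_layerParams {m k : ℕ} (W : Matrix (Fin k) (Fin m) ℝ) (b : Fin k → ℝ) :
    (∀ i j, W i j ∈ layerParams W b) ∧ ∀ i, b i ∈ layerParams W b := by
  refine ⟨fun i j => ?_, fun i => ?_⟩
  · refine List.mem_append_left _ (List.mem_flatten.2 ⟨List.ofFn (W i), ?_, ?_⟩)
    · exact List.mem_ofFn.2 ⟨i, rfl⟩
    · exact List.mem_ofFn.2 ⟨j, rfl⟩
  · exact List.mem_append_right _ (by simp [List.mem_ofFn])

/-- The invariant that passes from layer `l` to layer `l + 1`: current-round sources have first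
component strictly between `0` and `l`, while the names of the output layer and of all layers from
`l` on still hold `0`. -/
theorem FFNet.execReal_prog {δ : ℝ} (hδ : 0 < δ) {m k : ℕ} (N : FFNet m k)
    (hN : ∀ a ∈ N.params, ∃ z : ℤ, a = δ * z) (l : ℕ) (hl : 0 < l)
    (src : Fin m → (ℕ × ℕ) × Bool)
    (hsrc : ∀ j, (src j).2 = false → 0 < (src j).1.1 ∧ (src j).1.1 < l) (P V : ℕ × ℕ → ℝ)
    (hV : ∀ a : ℕ × ℕ, a.1 = 0 ∨ l ≤ a.1 → V a = 0) (i : Fin k) :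
    execReal δ P V (N.prog δ l src) (0, i) =
      N.eval (fun j => bif (src j).2 then P (src j).1 else max (V (src j).1) 0) i := by
  induction N generalizing l V with
  | last W b =>
    obtain ⟨h1, h2⟩ := mem_layerParams W b
    rw [FFNet.prog, execReal_layerProg hδ (fun i j => hN _ (h1 i j)) (fun i => hN _ (h2 i)),
      hV _ (Or.inl rfl), zero_add, Finset.sum_eq_single i]
    · rw [if_pos rfl, FFNet.eval]
    · intro j _ hj
      rw [if_neg fun h => hj (Fin.ext (by simpa using h))]
    · simp
    · intro j hj i' h
      have := (hsrc j hj).1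
      rw [h] at this
      exact this.ne rfl
  | @cons m n k W b rest ih =>
    obtain ⟨h1, h2⟩ := mem_layerParams W b
    have hlayer := execReal_layerProg hδ (dst := fun i : Fin n => (l, (i : ℕ)))
      (fun i j => hN _ (List.mem_append_left _ (h1 i j)))
      (fun i => hN _ (List.mem_append_left _ (h2 i)))
      (fun j hj i' h => by
        have := (hsrc j hj).2
        rw [h] at this
        exact this.ne rfl) P V
    rw [FFNet.prog, execReal_append, ih (fun a ha => hN a (List.mem_append_right _ ha)) _
      (Nat.succ_pos l)]
    · simp only [cond_false, FFNet.eval]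
      congr 1
      funext i
      rw [hlayer, hV _ (Or.inr le_rfl), zero_add, Finset.sum_eq_single i]
      · rw [if_pos rfl]
      · intro j _ hj
        rw [if_neg fun h => hj (Fin.ext (by simpa using h))]
      · simp
    · intro j _
      exact ⟨hl, Nat.lt_succ_self l⟩
    · intro a ha
      rw [hlayer, hV a (by omega), zero_add]
      refine Finset.sum_eq_zero fun j _ => if_neg fun h => ?_
      rw [← h] at ha
      simp only at ha
      omega

/-- The instructions of a looped network. -/
noncomputable def LNN.prog (N : LNN) (δ : ℝ) : List (Instr (ℕ × ℕ)) :=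
  N.block.prog δ 1 fun j => ((0, j), true)

theorem LNN.progState_prog {N : LNN} {δ M : ℝ} (hδ : 0 < δ) (hN : N.FixedPrecision δ M) (t : ℕ)
    (i : Fin N.n) : progState δ (N.prog δ) t (0, i) = N.state t i := by
  induction t generalizing i with
  | zero => rfl
  | succ t ih =>
    refine (FFNet.execReal_prog hδ _ (fun a ha => (hN a ha).1) 1 one_pos
      (fun j => ((0, j), true)) (by simp) _ 0 (fun _ _ => rfl) i).trans ?_
    simp only [cond_true]
    rw [LNN.state, ← funext ih]

theorem LNN.emittedBits_state (N : LNN) (t : ℕ) :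
    emittedBits (fun i => N.state i N.emitCh) (fun i => N.state i N.bitCh) t = N.emitted t := by
  induction t with
  | zero => rfl
  | succ t ih => rw [emittedBits, LNN.emitted, ih]

end Flatten

/-! ### Short names for the neurons that occur -/

section Rename

theorem nat_bits_injective : Function.Injective Nat.bits := fun m n h =>
  Nat.digits.injective 2 (by rw [Nat.digits_two_eq_bits, Nat.digits_two_eq_bits, h])

variable {α β : Type*} [DecidableEq α] [DecidableEq β]

/-- Renaming of an instruction. -/
def Instr.rename (ρ : α → β) (I : Instr α) : Instr β := (ρ I.1, ρ I.2.1, I.2.2)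

/-- Injectivity is asked only on the names that occur, so the length of the new names depends on the
program and not on the widths of the network. -/
theorem execReal_rename {δ : ℝ} {ρ : α → β} {S : Set α} (hρ : Set.InjOn ρ S) {P V : α → ℝ}
    {P' V' : β → ℝ} (hP : ∀ a ∈ S, P' (ρ a) = P a) (hV : ∀ a ∈ S, V' (ρ a) = V a)
    {prog : List (Instr α)} (hS : ∀ I ∈ prog, I.1 ∈ S ∧ I.2.1 ∈ S) {a : α} (ha : a ∈ S) :
    execReal δ P' V' (prog.map (Instr.rename ρ)) (ρ a) = execReal δ P V prog a := by
  induction prog generalizing V V' with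
  | nil => exact hV a ha
  | cons I prog ih =>
    obtain ⟨hd, hs⟩ := hS I List.mem_cons_self
    refine ih (V' := instrStep δ P' V' (Instr.rename ρ I)) (V := instrStep δ P V I)
      (fun b hb => ?_) fun J hJ => hS J (List.mem_cons_of_mem _ hJ)
    have hsrc : srcVal P' V' (Instr.rename ρ I) = srcVal P V I := by
      simp only [srcVal, Instr.rename, hP _ hs, hV _ hs]
    simp only [instrStep, hsrc]
    by_cases h : b = I.1
    · subst h
      simp [Instr.rename, hV _ hd]
    · rw [Function.update_of_ne h, Function.update_of_ne, hV b hb]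
      exact fun h' => h (hρ hb hd h')

theorem progState_rename {δ : ℝ} {ρ : α → β} {S : Set α} (hρ : Set.InjOn ρ S)
    {prog : List (Instr α)} (hS : ∀ I ∈ prog, I.1 ∈ S ∧ I.2.1 ∈ S) (t : ℕ) {a : α} (ha : a ∈ S) :
    progState δ (prog.map (Instr.rename ρ)) t (ρ a) = progState δ prog t a := by
  induction t generalizing a with
  | zero => rfl
  | succ t ih => exact execReal_rename hρ (fun b hb => ih hb) (fun _ _ => rfl) hS ha

/-- The names of a program can be taken to be the binary expansions of small numbers, three given
names being sent to `0`, `1` and `2`. -/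
theorem exists_rename (prog : List (Instr α)) {a b c : α} (hab : a ≠ b) (hac : a ≠ c)
    (hbc : b ≠ c) : ∃ prog' : List (Instr (List Bool)), prog'.length = prog.length ∧
      (∀ I ∈ prog', I.1.length ≤ Nat.size (2 * prog.length + 3) ∧
        I.2.1.length ≤ Nat.size (2 * prog.length + 3)) ∧
      ∀ δ t, progState δ prog' t (Nat.bits 0) = progState δ prog t a ∧
        progState δ prog' t (Nat.bits 1) = progState δ prog t b ∧
        progState δ prog' t (Nat.bits 2) = progState δ prog t c := by
  -- A name is replaced by its first position in this list, which sends `a`, `b`, `c` to `0`, `1`,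
  -- `2`. Each instruction contributes two entries.
  set u : List α := a :: b :: c :: prog.flatMap fun I => [I.1, I.2.1] with hu
  have hlen : u.length = 2 * prog.length + 3 := by
    simp [hu]
    omega
  set ρ : α → List Bool := fun x => Nat.bits (u.idxOf x) with hρdef
  have hρ : Set.InjOn ρ {x | x ∈ u} := by
    intro x hx y _ h
    exact (List.idxOf_inj hx).1 (nat_bits_injective h)
  have hsize : ∀ x ∈ u, (ρ x).length ≤ Nat.size (2 * prog.length + 3) := by
    intro x hx
    rw [hρdef, Nat.size_eq_bits_len]
    exact Nat.size_le_size (hlen ▸ (List.idxOf_lt_length_of_mem hx).le)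
  have hS : ∀ I ∈ prog, I.1 ∈ u ∧ I.2.1 ∈ u := by
    intro I hI
    have : ∀ x ∈ [I.1, I.2.1], x ∈ u := fun x hx => by
      simp only [hu, List.mem_cons, List.mem_flatMap]
      exact Or.inr (Or.inr (Or.inr ⟨I, hI, by simpa using hx⟩))
    exact ⟨this _ (by simp), this _ (by simp)⟩
  refine ⟨prog.map (Instr.rename ρ), by simp, fun I hI => ?_, fun δ t => ?_⟩
  · obtain ⟨J, hJ, rfl⟩ := List.mem_map.1 hI
    exact ⟨hsize _ (hS J hJ).1, hsize _ (hS J hJ).2⟩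
  · have ha : ρ a = Nat.bits 0 := by simp [hρdef, hu]
    have hb : ρ b = Nat.bits 1 := by simp [hρdef, hu, List.idxOf_cons, beq_false_of_ne hab]
    have hc : ρ c = Nat.bits 2 := by simp [hρdef, hu, List.idxOf_cons, beq_false_of_ne hac, beq_false_of_ne hbc]
    rw [← ha, ← hb, ← hc]
    exact ⟨progState_rename hρ hS t (by simp [hu]), progState_rename hρ hS t (by simp [hu]),
      progState_rename hρ hS t (by simp [hu])⟩

end Rename

/-! ### The complexity of the output of a network -/

theorem LNN.length_prog_le {N : LNN} {δ M : ℝ} (hδ : 0 < δ) (hN : N.FixedPrecision δ M) :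
    (N.prog δ).length ≤ ⌊M / δ⌋₊ * N.zeroNorm := by
  classical
  rw [LNN.prog, FFNet.length_prog, LNN.zeroNorm]
  have h : ∀ a ∈ N.block.params, (∃ z : ℤ, a = δ * z) ∧ |a| ≤ M := hN
  generalize N.block.params = l at h
  induction l with
  | nil => simp
  | cons a l ih =>
    have ih := ih fun b hb => h b (List.mem_cons_of_mem _ hb)
    obtain ⟨⟨z, rfl⟩, hM⟩ := h a List.mem_cons_self
    have hz : ⌊δ * z / δ⌋ = z := by
      rw [mul_div_cancel_left₀ _ hδ.ne', Int.floor_intCast]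
    rw [List.map_cons, List.sum_cons, List.countP_cons, hz]
    by_cases h0 : z = 0
    · simpa [h0] using ih
    · have h1 : δ * (z : ℝ) ≠ 0 := mul_ne_zero hδ.ne' (by exact_mod_cast h0)
      have h2 : z.natAbs ≤ ⌊M / δ⌋₊ := by
        refine Nat.le_floor ?_
        rw [le_div_iff₀ hδ, Nat.cast_natAbs, Int.cast_abs, mul_comm]
        rwa [abs_mul, abs_of_pos hδ] at hM
      simp only [ne_eq, h1, not_false_eq_true, decide_true, if_true, mul_add, mul_one]
      simp only [ne_eq] at ih
      omega

/-- Bounds the code length of a program of `len` instructions. Terms linear in `k` are absorbed by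
`k ≤ k log k + 1`, where the `1` is needed for `k = 1`. -/
theorem exists_log_bound (Z c : ℕ) : ∃ C : ℝ, 0 ≤ C ∧ ∀ k len : ℕ, 1 ≤ k → len ≤ Z * k →
    ((len * (4 * Nat.size (2 * len + 3) + 6) + 1 + c : ℕ) : ℝ) ≤
      C * (k * Real.logb 2 k) + C := by
  set A : ℝ := Real.logb 2 (2 * Z + 3) + 1 with hA
  have hA0 : 0 ≤ A := by
    have : 0 ≤ Real.logb 2 (2 * Z + 3) := Real.logb_nonneg one_lt_two (by
      have : (0 : ℝ) ≤ Z := Z.cast_nonneg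
      linarith)
    linarith
  -- With `L = log k`, the main term `Z k (4 (A + L) + 6)` is `4 Z k L` plus `Z (4 A + 6) k`, and
  -- the latter is at most `Z (4 A + 6) (k L + 1)`; whence `4 A + 10`.
  refine ⟨(4 * A + 10) * Z + 1 + c, by positivity, fun k len hk hlen => ?_⟩
  set L : ℝ := Real.logb 2 k
  have hk1 : (1 : ℝ) ≤ k := by exact_mod_cast hk
  have hL : 0 ≤ L := Real.logb_nonneg one_lt_two hk1
  have hkL : (k : ℝ) ≤ k * L + 1 := by
    rcases hk.eq_or_lt with h | h
    · rw [← h]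
      simp only [Nat.cast_one]
      linarith
    · have : 1 ≤ L := by
        rw [Real.le_logb_iff_rpow_le one_lt_two (by linarith), Real.rpow_one]
        exact_mod_cast h
      nlinarith
  have hlen' : (len : ℝ) ≤ Z * k := by exact_mod_cast hlen
  have hsize : (Nat.size (2 * len + 3) : ℝ) ≤ A + L := by
    have h1 : 2 ^ (Nat.size (2 * len + 3) - 1) ≤ 2 * len + 3 := by
      have : 0 < Nat.size (2 * len + 3) := Nat.size_pos.2 (by omega)
      exact Nat.lt_size.1 (by omega)
    -- Since `k ≥ 1`, the product `(2 Z + 3) k` dominates `2 len + 3`, and its logarithm splits into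
    -- `A - 1` and `log k`.
    have h2 : (Nat.size (2 * len + 3) - 1 : ℕ) ≤ Real.logb 2 ((2 * Z + 3) * k) := by
      rw [Real.le_logb_iff_rpow_le one_lt_two (by positivity), Real.rpow_natCast]
      have h3 : ((2 ^ (Nat.size (2 * len + 3) - 1) : ℕ) : ℝ) ≤ ((2 * len + 3 : ℕ) : ℝ) :=
        Nat.cast_le.2 h1
      push_cast at h3
      nlinarith
    rw [Real.logb_mul (by positivity) (by positivity)] at h2
    have h4 : (Nat.size (2 * len + 3) : ℝ) ≤ (Nat.size (2 * len + 3) - 1 : ℕ) + 1 := by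
      exact_mod_cast (by omega : Nat.size (2 * len + 3) ≤ Nat.size (2 * len + 3) - 1 + 1)
    linarith
  push_cast
  have h5 : (len : ℝ) * (4 * Nat.size (2 * len + 3) + 6) ≤ Z * k * (4 * (A + L) + 6) := by
    gcongr
  have hZ : (0 : ℝ) ≤ Z := Z.cast_nonneg
  have hc : (0 : ℝ) ≤ c := c.cast_nonneg
  have h6 : (Z : ℝ) * (4 * A + 6) * k ≤ Z * (4 * A + 6) * (k * L + 1) := by gcongr
  have h7 : 0 ≤ (k : ℝ) * L := by positivity
  nlinarith

theorem exists_kolmogorov_le_zeroNorm {U : List Bool →. List Bool} (hU : IsUniversal U)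
    {δ M : ℝ} (hδ : 0 < δ) (hc : IsComputableReal δ) :
    ∃ C : ℝ, 0 ≤ C ∧ ∀ (N : LNN) (s : List Bool), N.FixedPrecision δ M → N.Outputs s →
      1 ≤ N.zeroNorm →
      (kolmogorov U s : ℝ) ≤ C * (N.zeroNorm * Real.logb 2 N.zeroNorm) + C := by
  obtain ⟨pos, hpc, hpos⟩ := ComputablePred.computable_iff.1 (computablePred_expVal_pos hδ hc)
  have hpos : ∀ L, pos L = true ↔ 0 < expVal δ L := fun L => (iff_of_eq (congrFun hpos L)).symm
  obtain ⟨c, hK⟩ := exists_kolmogorov_le hU primrec_encProg.to_comp (fun _ _ => encProg_prefix)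
    (partrec_progOutput hpc (Nat.bits 0) (Nat.bits 1) (Nat.bits 2))
  obtain ⟨C, hC, hb⟩ := exists_log_bound ⌊M / δ⌋₊ c
  refine ⟨C, hC, fun N s hN hs h1 => ?_⟩
  obtain ⟨prog', hlen, hnames, hstate⟩ := exists_rename (N.prog δ)
    (show ((0, 0) : ℕ × ℕ) ≠ (0, 1) by simp) (show ((0, 0) : ℕ × ℕ) ≠ (0, 2) by simp)
    (show ((0, 1) : ℕ × ℕ) ≠ (0, 2) by simp)
  have hh : ∀ t, progState δ prog' t (Nat.bits 0) = N.state t N.haltCh := fun t =>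
    (hstate δ t).1.trans (N.progState_prog hδ hN t N.haltCh)
  have he : ∀ t, progState δ prog' t (Nat.bits 1) = N.state t N.emitCh := fun t =>
    (hstate δ t).2.1.trans (N.progState_prog hδ hN t N.emitCh)
  have hbit : ∀ t, progState δ prog' t (Nat.bits 2) = N.state t N.bitCh := fun t =>
    (hstate δ t).2.2.trans (N.progState_prog hδ hN t N.bitCh)
  obtain ⟨t, ht, hlt, rfl⟩ := hs
  have hmem := mem_progOutput (prog := prog') (halt := Nat.bits 0) (emit := Nat.bits 1)
    (bit := Nat.bits 2) (t := t) hpos (by rw [hh]; exact ht) (fun i hi => by rw [hh]; exact hlt i hi)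
  simp only [he, hbit, LNN.emittedBits_state] at hmem
  refine le_trans ?_ (hb N.zeroNorm (N.prog δ).length h1 (LNN.length_prog_le hδ hN))
  refine Nat.cast_le.2 ((hK prog' _ hmem).trans ?_)
  rw [← hlen] at hnames ⊢
  exact Nat.add_le_add_right (length_encProg_le hnames) c

end LoopedNet

namespace LoopedNet

/-! ### Looped networks over arbitrary index types -/

section Layers

open Classical in
/-- The number of nonzero entries of a matrix. -/
noncomputable def nnzMat {I J : Type*} [Fintype I] [Fintype J] (W : Matrix I J ℝ) : ℕ :=
  ∑ i, ∑ j, if W i j ≠ 0 then 1 else 0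

open Classical in
/-- The number of nonzero entries of a vector. -/
noncomputable def nnzVec {I : Type*} [Fintype I] (b : I → ℝ) : ℕ :=
  ∑ i, if b i ≠ 0 then 1 else 0

open Classical in
theorem countP_layerParams {m k : ℕ} (W : Matrix (Fin k) (Fin m) ℝ) (b : Fin k → ℝ) :
    (layerParams W b).countP (fun a => a ≠ 0) = nnzMat W + nnzVec b := by
  have h : ∀ l : List ℝ, l.countP (fun a => decide (a ≠ 0)) =
      (l.map fun a => if a ≠ 0 then 1 else 0).sum := by
    intro l
    induction l with
    | nil => rfl
    | cons a l ih => rw [List.countP_cons, ih, List.map_cons, List.sum_cons, add_comm]; simp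
  rw [h]
  simp only [layerParams, nnzMat, nnzVec, List.map_append, List.sum_append, List.map_flatten,
    List.sum_flatten, List.map_ofFn, Function.comp_def, List.sum_ofFn]

theorem nnzMat_submatrix {I J I' J' : Type*} [Fintype I] [Fintype J] [Fintype I'] [Fintype J']
    (W : Matrix I J ℝ) (e : I' ≃ I) (f : J' ≃ J) : nnzMat (W.submatrix e f) = nnzMat W := by
  simp only [nnzMat, Matrix.submatrix_apply]
  rw [← Equiv.sum_comp e]
  exact Finset.sum_congr rfl fun i _ => Equiv.sum_comp f fun j => if W (e i) j ≠ 0 then 1 else 0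

theorem nnzVec_comp {I I' : Type*} [Fintype I] [Fintype I'] (b : I → ℝ) (e : I' ≃ I) :
    nnzVec (b ∘ e) = nnzVec b :=
  Equiv.sum_comp e fun i => if b i ≠ 0 then 1 else 0

theorem nnzVec_zero {I : Type*} [Fintype I] : nnzVec (0 : I → ℝ) = 0 := by simp [nnzVec]

/-- One affine layer followed by ReLU. -/
noncomputable def reluLayer {I J : Type*} [Fintype J] (W : Matrix I J ℝ) (b : I → ℝ) (x : J → ℝ) :
    I → ℝ := fun i => max ((W.mulVec x + b) i) 0

variable {T₀ T₁ T₂ T₃ : Type} [Fintype T₀] [Fintype T₁] [Fintype T₂] [Fintype T₃]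

/-- The states of a looped network with three hidden layers, over arbitrary index types and
without biases after the first layer. -/
noncomputable def loopState (W₁ : Matrix T₁ T₀ ℝ) (b : T₁ → ℝ) (W₂ : Matrix T₂ T₁ ℝ)
    (W₃ : Matrix T₃ T₂ ℝ) (W₄ : Matrix T₀ T₃ ℝ) : ℕ → T₀ → ℝ
  | 0 => 0
  | t + 1 => W₄.mulVec (reluLayer W₃ 0 (reluLayer W₂ 0 (reluLayer W₁ b
      (loopState W₁ b W₂ W₃ W₄ t))))

/-- The three channels must become the first three coordinates; the order of the others is
immaterial. -/
theorem exists_equiv_fin {T : Type} [Fintype T] {f : Fin 3 → T} (hf : Function.Injective f) :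
    ∃ (m : ℕ) (e : T ≃ Fin (3 + m)), ∀ i, e (f i) = Fin.castAdd m i := by
  classical
  refine ⟨Fintype.card ((Set.range f)ᶜ : Set T), (((Equiv.sumCongr (Equiv.ofInjective f hf)
    (Fintype.equivFin ((Set.range f)ᶜ : Set T)).symm).trans
      (Equiv.Set.sumCompl (Set.range f))).symm.trans finSumFinEquiv), fun i => ?_⟩
  rw [Equiv.trans_apply, ← finSumFinEquiv_apply_left]
  congr 1
  rw [Equiv.symm_apply_eq]
  simp

theorem mulVec_submatrix {I J I' J' : Type*} [Fintype J] [Fintype J']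
    (W : Matrix I J ℝ) (e : I' → I) (f : J' ≃ J) (x : J → ℝ) :
    (W.submatrix e f).mulVec (x ∘ f) = W.mulVec x ∘ e := by
  funext i
  simp only [Matrix.mulVec, dotProduct, Matrix.submatrix_apply, Function.comp_apply]
  exact Equiv.sum_comp f fun j => W (e i) j * x j

/-- Index types can be replaced by `Fin n`. -/
theorem exists_looped_network (W₁ : Matrix T₁ T₀ ℝ) (b : T₁ → ℝ) (W₂ : Matrix T₂ T₁ ℝ)
    (W₃ : Matrix T₃ T₂ ℝ) (W₄ : Matrix T₀ T₃ ℝ) {f : Fin 3 → T₀} (hf : Function.Injective f) :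
    ∃ N : LNN, (∀ t, N.state t N.haltCh = loopState W₁ b W₂ W₃ W₄ t (f 0) ∧
        N.state t N.emitCh = loopState W₁ b W₂ W₃ W₄ t (f 1) ∧
        N.state t N.bitCh = loopState W₁ b W₂ W₃ W₄ t (f 2)) ∧
      N.zeroNorm = nnzMat W₁ + nnzVec b + nnzMat W₂ + nnzMat W₃ + nnzMat W₄ ∧
      ∀ a ∈ N.block.params, a = 0 ∨ (∃ i j, a = W₁ i j) ∨ (∃ i, a = b i) ∨ (∃ i j, a = W₂ i j) ∨
        (∃ i j, a = W₃ i j) ∨ ∃ i j, a = W₄ i j := by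
  classical
  obtain ⟨m, e₀, he₀⟩ := exists_equiv_fin hf
  set e₁ := (Fintype.equivFin T₁).symm
  set e₂ := (Fintype.equivFin T₂).symm
  set e₃ := (Fintype.equivFin T₃).symm
  set B : FFNet (3 + m) (3 + m) := .cons (W₁.submatrix e₁ e₀.symm) (b ∘ e₁)
    (.cons (W₂.submatrix e₂ e₁) 0 (.cons (W₃.submatrix e₃ e₂) 0
      (.last (W₄.submatrix e₀.symm e₃) 0))) with hB
  set N : LNN := ⟨3 + m, Nat.le_add_right 3 m, B⟩ with hN
  have hstate : ∀ t, N.state t = loopState W₁ b W₂ W₃ W₄ t ∘ e₀.symm := by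
    intro t
    induction t with
    | zero => rfl
    | succ t ih =>
      rw [LNN.state, ih, loopState]
      change FFNet.eval B _ = _
      simp only [hB, FFNet.eval, mulVec_submatrix]
      have h1 : (fun i => max ((W₁.mulVec (loopState W₁ b W₂ W₃ W₄ t) ∘ e₁ + b ∘ e₁) i) 0) =
          reluLayer W₁ b (loopState W₁ b W₂ W₃ W₄ t) ∘ e₁ := rfl
      rw [h1, mulVec_submatrix]
      set y := reluLayer W₁ b (loopState W₁ b W₂ W₃ W₄ t)
      have h2 : (fun i => max ((W₂.mulVec y ∘ e₂ + (0 : Fin (Fintype.card T₂) → ℝ)) i) 0) =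
          reluLayer W₂ 0 y ∘ e₂ := rfl
      rw [h2, mulVec_submatrix]
      set z := reluLayer W₂ 0 y
      have h3 : (fun i => max ((W₃.mulVec z ∘ e₃ + (0 : Fin (Fintype.card T₃) → ℝ)) i) 0) =
          reluLayer W₃ 0 z ∘ e₃ := rfl
      rw [h3, mulVec_submatrix, add_zero]
  have hch : ∀ t (i : Fin 3), N.state t (Fin.castAdd m i) = loopState W₁ b W₂ W₃ W₄ t (f i) := by
    intro t i
    rw [hstate, Function.comp_apply, ← he₀, Equiv.symm_apply_apply]
  refine ⟨N, fun t => ⟨hch t 0, hch t 1, hch t 2⟩, ?_, ?_⟩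
  · have hpar : N.block.params = B.params := rfl
    rw [LNN.zeroNorm, hpar]
    simp only [hB, FFNet.params, List.countP_append, countP_layerParams, nnzMat_submatrix,
      nnzVec_comp, nnzVec_zero, add_zero, add_assoc]
  · intro a ha
    change a ∈ B.params at ha
    simp only [hB, FFNet.params, layerParams, List.mem_append, List.mem_flatten,
      List.mem_ofFn] at ha
    rcases ha with (⟨_, ⟨i, rfl⟩, h⟩ | ⟨i, rfl⟩) | (⟨_, ⟨i, rfl⟩, h⟩ | ⟨i, rfl⟩) |
      (⟨_, ⟨i, rfl⟩, h⟩ | ⟨i, rfl⟩) | (⟨_, ⟨i, rfl⟩, h⟩ | ⟨i, rfl⟩)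
    · obtain ⟨j, rfl⟩ := List.mem_ofFn.1 h
      exact Or.inr (Or.inl ⟨_, _, rfl⟩)
    · exact Or.inr (Or.inr (Or.inl ⟨_, rfl⟩))
    · obtain ⟨j, rfl⟩ := List.mem_ofFn.1 h
      exact Or.inr (Or.inr (Or.inr (Or.inl ⟨_, _, rfl⟩)))
    · exact Or.inl rfl
    · obtain ⟨j, rfl⟩ := List.mem_ofFn.1 h
      exact Or.inr (Or.inr (Or.inr (Or.inr (Or.inl ⟨_, _, rfl⟩))))
    · exact Or.inl rfl
    · obtain ⟨j, rfl⟩ := List.mem_ofFn.1 h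
      exact Or.inr (Or.inr (Or.inr (Or.inr (Or.inr ⟨_, _, rfl⟩))))
    · exact Or.inl rfl

end Layers

/-! ### Integer networks and copies of neurons -/

section Expand

variable {I J : Type}

/-- The matrix with entries `0` and `± δ` in which neuron `i` has `μ i` copies and a weight `a`
is distributed over `|a|` copies of its source. -/
noncomputable def expandMat (δ : ℝ) (A : I → J → ℤ) (μ : I → ℕ) (ν : J → ℕ) :
    Matrix (Σ i, Fin (μ i)) (Σ j, Fin (ν j)) ℝ :=
  fun x y => if (y.2 : ℕ) < (A x.1 y.1).natAbs then δ * (A x.1 y.1).sign else 0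

theorem expandMat_mem (δ : ℝ) (A : I → J → ℤ) (μ : I → ℕ) (ν : J → ℕ) (x : Σ i, Fin (μ i))
    (y : Σ j, Fin (ν j)) : expandMat δ A μ ν x y = 0 ∨ expandMat δ A μ ν x y = δ ∨
      expandMat δ A μ ν x y = -δ := by
  simp only [expandMat]
  split_ifs with h
  · rcases Int.sign_trichotomy (A x.1 y.1) with h | h | h <;> simp [h]
  · exact Or.inl rfl

variable [Fintype J]

theorem card_filter_fin_lt {n a : ℕ} (h : a ≤ n) :
    (Finset.univ.filter fun r : Fin n => (r : ℕ) < a).card = a := by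
  rw [Fin.card_filter_val_lt, min_eq_right h]

/-- All copies of a source hold the same value, and exactly `|a|` of them are connected, each with
weight `± δ`. -/
theorem expandMat_mulVec (δ : ℝ) {A : I → J → ℤ} {μ : I → ℕ} {ν : J → ℕ}
    (h : ∀ i j, (A i j).natAbs ≤ ν j) (v : J → ℝ) (x : Σ i, Fin (μ i)) :
    (expandMat δ A μ ν).mulVec (fun y => v y.1) x = δ * ∑ j, A x.1 j * v j := by
  simp only [Matrix.mulVec, dotProduct, expandMat]
  rw [Fintype.sum_sigma, Finset.mul_sum]
  refine Finset.sum_congr rfl fun j _ => ?_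
  simp only [ite_mul, zero_mul]
  rw [← Finset.sum_filter, Finset.sum_const, card_filter_fin_lt (h _ _), nsmul_eq_mul]
  have : ((A x.1 j).natAbs : ℝ) * (A x.1 j).sign = A x.1 j := by
    rw [mul_comm]
    rw [← Int.cast_natCast, ← Int.cast_mul, Int.sign_mul_natAbs]
  rw [← this]
  ring

theorem nnzMat_expandMat_le [Fintype I] (δ : ℝ) {A : I → J → ℤ} {μ : I → ℕ} {ν : J → ℕ} :
    nnzMat (expandMat δ A μ ν) ≤ ∑ i, μ i * ∑ j, (A i j).natAbs := by
  classical
  rw [nnzMat, Fintype.sum_sigma]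
  refine Finset.sum_le_sum fun i _ => ?_
  have h : ∀ r : Fin (μ i), (∑ y : Σ j, Fin (ν j),
      if expandMat δ A μ ν ⟨i, r⟩ y ≠ 0 then 1 else 0) ≤ ∑ j, (A i j).natAbs := by
    intro r
    rw [Fintype.sum_sigma]
    refine Finset.sum_le_sum fun j _ => ?_
    calc (∑ s : Fin (ν j), if expandMat δ A μ ν ⟨i, r⟩ ⟨j, s⟩ ≠ 0 then 1 else 0)
        ≤ ∑ s : Fin (ν j), if (s : ℕ) < (A i j).natAbs then 1 else 0 := by
          refine Finset.sum_le_sum fun s _ => ?_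
          simp only [expandMat]
          split_ifs with h1 h2 <;> simp_all
      _ ≤ (A i j).natAbs := by
          rw [Finset.sum_boole, Fin.card_filter_val_lt]
          exact min_le_right _ _
  calc _ ≤ ∑ _r : Fin (μ i), ∑ j, (A i j).natAbs := Finset.sum_le_sum fun r _ => h r
    _ = _ := by simp

/-- One layer of an integer network. -/
noncomputable def intLayer (A : I → J → ℤ) (b : I → ℝ) (x : J → ℝ) (i : I) : ℝ :=
  max (∑ j, A i j * x j + b i) 0

/-- ReLU is positively homogeneous, so the scale `c` of the input passes through. The bias does not
carry this scale and appears as `c⁻¹ * b` once it is factored out. -/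
theorem reluLayer_expandMat {δ c : ℝ} (hδ : 0 ≤ δ) (hc : 0 < c) {A : I → J → ℤ} {μ : I → ℕ}
    {ν : J → ℕ} (h : ∀ i j, (A i j).natAbs ≤ ν j) (b : I → ℝ) (v : J → ℝ) :
    reluLayer (expandMat δ A μ ν) (fun x => δ * b x.1) (fun y => c * v y.1) =
      fun x => c * δ * intLayer A (fun i => c⁻¹ * b i) v x.1 := by
  funext x
  rw [reluLayer, Pi.add_apply, expandMat_mulVec δ h fun j => c * v j, intLayer,
    mul_max_of_nonneg _ _ (by positivity), mul_zero]
  congr 1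
  rw [mul_add, Finset.mul_sum, Finset.mul_sum]
  congr 1
  · exact Finset.sum_congr rfl fun j _ => by ring
  · field_simp

theorem reluLayer_expandMat_zero {δ c : ℝ} (hδ : 0 ≤ δ) (hc : 0 < c) {A : I → J → ℤ} {μ : I → ℕ}
    {ν : J → ℕ} (h : ∀ i j, (A i j).natAbs ≤ ν j) (v : J → ℝ) :
    reluLayer (expandMat δ A μ ν) 0 (fun y => c * v y.1) =
      fun x => c * δ * intLayer A 0 v x.1 := by
  have h0 := reluLayer_expandMat hδ hc (μ := μ) h 0 v
  simp only [Pi.zero_apply, mul_zero] at h0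
  exact h0

variable {I₁ I₂ I₃ : Type} [Fintype I₁] [Fintype I₂] [Fintype I₃]

/-- The states of an integer network with three hidden layers, the bias of the first layer being
divided by `ε` at each iteration. -/
noncomputable def intState (ε : ℝ) (A₁ : I₁ → J → ℤ) (b : I₁ → ℕ) (A₂ : I₂ → I₁ → ℤ)
    (A₃ : I₃ → I₂ → ℤ) (A₄ : J → I₃ → ℤ) : ℕ → J → ℝ
  | 0 => 0
  | t + 1 => fun j => ∑ i, A₄ j i * intLayer A₃ 0 (intLayer A₂ 0 (intLayer A₁
      (fun i => (ε ^ t)⁻¹ * b i) (intState ε A₁ b A₂ A₃ A₄ t))) i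

/-- An integer network is realized, up to positive factors, by a looped network whose nonzero
parameters are `± δ`. -/
theorem exists_network_of_int {δ M : ℝ} (hδ : 0 < δ) (hδM : δ ≤ M) (A₁ : I₁ → J → ℤ)
    (b : I₁ → ℕ) (hb : ∀ i, b i ≤ 1) (A₂ : I₂ → I₁ → ℤ) (A₃ : I₃ → I₂ → ℤ) (A₄ : J → I₃ → ℤ)
    (μ : J → ℕ) (μ₁ : I₁ → ℕ) (μ₂ : I₂ → ℕ) (μ₃ : I₃ → ℕ)
    (h₁ : ∀ i j, (A₁ i j).natAbs ≤ μ j) (h₂ : ∀ i j, (A₂ i j).natAbs ≤ μ₁ j)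
    (h₃ : ∀ i j, (A₃ i j).natAbs ≤ μ₂ j) (h₄ : ∀ i j, (A₄ i j).natAbs ≤ μ₃ j)
    {f : Fin 3 → J} (hf : Function.Injective f) (hμ : ∀ i, 0 < μ (f i)) :
    ∃ N : LNN, N.FixedPrecision δ M ∧
      (∀ t, N.state t N.haltCh = (δ ^ 4) ^ t * intState (δ ^ 4) A₁ b A₂ A₃ A₄ t (f 0) ∧
        N.state t N.emitCh = (δ ^ 4) ^ t * intState (δ ^ 4) A₁ b A₂ A₃ A₄ t (f 1) ∧
        N.state t N.bitCh = (δ ^ 4) ^ t * intState (δ ^ 4) A₁ b A₂ A₃ A₄ t (f 2)) ∧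
      N.zeroNorm ≤ (∑ i, μ₁ i * ∑ j, (A₁ i j).natAbs) + (∑ i, μ₁ i * b i) +
        (∑ i, μ₂ i * ∑ j, (A₂ i j).natAbs) + (∑ i, μ₃ i * ∑ j, (A₃ i j).natAbs) +
        (∑ i, μ i * ∑ j, (A₄ i j).natAbs) := by
  classical
  set W₁ := expandMat δ A₁ μ₁ μ
  set W₂ := expandMat δ A₂ μ₂ μ₁
  set W₃ := expandMat δ A₃ μ₃ μ₂
  set W₄ := expandMat δ A₄ μ μ₃
  set B : (Σ i, Fin (μ₁ i)) → ℝ := fun x => δ * b x.1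
  obtain ⟨N, hN, hnorm, hpar⟩ := exists_looped_network W₁ B W₂ W₃ W₄
    (f := fun i => ⟨f i, ⟨0, hμ i⟩⟩) (fun i j h => hf (congrArg Sigma.fst h))
  -- Each of the four layers contributes one factor `δ` per iteration.
  have hstate : ∀ t, loopState W₁ B W₂ W₃ W₄ t =
      fun x => (δ ^ 4) ^ t * intState (δ ^ 4) A₁ b A₂ A₃ A₄ t x.1 := by
    intro t
    induction t with
    | zero => funext x; simp [loopState, intState]
    | succ t ih =>
      have hc : 0 < (δ ^ 4) ^ t := by positivity
      rw [loopState, ih, reluLayer_expandMat hδ.le hc h₁ (fun i => (b i : ℝ))]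
      rw [reluLayer_expandMat_zero hδ.le (by positivity) h₂,
        reluLayer_expandMat_zero hδ.le (by positivity) h₃]
      funext x
      have h4 := expandMat_mulVec δ (μ := μ) h₄
        (fun j => (δ ^ 4) ^ t * δ * δ * δ * intLayer A₃ 0 (intLayer A₂ 0 (intLayer A₁
          (fun i => ((δ ^ 4) ^ t)⁻¹ * b i) (intState (δ ^ 4) A₁ b A₂ A₃ A₄ t))) j) x
      rw [h4, intState, Finset.mul_sum, Finset.mul_sum]
      exact Finset.sum_congr rfl fun j _ => by ring
  refine ⟨N, fun a ha => ?_, fun t => ?_, ?_⟩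
  · have h0 : a = 0 ∨ a = δ ∨ a = -δ := by
      rcases hpar a ha with h | ⟨i, j, h⟩ | ⟨i, h⟩ | ⟨i, j, h⟩ | ⟨i, j, h⟩ | ⟨i, j, h⟩
      · exact Or.inl h
      · exact h ▸ expandMat_mem δ _ _ _ i j
      · have := hb i.1
        interval_cases hbi : b i.1 <;> simp_all [B]
      · exact h ▸ expandMat_mem δ _ _ _ i j
      · exact h ▸ expandMat_mem δ _ _ _ i j
      · exact h ▸ expandMat_mem δ _ _ _ i j
    rcases h0 with rfl | rfl | rfl
    · exact ⟨⟨0, by simp⟩, by simpa using hδ.le.trans hδM⟩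
    · exact ⟨⟨1, by simp⟩, by rwa [abs_of_pos hδ]⟩
    · exact ⟨⟨-1, by simp⟩, by rwa [abs_neg, abs_of_pos hδ]⟩
  · obtain ⟨h0, h1, h2⟩ := hN t
    rw [h0, h1, h2, hstate]
    exact ⟨rfl, rfl, rfl⟩
  · have hB : nnzVec B ≤ ∑ i, μ₁ i * b i := by
      rw [nnzVec, Fintype.sum_sigma]
      refine Finset.sum_le_sum fun i _ => ?_
      have : ∀ r : Fin (μ₁ i), (if B ⟨i, r⟩ ≠ 0 then 1 else 0) ≤ b i := by
        intro r
        split_ifs with h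
        · by_contra h'
          have : b i = 0 := by omega
          simp [B, this] at h
        · exact Nat.zero_le _
      calc _ ≤ ∑ _r : Fin (μ₁ i), b i := Finset.sum_le_sum fun r _ => this r
        _ = _ := by simp
    rw [hnorm]
    have h1 : nnzMat W₁ ≤ _ := nnzMat_expandMat_le δ
    have h2 : nnzMat W₂ ≤ _ := nnzMat_expandMat_le δ
    have h3 : nnzMat W₃ ≤ _ := nnzMat_expandMat_le δ
    have h4 : nnzMat W₄ ≤ _ := nnzMat_expandMat_le δ
    omega

end Expand

end LoopedNet

namespace LoopedNet

/-! ### Stack machines -/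

/-- A finite multi-stack machine. A state reads the top of one stack, and then keeps that stack,
pops it (`some none`) or pushes a symbol (`some (some a)`). A state may emit a bit or halt. -/
structure StackMachine (Q K Γ : Type) where
  start : Q
  input : K
  stack : Q → K
  next : Q → Option Γ → Q
  act : Q → Option Γ → Option (Option Γ)
  halts : Q → Bool
  emits : Q → Option Bool

/-- The effect of an action on a stack. -/
def applyAct {Γ : Type} : Option (Option Γ) → List Γ → List Γ
  | none, l => l
  | some none, l => l.tail
  | some (some a), l => a :: l

namespace StackMachine

variable {Q K Γ : Type} [DecidableEq K] (M : StackMachine Q K Γ)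

/-- One step of a stack machine. -/
def step (c : Q × (K → List Γ)) : Q × (K → List Γ) :=
  (M.next c.1 (c.2 (M.stack c.1)).head?, Function.update c.2 (M.stack c.1)
    (applyAct (M.act c.1 (c.2 (M.stack c.1)).head?) (c.2 (M.stack c.1))))

/-- The machine halts from a configuration after emitting the given bits. -/
inductive Run : Q × (K → List Γ) → List Bool → Prop
  | halt {c} (h : M.halts c.1 = true) : Run c []
  | step {c s} (h : M.halts c.1 = false) (hs : Run (M.step c) s) :
      Run c ((M.emits c.1).toList ++ s)

end StackMachine

/-! ### Linear forms with integer coefficients -/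

section Dot

variable {J : Type} [Fintype J]

/-- The value of an integer linear form. -/
noncomputable def dot (r : J → ℤ) (x : J → ℝ) : ℝ := ∑ j, r j * x j

open Classical in
/-- A coordinate form. -/
noncomputable def coord (j : J) : J → ℤ := Pi.single j 1

variable (x : J → ℝ)

@[simp] theorem dot_coord (j : J) : dot (coord j) x = x j := by
  classical
  rw [dot, Finset.sum_eq_single j]
  · simp [coord]
  · intro i _ hi
    simp [coord, Pi.single_eq_of_ne hi]
  · simp

@[simp] theorem dot_zero : dot (0 : J → ℤ) x = 0 := by simp [dot]

@[simp] theorem dot_add (r r' : J → ℤ) : dot (r + r') x = dot r x + dot r' x := by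
  simp [dot, add_mul, Finset.sum_add_distrib]

@[simp] theorem dot_sub (r r' : J → ℤ) : dot (r - r') x = dot r x - dot r' x := by
  simp [dot, sub_mul, Finset.sum_sub_distrib]

@[simp] theorem dot_smul (n : ℤ) (r : J → ℤ) : dot (n • r) x = n * dot r x := by
  simp [dot, Finset.mul_sum, mul_assoc]

@[simp] theorem dot_sum {ι : Type} (s : Finset ι) (r : ι → J → ℤ) :
    dot (∑ i ∈ s, r i) x = ∑ i ∈ s, dot (r i) x := by
  classical
  induction s using Finset.induction_on with
  | empty => simp
  | insert i s hi ih => rw [Finset.sum_insert hi, Finset.sum_insert hi, dot_add, ih]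

@[simp] theorem dot_ite (c : Prop) [Decidable c] (r r' : J → ℤ) :
    dot (if c then r else r') x = if c then dot r x else dot r' x := by
  split_ifs <;> rfl

end Dot

/-! ### Stacks as fractions -/

section Frac

variable {Γ : Type} [Fintype Γ]

/-- The digit of an optional symbol, `0` for no symbol. -/
noncomputable def digit : Option Γ → ℕ
  | none => 0
  | some a => (Fintype.equivFin Γ a : ℕ) + 1

theorem digit_le (o : Option Γ) : digit o ≤ Fintype.card Γ := by
  cases o with
  | none => exact Nat.zero_le _
  | some a => exact (Fintype.equivFin Γ a).2

theorem digit_injective : Function.Injective (digit : Option Γ → ℕ) := by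
  intro o o' h
  cases o <;> cases o' <;> simp_all [digit, Fin.val_inj]

/-- The fraction in base `B` that codes a stack. -/
noncomputable def frac (B : ℕ) : List Γ → ℝ
  | [] => 0
  | a :: l => (digit (some a) + frac B l) / B

variable {B : ℕ} (hB : 2 * Fintype.card Γ + 2 ≤ B)
include hB

/-- The bound `1 / 2` leaves a gap between consecutive values of the leading digit, across which a
ReLU ramp can rise. Thresholding is therefore exact. -/
theorem frac_bounds (l : List Γ) : 0 ≤ frac B l ∧ frac B l ≤ 1 / 2 := by
  induction l with
  | nil => exact ⟨le_rfl, by norm_num [frac]⟩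
  | cons a l ih =>
    have h1 : (digit (some a) : ℝ) ≤ Fintype.card Γ := by exact_mod_cast digit_le (some a)
    have h2 : (2 * Fintype.card Γ + 2 : ℝ) ≤ B := by exact_mod_cast hB
    have hB0 : (0 : ℝ) < B := by
      have : (0 : ℝ) ≤ Fintype.card Γ := Nat.cast_nonneg _
      linarith
    rw [frac]
    refine ⟨div_nonneg (add_nonneg (Nat.cast_nonneg _) ih.1) hB0.le, ?_⟩
    rw [div_le_iff₀ hB0]
    linarith [ih.2]

theorem mul_frac (l : List Γ) : B * frac B l = digit l.head? + frac B l.tail := by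
  have hB0 : (B : ℝ) ≠ 0 := by
    have : 0 < B := by omega
    positivity
  cases l with
  | nil => simp [frac, digit]
  | cons a l =>
    rw [frac, mul_div_cancel₀ _ hB0]
    rfl

/-- The difference of two ReLU neurons is the indicator of `j ≤` the digit of the top. -/
theorem relu_sub_relu {v : ℝ} (hv : 0 ≤ v) (l : List Γ) (j : ℕ) :
    max (2 * B * (v * frac B l) - (2 * j - 1) * v) 0 - max (2 * B * (v * frac B l) - 2 * j * v) 0 =
      if j ≤ digit l.head? then v else 0 := by
  have h1 : 2 * B * (v * frac B l) = v * (2 * (digit l.head? + frac B l.tail)) := by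
    rw [← mul_frac hB l]
    ring
  obtain ⟨h2, h3⟩ := frac_bounds hB l.tail
  rw [h1]
  split_ifs with h
  · have h' : (j : ℝ) ≤ digit l.head? := by exact_mod_cast h
    rw [max_eq_left (by nlinarith), max_eq_left (by nlinarith)]
    ring
  · have h' : (digit l.head? : ℝ) + 1 ≤ j := by exact_mod_cast not_le.1 h
    rw [max_eq_right (by nlinarith), max_eq_right (by nlinarith), sub_zero]

/-- Appending `n` symbols below a stack. -/
theorem frac_take_add (l : List Γ) (i n : ℕ) :
    (B : ℝ) ^ (i + n) * frac B (l.take (i + n)) =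
      B ^ n * (B ^ i * frac B (l.take i)) +
        ∑ j : Fin n, (digit l[i + (j : ℕ)]? : ℝ) * B ^ (n - 1 - (j : ℕ)) := by
  have hB0 : (B : ℝ) ≠ 0 := by
    have : 0 < B := by omega
    positivity
  -- Past the end of the list the digit is `0`, so incomplete blocks need no separate treatment.
  have hone : ∀ (l : List Γ) (i : ℕ), (B : ℝ) ^ (i + 1) * frac B (l.take (i + 1)) =
      B * (B ^ i * frac B (l.take i)) + digit l[i]? := by
    intro l
    induction l with
    | nil => simp [frac, digit]
    | cons a l ih =>
      intro i
      cases i with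
      | zero => simp [frac, mul_div_cancel₀ _ hB0]
      | succ i =>
        have h := ih i
        simp only [List.take_succ_cons, frac, List.getElem?_cons_succ]
        rw [pow_succ (B : ℝ) (i + 1), mul_assoc, mul_div_cancel₀ _ hB0, mul_add, h]
        field_simp
        ring
  induction n with
  | zero => simp
  | succ n ih =>
    rw [← add_assoc, hone, ih, Fin.sum_univ_castSucc]
    simp only [Fin.val_castSucc, Fin.val_last, Nat.add_sub_cancel, Nat.sub_self, pow_zero, mul_one]
    rw [mul_add, Finset.mul_sum, add_assoc]
    congr 1
    · ring
    · congr 1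
      refine Finset.sum_congr rfl fun j _ => ?_
      have : n - (j : ℕ) = n - 1 - j + 1 := by omega
      rw [this, pow_succ]
      ring

end Frac

end LoopedNet

namespace LoopedNet

/-! ### The network that simulates a stack machine -/

/-- The blocks of five input symbols that are loaded in one iteration, with a flag that marks the
last block. -/
abbrev Block (Γ : Type) : Type := (Fin 5 → Option Γ) × Bool

/-- The coordinates of the state: the channels, the unit `u`, the clock `z`, the control state and
the stacks. -/
inductive StateIx (Q K : Type)
  | ch (i : Fin 3)
  | u
  | z
  | x (q : Q)
  | s (k : K)
  deriving DecidableEq, Fintype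

/-- The neurons of the first hidden layer, which compare the tops of the stacks with digits. -/
inductive ReadIx (Q K Γ : Type)
  | u
  | t (k : K) (o : Option Γ) (i : Fin 4)
  | x (q : Q)
  | s (k : K)
  | z
  | zc
  | pu
  | init
  | w (b : Block Γ)
  deriving DecidableEq, Fintype

/-- The neurons of the second hidden layer, which find the state and the symbol read. -/
inductive MatchIx (Q K Γ : Type)
  | u
  | s (k : K)
  | p (q : Q) (o : Option Γ)
  | zn
  | pu
  | init
  | w (b : Block Γ)
  deriving DecidableEq, Fintype

/-- The neurons of the third hidden layer, which update the stacks. -/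
inductive ActIx (Q K Γ : Type)
  | u
  | p (q : Q) (o : Option Γ)
  | y (q : Q) (o : Option Γ)
  | ks (k : K)
  | zn
  | pu
  | init
  | w (b : Block Γ)
  deriving DecidableEq, Fintype

namespace StackMachine

variable {Q K Γ : Type} [Fintype Q] [Fintype K] [Fintype Γ] [DecidableEq Q] [DecidableEq K]
  [DecidableEq Γ] (M : StackMachine Q K Γ) (B C : ℕ)

/-- The weights of the first layer. -/
noncomputable def readRow : ReadIx Q K Γ → StateIx Q K → ℤ
  | .u => coord .u
  | .t k o i => (2 * B : ℤ) • coord (.s k) - (2 * digit o - 1 + (i : ℕ) : ℤ) • coord .u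
  | .x q => coord (.x q)
  | .s k => coord (.s k)
  | .z => coord .z
  | .zc => (B ^ 5 : ℤ) • coord .z - coord .u
  | .pu => (2 : ℤ) • coord .z - coord .u - (2 : ℤ) • ∑ q, coord (.x q)
  | .init => (-C : ℤ) • coord .u
  | .w _ => 0

/-- The weights of the second layer. -/
noncomputable def matchRow : MatchIx Q K Γ → ReadIx Q K Γ → ℤ
  | .u => coord .u
  | .s k => coord (.s k)
  | .p q o => coord (.x q) + coord (.t (M.stack q) o 0) - coord (.t (M.stack q) o 1) -
      (coord (.t (M.stack q) o 2) - coord (.t (M.stack q) o 3)) - coord .u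
  | .zn => (B ^ 5 : ℤ) • coord .z - coord .zc
  | .pu => coord .pu
  | .init => coord .init
  | .w b => coord (.w b)

/-- The coefficients of the affine map that an action performs on a stack. -/
noncomputable def actCoeff (o : Option Γ) : Option (Option Γ) → ℤ × ℤ
  | none => (B ^ 5, 0)
  | some none => (B ^ 6, -(B ^ 5 * digit o))
  | some (some a) => (B ^ 4, B ^ 4 * digit (some a))

/-- The weights of the third layer. -/
noncomputable def actRow : ActIx Q K Γ → MatchIx Q K Γ → ℤ
  | .u => coord .u
  | .p q o => coord (.p q o)
  | .y q o => (actCoeff B o (M.act q o)).1 • coord (.s (M.stack q)) +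
      (actCoeff B o (M.act q o)).2 • coord .u - (B ^ 6 : ℤ) • (coord .u - coord (.p q o))
  | .ks k => (B ^ 5 : ℤ) • coord (.s k) -
      (B ^ 5 : ℤ) • ∑ q, ∑ o, if M.stack q = k then coord (.p q o) else 0
  | .zn => coord .zn
  | .pu => coord .pu
  | .init => coord .init
  | .w b => coord (.w b)

/-- The value of a block of symbols. -/
noncomputable def blockValue (b : Block Γ) : ℕ := ∑ j : Fin 5, digit (b.1 j) * B ^ (4 - (j : ℕ))

/-- The states that make a channel positive. -/
def channel (q : Q) (i : Fin 3) : Bool :=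
  ![M.halts q, (M.emits q).isSome, (M.emits q).getD false] i

/-- The weights of the last layer. -/
noncomputable def outRow : StateIx Q K → ActIx Q K Γ → ℤ
  | .ch i => ∑ q, ∑ o, if M.channel q i then coord (.p q o) else 0
  | .u => (B ^ 5 : ℤ) • coord .u + coord .init
  | .z => (B ^ 5 : ℤ) • coord .zn + ∑ b : Block Γ, if b.2 then coord (.w b) else 0
  | .x q' => (B ^ 5 : ℤ) • (∑ q, ∑ o, if M.next q o = q' then coord (.p q o) else 0) +
      if M.start = q' then (B ^ 5 : ℤ) • coord .pu else 0
  | .s k => coord (.ks k) + (∑ q, ∑ o, if M.stack q = k then coord (.y q o) else 0) +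
      if M.input = k then ∑ b : Block Γ, (blockValue B b : ℤ) • coord (.w b) else 0

variable {m : ℕ} (sym : Fin m → Block Γ)

/-- The weights of the first layer with the input tape. -/
noncomputable def readMat : ReadIx Q K Γ ⊕ Fin m → StateIx Q K ⊕ Fin m → ℤ
  | .inl i, .inl j => readRow B C i j
  | .inl i, .inr j => if i = .w (sym j) then 1 else 0
  | .inr _, .inl _ => 0
  | .inr i, .inr j => if i = j then 1 else 0

/-- A weight matrix that copies the tape. -/
def copyMat {I J : Type} (m : ℕ) (A : I → J → ℤ) : I ⊕ Fin m → J ⊕ Fin m → ℤ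
  | .inl i, .inl j => A i j
  | .inl _, .inr _ => 0
  | .inr _, .inl _ => 0
  | .inr i, .inr j => if i = j then 1 else 0

/-- The weights of the last layer with the input tape, which is shifted. -/
noncomputable def outMat (m : ℕ) : StateIx Q K ⊕ Fin m → ActIx Q K Γ ⊕ Fin m → ℤ
  | .inl i, .inl j => M.outRow B i j
  | .inl _, .inr _ => 0
  | .inr i, .inl j => if (i : ℕ) = 0 ∧ j = .init then 1 else 0
  | .inr i, .inr j => if (i : ℕ) = j + 1 then 1 else 0

/-- The biases of the first layer. -/
def readBias (m : ℕ) : ReadIx Q K Γ ⊕ Fin m → ℕ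
  | .inl .init => 1
  | _ => 0

/-- One iteration of the network with a given bias. -/
noncomputable def netStep (β : ℝ) (X : StateIx Q K ⊕ Fin m → ℝ) : StateIx Q K ⊕ Fin m → ℝ :=
  fun j => ∑ i, M.outMat B m j i * intLayer (copyMat m (M.actRow B)) 0
    (intLayer (copyMat m (M.matchRow B)) 0
      (intLayer (readMat B C sym) (fun i => β * readBias (Q := Q) (K := K) (Γ := Γ) m i) X)) i

/-- The state `X` codes the unit `v`, the clock `ζ`, the control state `σ`, the stacks `y` and the
input tape `τ`. -/
structure Codes (X : StateIx Q K ⊕ Fin m → ℝ) (v ζ : ℝ) (σ : Option Q) (y : K → ℝ)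
    (τ : Fin m → ℝ) : Prop where
  u : X (.inl .u) = v
  z : X (.inl .z) = ζ
  x : ∀ q, X (.inl (.x q)) = if σ = some q then v else 0
  s : ∀ k, X (.inl (.s k)) = y k
  tape : ∀ i, X (.inr i) = τ i

section Layers

variable {M B C sym}

theorem intLayer_copyMat_inl {I J : Type} [Fintype J] (A : I → J → ℤ) (Y : J ⊕ Fin m → ℝ) (i : I) :
    intLayer (copyMat m A) 0 Y (.inl i) = max (dot (A i) fun j => Y (.inl j)) 0 := by
  simp [intLayer, copyMat, dot, Fintype.sum_sum_type]

theorem intLayer_copyMat_inr {I J : Type} [Fintype J] (A : I → J → ℤ) (Y : J ⊕ Fin m → ℝ)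
    (i : Fin m) : intLayer (copyMat m A) 0 Y (.inr i) = max (Y (.inr i)) 0 := by
  simp [intLayer, copyMat, Fintype.sum_sum_type]

theorem intLayer_readMat_inl (β : ℝ) (X : StateIx Q K ⊕ Fin m → ℝ) (i : ReadIx Q K Γ) :
    intLayer (readMat B C sym) (fun i => β * readBias (Q := Q) (K := K) (Γ := Γ) m i) X (.inl i) =
      max (dot (readRow B C i) (fun j => X (.inl j)) +
        (∑ j, if i = .w (sym j) then X (.inr j) else 0) + if i = .init then β else 0) 0 := by
  have h : β * (readBias (Q := Q) (K := K) (Γ := Γ) m (.inl i) : ℝ) =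
      if i = .init then β else 0 := by
    cases i <;> simp [readBias]
  simp [intLayer, readMat, dot, Fintype.sum_sum_type, h]

theorem intLayer_readMat_inr (β : ℝ) (X : StateIx Q K ⊕ Fin m → ℝ) (i : Fin m) :
    intLayer (readMat B C sym) (fun i => β * readBias (Q := Q) (K := K) (Γ := Γ) m i) X (.inr i) =
      max (X (.inr i)) 0 := by
  simp [intLayer, readMat, Fintype.sum_sum_type, readBias]

/-- The values of the second hidden layer. -/
theorem match_values (hB : 2 * Fintype.card Γ + 2 ≤ B) {X : StateIx Q K ⊕ Fin m → ℝ}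
    {v ζ β : ℝ} {σ : Option Q} {S : K → List Γ} {τ : Fin m → ℝ} (hv : 0 ≤ v) (hζ₀ : 0 ≤ ζ)
    (hζ₁ : ζ ≤ v) (hτ : ∀ i, 0 ≤ τ i) (hσ : σ = none → ζ = v ∨ 2 * ζ ≤ v)
    (h : Codes X v ζ σ (fun k => v * frac B (S k)) τ) :
    let Y := intLayer (copyMat m (M.matchRow B)) 0
      (intLayer (readMat B C sym) (fun i => β * readBias (Q := Q) (K := K) (Γ := Γ) m i) X)
    Y (.inl .u) = v ∧ (∀ k, Y (.inl (.s k)) = v * frac B (S k)) ∧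
      (∀ q o, Y (.inl (.p q o)) = if σ = some q ∧ (S (M.stack q)).head? = o then v else 0) ∧
      Y (.inl .zn) = min (B ^ 5 * ζ) v ∧ Y (.inl .pu) = (if σ = none ∧ ζ = v then v else 0) ∧
      Y (.inl .init) = max (β - C * v) 0 ∧
      (∀ b, Y (.inl (.w b)) = ∑ j, if b = sym j then τ j else 0) ∧
      ∀ i, Y (.inr i) = τ i := by
  obtain ⟨hu, hz, hx, hs, ht⟩ := h
  have hf : ∀ k, 0 ≤ v * frac B (S k) := fun k => mul_nonneg hv (frac_bounds hB _).1
  have hsum : ∀ b : Block Γ, 0 ≤ ∑ j, if b = sym j then τ j else 0 := fun b =>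
    Finset.sum_nonneg fun j _ => by split_ifs <;> simp [hτ]
  intro Y
  refine ⟨?_, fun k => ?_, fun q o => ?_, ?_, ?_, ?_, fun b => ?_, fun i => ?_⟩
  · simp [Y, intLayer_copyMat_inl, matchRow, intLayer_readMat_inl, readRow, hu, hv]
  · simp [Y, intLayer_copyMat_inl, matchRow, intLayer_readMat_inl, readRow, hs, hf]
  · have hT : ∀ k (o : Option Γ),
        max (2 * B * (v * frac B (S k)) - (2 * digit o - 1) * v) 0 -
          max (2 * B * (v * frac B (S k)) - 2 * digit o * v) 0 -
        (max (2 * B * (v * frac B (S k)) - (2 * digit o + 1) * v) 0 -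
          max (2 * B * (v * frac B (S k)) - (2 * digit o + 2) * v) 0) =
        if (S k).head? = o then v else 0 := by
      intro k o
      -- Equality with `digit o` is the difference of the indicators of `≥ digit o` and `≥ digit o +
      -- 1`, hence the four neurons per symbol.
      have h1 := relu_sub_relu hB hv (S k) (digit o)
      have h2 := relu_sub_relu hB hv (S k) (digit o + 1)
      push_cast at h2
      rw [show (2 * ((digit o : ℝ) + 1) - 1) = 2 * digit o + 1 by ring,
        show 2 * ((digit o : ℝ) + 1) = 2 * digit o + 2 by ring] at h2
      rw [h1, h2]
      by_cases ho : (S k).head? = o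
      · subst ho; simp
      · rw [if_neg ho]
        have : digit (S k).head? ≠ digit o := fun h => ho (digit_injective h)
        by_cases h3 : digit o ≤ digit (S k).head?
        · rw [if_pos h3, if_pos (by omega), sub_self]
        · rw [if_neg h3, if_neg (by omega), sub_self]
    have hTo := hT (M.stack q) o
    have hxv : (0 : ℝ) ≤ if σ = some q then v else 0 := by split_ifs <;> simp [hv]
    simp only [Y, intLayer_copyMat_inl, matchRow, intLayer_readMat_inl, readRow, dot_add, dot_sub,
      dot_coord, dot_smul, hu, hx, hs, reduceCtorEq, if_false, Finset.sum_const_zero, add_zero]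
    push_cast
    simp only [Fin.val_zero, Fin.val_one, Fin.val_two, show ((3 : Fin 4) : ℕ) = 3 from rfl]
    rw [show (2 * (digit o : ℝ) - 1 + ((0 : ℕ) : ℝ)) = 2 * digit o - 1 by push_cast; ring,
      show (2 * (digit o : ℝ) - 1 + ((1 : ℕ) : ℝ)) = 2 * digit o by push_cast; ring,
      show (2 * (digit o : ℝ) - 1 + ((2 : ℕ) : ℝ)) = 2 * digit o + 1 by push_cast; ring,
      show (2 * (digit o : ℝ) - 1 + ((3 : ℕ) : ℝ)) = 2 * digit o + 2 by push_cast; ring,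
      max_eq_left hxv, max_eq_left hv]
    -- A conjunction as one neuron: two indicators of height `v`, minus `v`, cut off at `0`.
    refine Eq.trans (congrArg (max · 0) (?_ : _ = (if σ = some q then v else 0) +
      (if (S (M.stack q)).head? = o then v else 0) - v)) ?_
    · rw [← hTo]
      ring
    · split_ifs <;> simp_all
  · simp [-zsmul_eq_mul, Y, intLayer_copyMat_inl, matchRow, intLayer_readMat_inl, readRow, hu, hz,
      hζ₀]
    rcases le_total (B ^ 5 * ζ) v with h | h
    · rw [min_eq_left h, max_eq_right (sub_nonpos.2 h), sub_zero, max_eq_left (by positivity)]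
    · rw [min_eq_right h, max_eq_left (sub_nonneg.2 h), sub_sub_cancel, max_eq_left hv]
  · simp [-zsmul_eq_mul, Y, intLayer_copyMat_inl, matchRow, intLayer_readMat_inl, readRow, hu, hz,
      hx]
    -- Without a control state `2 ζ - v` equals `v` when the clock has caught up and is nonpositive
    -- before. A running state subtracts `2 v` more, so the machine is not started twice.
    cases σ with
    | none =>
      rcases hσ rfl with h | h
      · simp [h, hv, two_mul]
      · rcases hv.eq_or_lt with rfl | hv'
        · simp [le_antisymm hζ₁ hζ₀]
        · have hne : ζ ≠ v := by intro h'; linarith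
          simp [hne, h]
    | some q => simp; linarith
  · simp only [Y, intLayer_copyMat_inl, matchRow, dot_coord, intLayer_readMat_inl, readRow,
      dot_smul, hu, reduceCtorEq, if_false, if_true, Finset.sum_const_zero, add_zero]
    rw [max_eq_left (le_max_right _ _)]
    push_cast
    congr 1
    ring
  · simp [Y, intLayer_copyMat_inl, matchRow, intLayer_readMat_inl, readRow, ht, hsum]
  · simp [Y, intLayer_copyMat_inr, intLayer_readMat_inr, ht, hτ]

omit [Fintype K] [DecidableEq K] in
theorem sum_active (σ : Option Q) (r : Q → Option Γ) (P : Q → Option Γ → Prop)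
    [∀ q o, Decidable (P q o)] (F : Q → Option Γ → ℝ) :
    (∑ q, ∑ o, if P q o then if σ = some q ∧ r q = o then F q o else 0 else 0) =
      σ.elim 0 fun q => if P q (r q) then F q (r q) else 0 := by
  cases σ with
  | none => simp
  | some q =>
    rw [Finset.sum_eq_single q, Finset.sum_eq_single (r q)]
    · simp
    · intro o _ ho
      simp [ho.symm]
    · simp
    · intro q' _ hq'
      simp [hq'.symm]
    · simp

omit [DecidableEq Γ] in
-- A pop multiplies by `B` and a push divides by `B`. Scaling all actions by the growth `B ^ 5` of
-- the unit keeps the coefficients integral.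
theorem actCoeff_apply (hB : 2 * Fintype.card Γ + 2 ≤ B) (l : List Γ) (a : Option (Option Γ)) :
    ((actCoeff B l.head? a).1 : ℝ) * frac B l + (actCoeff B l.head? a).2 =
      B ^ 5 * frac B (applyAct a l) := by
  have hB0 : (B : ℝ) ≠ 0 := by
    have : 0 < B := by omega
    positivity
  rcases a with _ | _ | a
  · simp [actCoeff, applyAct]
  · have h := mul_frac hB l
    simp only [actCoeff, applyAct]
    push_cast
    linear_combination (B : ℝ) ^ 5 * h
  · simp only [actCoeff, applyAct, frac]
    push_cast
    field_simp
    ring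

omit [DecidableEq Γ] in
-- Justifies the inhibition `B ^ 6` in `actRow`: it silences every action whose state and symbol are
-- not the current ones.
theorem actCoeff_le (hB : 2 * Fintype.card Γ + 2 ≤ B) {f : ℝ} (hf₁ : f ≤ 1 / 2)
    (o : Option Γ) (a : Option (Option Γ)) :
    ((actCoeff B o a).1 : ℝ) * f + (actCoeff B o a).2 ≤ B ^ 6 := by
  have hB2 : (2 * Fintype.card Γ + 2 : ℝ) ≤ B := by exact_mod_cast hB
  have hB1 : (1 : ℝ) ≤ B := by
    have : (0 : ℝ) ≤ Fintype.card Γ := Nat.cast_nonneg _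
    linarith
  have h5 : (B : ℝ) ^ 5 ≤ B ^ 6 := pow_le_pow_right₀ hB1 (by norm_num)
  rcases a with _ | _ | a
  · simp only [actCoeff]
    push_cast
    have : (B : ℝ) ^ 5 * f ≤ B ^ 5 * 1 := by gcongr; linarith
    linarith
  · simp only [actCoeff]
    push_cast
    have : (B : ℝ) ^ 6 * f ≤ B ^ 6 * 1 := by gcongr; linarith
    have : (0 : ℝ) ≤ B ^ 5 * digit o := by positivity
    linarith
  · simp only [actCoeff]
    push_cast
    have hd : (digit (some a) : ℝ) ≤ Fintype.card Γ := by exact_mod_cast digit_le (some a)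
    calc (B : ℝ) ^ 4 * f + (B : ℝ) ^ 4 * digit (some a) =
          (B : ℝ) ^ 4 * (f + digit (some a)) := by ring
      _ ≤ (B : ℝ) ^ 4 * B := by gcongr; linarith
      _ ≤ (B : ℝ) ^ 6 := by rw [← pow_succ]; exact h5

/-- The values of the third hidden layer. -/
theorem act_values (hB : 2 * Fintype.card Γ + 2 ≤ B) {Y : MatchIx Q K Γ ⊕ Fin m → ℝ}
    {v : ℝ} {σ : Option Q} {S : K → List Γ} (hv : 0 ≤ v) (hu : Y (.inl .u) = v)
    (hs : ∀ k, Y (.inl (.s k)) = v * frac B (S k))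
    (hp : ∀ q o, Y (.inl (.p q o)) =
      if σ = some q ∧ (S (M.stack q)).head? = o then v else 0) :
    let Z := intLayer (copyMat m (M.actRow B)) 0 Y
    (∀ q o, Z (.inl (.y q o)) = if σ = some q ∧ (S (M.stack q)).head? = o then
        B ^ 5 * v * frac B (applyAct (M.act q o) (S (M.stack q))) else 0) ∧
      ∀ k, Z (.inl (.ks k)) = if σ.map M.stack = some k then 0 else B ^ 5 * v * frac B (S k) := by
  have hB2 : (2 * Fintype.card Γ + 2 : ℝ) ≤ B := by exact_mod_cast hB
  have hB1 : (1 : ℝ) ≤ B := by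
    have : (0 : ℝ) ≤ Fintype.card Γ := Nat.cast_nonneg _
    linarith
  have hf := fun k => frac_bounds hB (S k)
  intro Z
  refine ⟨fun q o => ?_, fun k => ?_⟩
  · simp only [Z, intLayer_copyMat_inl, actRow, dot_sub, dot_add, dot_smul, dot_coord, hs, hu, hp]
    split_ifs with h
    · obtain ⟨-, rfl⟩ := h
      have h1 := actCoeff_apply hB (S (M.stack q)) (M.act q (S (M.stack q)).head?)
      have h2 := (frac_bounds hB (applyAct (M.act q (S (M.stack q)).head?) (S (M.stack q)))).1
      have h3 := mul_nonneg hv (mul_nonneg (by positivity : (0 : ℝ) ≤ B ^ 5) h2)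
      rw [← h1] at h3
      rw [max_eq_left (by push_cast; linarith)]
      linear_combination v * h1
    · rw [max_eq_right]
      have h1 := mul_le_mul_of_nonneg_left
        (actCoeff_le hB (hf (M.stack q)).2 o (M.act q o)) hv
      push_cast
      linarith
  · simp only [Z, intLayer_copyMat_inl, actRow, dot_sub, dot_smul, dot_coord, dot_sum, dot_ite,
      dot_zero, hs, hp]
    rw [sum_active σ (fun q => (S (M.stack q)).head?) (fun q _ => M.stack q = k) fun _ _ => v]
    cases σ with
    | none =>
      have := (hf k).1
      simp
      rw [max_eq_left (by positivity), mul_assoc]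
    | some q =>
      have h0 := (hf k).1
      by_cases h : M.stack q = k
      · simp [h]
        have := (hf k).2
        gcongr
        nlinarith
      · simp [h]
        rw [max_eq_left (by positivity), mul_assoc]

omit [Fintype Q] [Fintype K] [DecidableEq Q] [DecidableEq K] in
theorem sum_block (sym : Fin m → Block Γ) (τ : Fin m → ℝ) (c : Block Γ → ℝ) :
    (∑ b, c b * ∑ j, if b = sym j then τ j else 0) = ∑ j, c (sym j) * τ j := by
  simp only [Finset.mul_sum, mul_ite, mul_zero]
  rw [Finset.sum_comm]
  simp

/-- One iteration of the network performs one step of the machine, and shifts the tape. -/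
theorem netStep_values (hB : 2 * Fintype.card Γ + 2 ≤ B) {X : StateIx Q K ⊕ Fin m → ℝ}
    {v ζ β : ℝ} {σ : Option Q} {S : K → List Γ} {τ : Fin m → ℝ} (hv : 0 ≤ v) (hζ₀ : 0 ≤ ζ)
    (hζ₁ : ζ ≤ v) (hτ : ∀ i, 0 ≤ τ i) (hσ : σ = none → ζ = v ∨ 2 * ζ ≤ v)
    (h : Codes X v ζ σ (fun k => v * frac B (S k)) τ) :
    let Y := M.netStep B C sym β X
    (∀ i, Y (.inl (.ch i)) = σ.elim 0 fun q => if M.channel q i then v else 0) ∧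
      Y (.inl .u) = B ^ 5 * v + max (β - C * v) 0 ∧
      Y (.inl .z) = B ^ 5 * min (B ^ 5 * ζ) v + ∑ j, (if (sym j).2 then τ j else 0) ∧
      (∀ q', Y (.inl (.x q')) = if (σ.elim (if ζ = v then some M.start else none)
        fun q => some (M.step (q, S)).1) = some q' then B ^ 5 * v else 0) ∧
      (∀ k, Y (.inl (.s k)) = B ^ 5 * v * frac B ((σ.elim S fun q => (M.step (q, S)).2) k) +
        if M.input = k then ∑ j, (blockValue B (sym j) : ℝ) * τ j else 0) ∧
      ∀ i, Y (.inr i) = (if (i : ℕ) = 0 then max (β - C * v) 0 else 0) +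
        ∑ j : Fin m, if (i : ℕ) = j + 1 then τ j else 0 := by
  obtain ⟨hu, hs, hp, hzn, hpu, hinit, hw, ht⟩ :=
    match_values (M := M) (C := C) (sym := sym) (β := β) hB hv hζ₀ hζ₁ hτ hσ h
  obtain ⟨hy, hks⟩ := act_values (M := M) hB hv hu hs hp
  set Y₂ := intLayer (copyMat m (M.matchRow B)) 0
      (intLayer (readMat B C sym) (fun i => β * readBias (Q := Q) (K := K) (Γ := Γ) m i) X)
  set Z := intLayer (copyMat m (M.actRow B)) 0 Y₂ with hZ
  have hcopy : ∀ j, 0 ≤ Y₂ (.inl j) := fun j => le_max_right _ _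
  have hu' : Z (.inl .u) = v := by
    simp [hZ, intLayer_copyMat_inl, actRow, hu, hv]
  have hp' : ∀ q o, Z (.inl (.p q o)) = Y₂ (.inl (.p q o)) := fun q o => by
    simp [hZ, intLayer_copyMat_inl, actRow, hcopy]
  have hzn' : Z (.inl .zn) = min (B ^ 5 * ζ) v := by
    rw [← hzn]
    simp [hZ, intLayer_copyMat_inl, actRow, hcopy]
  have hpu' : Z (.inl .pu) = if σ = none ∧ ζ = v then v else 0 := by
    rw [← hpu]
    simp [hZ, intLayer_copyMat_inl, actRow, hcopy]
  have hinit' : Z (.inl .init) = max (β - C * v) 0 := by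
    rw [← hinit]
    simp [hZ, intLayer_copyMat_inl, actRow, hcopy]
  have hw' : ∀ b, Z (.inl (.w b)) = ∑ j, if b = sym j then τ j else 0 := fun b => by
    rw [← hw]
    simp [hZ, intLayer_copyMat_inl, actRow, hcopy]
  have ht' : ∀ i, Z (.inr i) = τ i := fun i => by
    rw [hZ, intLayer_copyMat_inr, ht, max_eq_left (hτ i)]
  have hout : ∀ j, M.netStep B C sym β X (.inl j) = dot (M.outRow B j) fun i => Z (.inl i) := by
    intro j
    simp [netStep, Fintype.sum_sum_type, outMat, dot, hZ, Y₂]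
  intro Y
  refine ⟨fun i => ?_, ?_, ?_, fun q' => ?_, fun k => ?_, fun i => ?_⟩
  · simp only [Y, hout, outRow, dot_sum, dot_ite, dot_coord, dot_zero, hp', hp]
    rw [sum_active σ (fun q => (S (M.stack q)).head?) (fun q _ => M.channel q i = true) fun _ _ => v]
  · simp only [Y, hout, outRow, dot_add, dot_smul, dot_coord, hu', hinit']
    push_cast
    rfl
  · simp only [Y, hout, outRow, dot_add, dot_smul, dot_coord, dot_sum, dot_ite, dot_zero, hzn', hw']
    push_cast
    congr 1
    simpa using sum_block sym τ fun b => if b.2 then 1 else 0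
  · simp only [Y, hout, outRow, dot_add, dot_smul, dot_coord, dot_sum, dot_ite, dot_zero, hp', hp,
      hpu']
    rw [sum_active σ (fun q => (S (M.stack q)).head?) (fun q o => M.next q o = q') fun _ _ => v]
    push_cast
    cases σ with
    | none =>
      by_cases h : M.start = q' <;> by_cases h' : ζ = v <;> simp [h, h']
    | some q => simp [step]
  · simp only [Y, hout, outRow, dot_add, dot_smul, dot_coord, dot_sum, dot_ite, dot_zero, hks, hy,
      hw']
    rw [sum_active σ (fun q => (S (M.stack q)).head?) (fun q _ => M.stack q = k)
      fun q o => B ^ 5 * v * frac B (applyAct (M.act q o) (S (M.stack q)))]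
    push_cast
    congr 1
    · cases σ with
      | none => simp
      | some q =>
        by_cases h : M.stack q = k
        · subst h
          simp [step]
        · simp [h, step, Function.update_of_ne (Ne.symm h)]
    · congr 1
      exact sum_block sym τ fun b => (blockValue B b : ℝ)
  · have h1 : Y (.inr i) = (∑ j, (M.outMat B m (.inr i) (.inl j) : ℝ) * Z (.inl j)) +
        ∑ j, (M.outMat B m (.inr i) (.inr j) : ℝ) * Z (.inr j) := by
      simp only [Y, netStep, Fintype.sum_sum_type]
      rfl
    rw [h1]
    simp only [outMat, ht']
    congr 1
    · rw [Finset.sum_eq_single .init]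
      · simp [hinit']
      · intro j _ hj
        simp [hj]
      · simp
    · simp

end Layers

end StackMachine

end LoopedNet

/-! ### The phases of a run: loading the tape, waiting for the clock, simulating -/

namespace LoopedNet

namespace StackMachine

variable {Q K Γ : Type} [Fintype Q] [Fintype K] [Fintype Γ] [DecidableEq Q] [DecidableEq K]
  [DecidableEq Γ] (M : StackMachine Q K Γ) (B C : ℕ) (ε : ℝ)

/-- The number of blocks of an input. -/
def tapeLen (l : List Γ) : ℕ := l.length / 5 + 1

/-- The blocks of an input. -/
def tapeBlock (l : List Γ) (i : Fin (tapeLen l)) : Block Γ :=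
  (fun j => l[5 * (i : ℕ) + (j : ℕ)]?, decide ((i : ℕ) + 1 = tapeLen l))

/-- The states of the network on an input. -/
noncomputable def netState (l : List Γ) : ℕ → StateIx Q K ⊕ Fin (tapeLen l) → ℝ :=
  intState ε (readMat B C (tapeBlock l)) (readBias _) (copyMat _ (M.matchRow B))
    (copyMat _ (M.actRow B)) (M.outMat B _)

/-- The stacks when `i` symbols of the input have been loaded. -/
def loaded (l : List Γ) (i : ℕ) : K → List Γ := Function.update (fun _ => []) M.input (l.take i)

theorem netState_succ (l : List Γ) (t : ℕ) : M.netState B C ε l (t + 1) =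
    M.netStep B C (tapeBlock l) (ε ^ t)⁻¹ (M.netState B C ε l t) := rfl

variable {M B C ε} {l : List Γ} (hB : 2 * Fintype.card Γ + 2 ≤ B) (hε : 0 < ε)
  (hεB : ε⁻¹ ≤ (B : ℝ) ^ 5) (hεC : ε⁻¹ ≤ C)

include hB in
theorem netState_one :
    (∀ i, M.netState B C ε l 1 (.inl (.ch i)) = 0) ∧
      Codes (M.netState B C ε l 1) 1 0 none (fun k => 1 * frac B (M.loaded l 0 k))
        fun j => if (j : ℕ) = 0 then 1 else 0 := by
  -- At time `0` clock and unit agree, both being `0`. The start that this triggers has amplitude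
  -- `0` and no effect, while the bias sets the unit and the first tape cell to `1`.
  have h0 : Codes (M.netState B C ε l 0) 0 0 (none : Option Q) (fun k => 0 * frac B (M.loaded l 0 k))
      fun _ => 0 := by
    constructor <;> simp [netState, intState]
  obtain ⟨h1, h2, h3, h4, h5, h6⟩ := netStep_values (M := M) (C := C) (sym := tapeBlock l)
    (β := (ε ^ 0)⁻¹) hB le_rfl le_rfl le_rfl (fun _ => le_rfl) (fun _ => Or.inl rfl) h0
  rw [← netState_succ] at h1 h2 h3 h4 h5 h6
  have hfr : ∀ k, frac B (M.loaded l 0 k) = 0 := fun k => by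
    have : M.loaded l 0 k = [] := by
      by_cases h : k = M.input
      · subst h; simp [loaded]
      · simp [loaded, Function.update_of_ne h]
    rw [this, frac]
  refine ⟨h1, ⟨by simpa using h2, by simpa using h3, by simpa using h4, fun k => ?_,
    by simpa using h6⟩⟩
  rw [h5]
  simp [hfr]

include hε hεB hεC

omit [Fintype Γ] [DecidableEq Γ] in
-- Relative to the scale of the state the bias is multiplied by `ε⁻¹` per iteration, the unit by `B
-- ^ 5 ≥ ε⁻¹`, and `C` covers the first factor. So the neuron `init` is silent after the first
-- iteration.
theorem bias_le (t : ℕ) : max ((ε ^ (t + 1))⁻¹ - C * ((B : ℝ) ^ 5) ^ t) 0 = 0 := by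
  rw [max_eq_right]
  have : (ε ^ (t + 1))⁻¹ = ε⁻¹ * ε⁻¹ ^ t := by rw [← inv_pow, pow_succ']
  rw [this, sub_nonpos]
  have h : 0 ≤ ε⁻¹ := inv_nonneg.2 hε.le
  gcongr

include hB

/-- A pulse of constant size `1` moves along the tape. Since the stack already loaded is multiplied
by `B ^ 5`, adding the integer value of a block appends its five symbols below. -/
theorem netState_load (i : ℕ) (hi : i ≤ tapeLen l) :
    (∀ j, M.netState B C ε l (i + 1) (.inl (.ch j)) = 0) ∧
      Codes (M.netState B C ε l (i + 1)) (((B : ℝ) ^ 5) ^ i) (if i = tapeLen l then 1 else 0) none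
        (fun k => ((B : ℝ) ^ 5) ^ i * frac B (M.loaded l (5 * i) k))
        fun j => if (j : ℕ) = i then 1 else 0 := by
  induction i with
  | zero =>
    have h := netState_one (M := M) (l := l) (C := C) (ε := ε) hB
    simpa [tapeLen] using h
  | succ i ih =>
    obtain ⟨-, ih⟩ := ih (by omega)
    rw [if_neg (by omega)] at ih
    obtain ⟨h1, h2, h3, h4, h5, h6⟩ := netStep_values (M := M) (C := C) (sym := tapeBlock l)
      (β := (ε ^ (i + 1))⁻¹) hB (by positivity) le_rfl (by positivity)
      (fun _ => by split_ifs <;> simp) (fun _ => Or.inr (by simp)) ih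
    rw [← netState_succ] at h1 h2 h3 h4 h5 h6
    rw [bias_le hε hεB hεC] at h2 h6
    have hB0 : (0 : ℝ) < B := by
      have : 0 < B := by omega
      positivity
    have hlt : i < tapeLen l := by omega
    refine ⟨h1, ⟨by rw [h2, pow_succ']; ring, ?_, ?_, fun k => ?_, fun j => ?_⟩⟩
    · rw [h3, Finset.sum_eq_single (⟨i, hlt⟩ : Fin (tapeLen l))]
      · simp [tapeBlock, min_eq_left (by positivity : (0 : ℝ) ≤ ((B : ℝ) ^ 5) ^ i)]
      · intro j _ hj
        have : (j : ℕ) ≠ i := fun h => hj (Fin.ext h)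
        simp [this]
      · simp
    · intro q
      rw [h4]
      have : (0 : ℝ) ≠ ((B : ℝ) ^ 5) ^ i := by positivity
      simp [this]
    · rw [h5]
      by_cases hk : M.input = k
      · subst hk
        rw [if_pos rfl, Finset.sum_eq_single (⟨i, hlt⟩ : Fin (tapeLen l))]
        · have := frac_take_add hB l (5 * i) 5
          simp only [loaded, Option.elim_none, Function.update_self, if_true, mul_one, blockValue,
            tapeBlock, mul_add]
          rw [← pow_succ', ← pow_mul, mul_add 5, mul_one, this]
          push_cast
          ring
        · intro j _ hj
          have : (j : ℕ) ≠ i := fun h => hj (Fin.ext h)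
          simp [this]
        · simp
      · simp [hk, loaded, Function.update_of_ne (Ne.symm hk), frac]
    · rw [h6]
      by_cases hj : (j : ℕ) = i + 1
      · rw [Finset.sum_eq_single (⟨i, hlt⟩ : Fin (tapeLen l))]
        · simp [hj]
        · intro j' _ hj'
          have : (j' : ℕ) ≠ i := fun h => hj' (Fin.ext h)
          simp [this]
        · simp
      · rw [if_neg hj, Finset.sum_eq_zero]
        · simp
        · intro j' _
          split_ifs <;> first | rfl | omega

/-- The pulse leaves the tape with size `1`, but a control state must have the size of the unit,
then `(B ^ 5) ^ tapeLen l`. The clock grows by `B ^ 10` per iteration against `B ^ 5` for the unit,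
so it catches up after `tapeLen l` iterations. -/
theorem netState_clock (j : ℕ) (hj : j ≤ tapeLen l) :
    (∀ i, M.netState B C ε l (tapeLen l + j + 1) (.inl (.ch i)) = 0) ∧
      Codes (M.netState B C ε l (tapeLen l + j + 1)) (((B : ℝ) ^ 5) ^ (tapeLen l + j))
        (((B : ℝ) ^ 5) ^ (2 * j)) none
        (fun k => ((B : ℝ) ^ 5) ^ (tapeLen l + j) *
          frac B (Function.update (fun _ => []) M.input l k)) fun _ => 0 := by
  have hB2 : (2 : ℝ) ≤ (B : ℝ) ^ 5 := by
    have h1 : (2 : ℝ) ≤ B := by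
      have : 2 ≤ B := by omega
      exact_mod_cast this
    exact h1.trans (le_self_pow₀ (by linarith) (by norm_num))
  have hB1 : (1 : ℝ) ≤ (B : ℝ) ^ 5 := by linarith
  induction j with
  | zero =>
    obtain ⟨h1, h2⟩ := netState_load hB hε hεB hεC (M := M) (tapeLen l) le_rfl
    have h3 : l.take (5 * tapeLen l) = l := List.take_of_length_le (by rw [tapeLen]; omega)
    rw [if_pos rfl] at h2
    rw [loaded, h3] at h2
    refine ⟨h1, ?_⟩
    have h4 : (fun i : Fin (tapeLen l) => if (i : ℕ) = tapeLen l then (1 : ℝ) else 0) =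
        fun _ => 0 := by
      funext i
      rw [if_neg (by omega)]
    rw [h4] at h2
    simpa using h2
  | succ j ih =>
    obtain ⟨-, ih⟩ := ih (by omega)
    -- From `j + 1 ≤ tapeLen l`: the unit does not yet cap the clock.
    have hle : ((B : ℝ) ^ 5) ^ (2 * j + 1) ≤ ((B : ℝ) ^ 5) ^ (tapeLen l + j) :=
      pow_le_pow_right₀ hB1 (by omega)
    have hle2 : 2 * ((B : ℝ) ^ 5) ^ (2 * j) ≤ ((B : ℝ) ^ 5) ^ (2 * j + 1) := by
      rw [pow_succ' ((B : ℝ) ^ 5) (2 * j)]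
      exact mul_le_mul_of_nonneg_right hB2 (by positivity)
    have hpos : 0 < ((B : ℝ) ^ 5) ^ (2 * j) := by positivity
    obtain ⟨h1, h2, h3, h4, h5, h6⟩ := netStep_values (M := M) (C := C) (sym := tapeBlock l)
      (β := (ε ^ (tapeLen l + j + 1))⁻¹) hB (by positivity) (by positivity) (by linarith)
      (fun _ => le_rfl) (fun _ => Or.inr (by linarith)) ih
    rw [← netState_succ] at h1 h2 h3 h4 h5 h6
    rw [bias_le hε hεB hεC] at h2 h6
    rw [show tapeLen l + (j + 1) = tapeLen l + j + 1 from rfl]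
    refine ⟨h1, ⟨by rw [h2, add_zero, ← pow_succ'], ?_, fun q => ?_, fun k => ?_,
      by simpa using h6⟩⟩
    · rw [h3, ← pow_succ', min_eq_left hle, ← pow_succ']
      simp [mul_add]
    · rw [h4]
      have : ((B : ℝ) ^ 5) ^ (2 * j) ≠ ((B : ℝ) ^ 5) ^ (tapeLen l + j) := by
        intro h
        linarith
      simp [this]
    · rw [h5, ← pow_succ']
      simp

/-- In the run phase the clock equals the unit, and the tape is empty. -/
theorem netState_run {t : ℕ} {c : Q × (K → List Γ)}
    (h : Codes (M.netState B C ε l (t + 1)) (((B : ℝ) ^ 5) ^ t) (((B : ℝ) ^ 5) ^ t) (some c.1)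
      (fun k => ((B : ℝ) ^ 5) ^ t * frac B (c.2 k)) fun _ => 0) :
    (∀ i, 0 < M.netState B C ε l (t + 2) (.inl (.ch i)) ↔ M.channel c.1 i = true) ∧
      Codes (M.netState B C ε l (t + 2)) (((B : ℝ) ^ 5) ^ (t + 1)) (((B : ℝ) ^ 5) ^ (t + 1))
        (some (M.step c).1) (fun k => ((B : ℝ) ^ 5) ^ (t + 1) * frac B ((M.step c).2 k))
        fun _ => 0 := by
  have hB1 : (1 : ℝ) ≤ (B : ℝ) ^ 5 := one_le_pow₀ (by
    have : 1 ≤ B := by omega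
    exact_mod_cast this)
  have hpos : 0 < ((B : ℝ) ^ 5) ^ t := by positivity
  obtain ⟨h1, h2, h3, h4, h5, h6⟩ := netStep_values (M := M) (C := C) (sym := tapeBlock l)
    (β := (ε ^ (t + 1))⁻¹) hB hpos.le hpos.le le_rfl (fun _ => le_rfl) (by simp) h
  rw [← netState_succ] at h1 h2 h3 h4 h5 h6
  rw [bias_le hε hεB hεC] at h2 h6
  refine ⟨fun i => ?_, ⟨by rw [h2, add_zero, ← pow_succ'], ?_, fun q => ?_, fun k => ?_,
    by simpa using h6⟩⟩
  · rw [h1]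
    by_cases hc : M.channel c.1 i <;> simp [hc, hpos]
  · rw [h3, min_eq_right (le_mul_of_one_le_left hpos.le hB1), ← pow_succ']
    simp
  · rw [h4, ← pow_succ']
    rfl
  · rw [h5, ← pow_succ']
    simp

theorem netState_start :
    (∀ i, M.netState B C ε l (2 * tapeLen l + 2) (.inl (.ch i)) = 0) ∧
      Codes (M.netState B C ε l (2 * tapeLen l + 2)) (((B : ℝ) ^ 5) ^ (2 * tapeLen l + 1))
        (((B : ℝ) ^ 5) ^ (2 * tapeLen l + 1)) (some M.start)
        (fun k => ((B : ℝ) ^ 5) ^ (2 * tapeLen l + 1) *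
          frac B (Function.update (fun _ => []) M.input l k)) fun _ => 0 := by
  obtain ⟨-, h⟩ := netState_clock hB hε hεB hεC (M := M) (l := l) (tapeLen l) le_rfl
  have hB1 : (1 : ℝ) ≤ (B : ℝ) ^ 5 := one_le_pow₀ (by
    have : 1 ≤ B := by omega
    exact_mod_cast this)
  rw [← two_mul] at h
  have hpos : 0 < ((B : ℝ) ^ 5) ^ (2 * tapeLen l) := by positivity
  obtain ⟨h1, h2, h3, h4, h5, h6⟩ := netStep_values (M := M) (C := C) (sym := tapeBlock l)
    (β := (ε ^ (2 * tapeLen l + 1))⁻¹) hB hpos.le hpos.le le_rfl (fun _ => le_rfl)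
    (fun _ => Or.inl rfl) h
  rw [← netState_succ] at h1 h2 h3 h4 h5 h6
  rw [bias_le hε hεB hεC] at h2 h6
  refine ⟨h1, ⟨by rw [h2, add_zero, ← pow_succ'], ?_, fun q => ?_, fun k => ?_,
    by simpa using h6⟩⟩
  · rw [h3, min_eq_right (le_mul_of_one_le_left hpos.le hB1), ← pow_succ']
    simp
  · rw [h4, ← pow_succ']
    simp
  · rw [h5, ← pow_succ']
    simp

/-- The channels are silent until the machine starts. -/
theorem netState_ch_eq_zero {t : ℕ} (ht : t ≤ 2 * tapeLen l + 2) (i : Fin 3) :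
    M.netState B C ε l t (.inl (.ch i)) = 0 := by
  rcases t with _ | t
  · rfl
  · rcases le_or_gt t (tapeLen l) with h | h
    · exact (netState_load hB hε hεB hεC t h).1 i
    · obtain ⟨j, rfl⟩ := Nat.exists_eq_add_of_le h.le
      rcases le_or_gt j (tapeLen l) with h' | h'
      · exact (netState_clock hB hε hεB hεC j h').1 i
      · obtain rfl : j = tapeLen l + 1 := by omega
        rw [show tapeLen l + (tapeLen l + 1) + 1 = 2 * tapeLen l + 2 by omega]
        exact (netState_start hB hε hεB hεC).1 i

/-- The channels at iteration `t + 2` report the state coded at iteration `t + 1`, which accounts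
for the shift in the emitted bits. -/
theorem netState_run_halts {c : Q × (K → List Γ)} {s : List Bool} (hrun : M.Run c s) (t : ℕ)
    (h : Codes (M.netState B C ε l (t + 1)) (((B : ℝ) ^ 5) ^ t) (((B : ℝ) ^ 5) ^ t) (some c.1)
      (fun k => ((B : ℝ) ^ 5) ^ t * frac B (c.2 k)) fun _ => 0) :
    ∃ T, t < T ∧ 0 < M.netState B C ε l (T + 1) (.inl (.ch 0)) ∧
      (∀ i, t < i → i < T → ¬ 0 < M.netState B C ε l (i + 1) (.inl (.ch 0))) ∧
      emittedBits (fun i => M.netState B C ε l i (.inl (.ch 1)))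
        (fun i => M.netState B C ε l i (.inl (.ch 2))) T =
      emittedBits (fun i => M.netState B C ε l i (.inl (.ch 1)))
        (fun i => M.netState B C ε l i (.inl (.ch 2))) (t + 1) ++ s := by
  induction hrun generalizing t with
  | @halt c hc =>
    obtain ⟨h1, -⟩ := netState_run hB hε hεB hεC h
    exact ⟨t + 1, by omega, (h1 0).2 hc, fun i hi hi' => by omega, by simp⟩
  | @step c s hc _ ih =>
    obtain ⟨h1, h2⟩ := netState_run hB hε hεB hεC h
    obtain ⟨T, hT, hT1, hT2, hT3⟩ := ih (t + 1) h2
    refine ⟨T, by omega, hT1, fun i hi hi' => ?_, ?_⟩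
    · rcases Nat.lt_or_ge (t + 1) i with h' | h'
      · exact hT2 i h' hi'
      · obtain rfl : i = t + 1 := by omega
        rw [h1 0]
        simp [channel, hc]
    · rw [hT3, emittedBits, List.append_assoc]
      congr 1
      have e1 := h1 1
      have e2 := h1 2
      cases he : M.emits c.1 with
      | none =>
        rw [if_neg]
        · rfl
        · rw [e1]; simp [channel, he]
      | some b =>
        rw [if_pos]
        · simp [channel, he] at e2
          simp [e2]
        · rw [e1]; simp [channel, he]

end StackMachine

end LoopedNet

/-! ### Counting the nonzero parameters of the simulating network -/

namespace LoopedNet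

theorem emittedBits_congr {e b e' b' : ℕ → ℝ} (he : ∀ t, 0 < e t ↔ 0 < e' t)
    (hb : ∀ t, 0 < b t ↔ 0 < b' t) (t : ℕ) : emittedBits e b t = emittedBits e' b' t := by
  induction t with
  | zero => rfl
  | succ t ih => simp only [emittedBits, ih, he, hb]

theorem emittedBits_eq_nil {e b : ℕ → ℝ} {t : ℕ} (h : ∀ i ≤ t, ¬ 0 < e i) :
    emittedBits e b t = [] := by
  induction t with
  | zero => rfl
  | succ t ih => rw [emittedBits, ih fun i hi => h i (by omega), if_neg (h _ le_rfl)]; rfl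

namespace StackMachine

variable {Q K Γ : Type} [Fintype Q] [Fintype K] [Fintype Γ] [DecidableEq Q] [DecidableEq K]
  [DecidableEq Γ] (M : StackMachine Q K Γ) (B C : ℕ)

/-- The number of copies of a neuron of the first layer. -/
def readCopies (R : ℕ) : ReadIx Q K Γ → ℕ
  | .w _ => 1
  | _ => R

theorem copyMat_le {I J : Type} {m : ℕ} {A : I → J → ℤ} {μ : J → ℕ}
    (h : ∀ i j, (A i j).natAbs ≤ μ j) (i : I ⊕ Fin m) (j : J ⊕ Fin m) :
    (copyMat m A i j).natAbs ≤ Sum.elim μ (fun _ => 1) j := by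
  rcases i with i | i <;> rcases j with j | j <;> simp [copyMat, h]
  split_ifs <;> simp

theorem sum_copyMat {I J : Type} [Fintype I] [Fintype J] {m : ℕ} (A : I → J → ℤ) (μ : I → ℕ) :
    (∑ i, Sum.elim μ (fun _ => 1) i * ∑ j, (copyMat m A i j).natAbs) =
      (∑ i, μ i * ∑ j, (A i j).natAbs) + m := by
  simp [Fintype.sum_sum_type, copyMat, apply_ite Int.natAbs]

/-- Two weights per tape cell: one to the neuron of its block, which has a single copy, and one that
carries the cell on. -/
theorem sum_readMat {m : ℕ} (sym : Fin m → Block Γ) (R : ℕ) :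
    (∑ i, Sum.elim (readCopies R) (fun _ => 1) i *
        ∑ j, (readMat (Q := Q) (K := K) B C sym i j).natAbs) =
      (∑ i : ReadIx Q K Γ, readCopies R i * ∑ j, (readRow B C i j).natAbs) + 2 * m := by
  have h : ∑ i : ReadIx Q K Γ, readCopies R i * ∑ j, (if i = .w (sym j) then 1 else 0) = m := by
    simp only [Finset.mul_sum, mul_ite, mul_one, mul_zero]
    rw [Finset.sum_comm]
    simp [readCopies]
  simp only [Fintype.sum_sum_type, readMat, apply_ite Int.natAbs, Sum.elim_inl, Sum.elim_inr,
    mul_add, Finset.sum_add_distrib, Int.natAbs_one, Int.natAbs_zero, h]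
  simp
  ring

/-- The shift costs at most one weight per cell, and one more lets the initial pulse into the tape.
-/
theorem sum_outMat_le (m : ℕ) (μ : StateIx Q K → ℕ) :
    (∑ i, Sum.elim μ (fun _ => 1) i * ∑ j, (M.outMat B m i j).natAbs) ≤
      (∑ i, μ i * ∑ j, (M.outRow B i j).natAbs) + m + 1 := by
  have h1 : ∑ i : Fin m, ∑ j : ActIx Q K Γ, (if (i : ℕ) = 0 ∧ j = .init then 1 else 0) ≤ 1 := by
    rcases m with _ | m
    · simp
    · rw [Fin.sum_univ_succ]
      simp
  have h2 : ∑ i : Fin m, ∑ j : Fin m, (if (i : ℕ) = j + 1 then 1 else 0) ≤ m := by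
    have : ∀ i : Fin m, ∑ j : Fin m, (if (i : ℕ) = j + 1 then 1 else 0) ≤ 1 := by
      intro i
      rw [← Finset.card_filter, Finset.card_le_one]
      intro a ha b hb
      simp only [Finset.mem_filter, Finset.mem_univ, true_and] at ha hb
      exact Fin.ext (by omega)
    exact (Finset.sum_le_sum fun i _ => this i).trans (by simp)
  simp only [Fintype.sum_sum_type, outMat, apply_ite Int.natAbs, Sum.elim_inl, Sum.elim_inr,
    mul_add, Finset.sum_add_distrib, Int.natAbs_one, Int.natAbs_zero, one_mul]
  simp only [Finset.sum_const_zero, mul_zero]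
  omega

omit [Fintype Q] [Fintype K] [Fintype Γ] [DecidableEq Q] [DecidableEq K] in
-- The block neurons are read with weights `0` and `1` only, so one copy suffices. With `R` copies
-- each tape cell would need `R` weights to them.
theorem matchRow_le {R : ℕ} (h : ∀ i j, (M.matchRow B i j).natAbs ≤ R) (i : MatchIx Q K Γ)
    (j : ReadIx Q K Γ) : (M.matchRow B i j).natAbs ≤ readCopies R j := by
  cases j with
  | w b =>
    cases i <;> simp [matchRow, coord, readCopies, Pi.single_apply]
    split_ifs <;> simp
  | _ => exact h _ _

/-- A machine is simulated by looped networks whose numbers of nonzero parameters exceed the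
lengths of the inputs by a constant. -/
theorem exists_network_of_run {δ P : ℝ} (hδ : 0 < δ) (hδP : δ ≤ P) :
    ∃ c : ℕ, ∀ l s, M.Run (M.start, Function.update (fun _ => []) M.input l) s →
      ∃ N : LNN, N.FixedPrecision δ P ∧ N.Outputs s ∧ N.zeroNorm ≤ l.length + c := by
  set C := ⌈(δ ^ 4)⁻¹⌉₊
  set B := max (2 * Fintype.card Γ + 2) C
  have hε : 0 < δ ^ 4 := by positivity
  have hB : 2 * Fintype.card Γ + 2 ≤ B := le_max_left _ _
  have hC : (δ ^ 4)⁻¹ ≤ C := Nat.le_ceil _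
  have hB5 : (δ ^ 4)⁻¹ ≤ (B : ℝ) ^ 5 := by
    have h1 : (C : ℝ) ≤ B := by exact_mod_cast le_max_right _ _
    have h2 : (1 : ℝ) ≤ B := by
      have : 1 ≤ B := by omega
      exact_mod_cast this
    exact hC.trans (h1.trans (le_self_pow₀ h2 (by norm_num)))
  obtain ⟨R, hR0, hr1, hr2, hr3, hr4⟩ : ∃ R : ℕ, 0 < R ∧
      (∀ i j, (readRow (Q := Q) (K := K) (Γ := Γ) B C i j).natAbs ≤ R) ∧
      (∀ i j, (M.matchRow B i j).natAbs ≤ R) ∧ (∀ i j, (M.actRow B i j).natAbs ≤ R) ∧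
      ∀ i j, (M.outRow B i j).natAbs ≤ R := by
    have key : ∀ {I J : Type} [Fintype I] [Fintype J] (A : I → J → ℤ) (i : I) (j : J),
        (A i j).natAbs ≤ ∑ i, ∑ j, (A i j).natAbs := fun A i j =>
      (Finset.single_le_sum (f := fun j => (A i j).natAbs) (fun _ _ => Nat.zero_le _)
        (Finset.mem_univ j)).trans
      (Finset.single_le_sum (f := fun i => ∑ j, (A i j).natAbs) (fun _ _ => Nat.zero_le _)
        (Finset.mem_univ i))
    refine ⟨(∑ i, ∑ j, (readRow (Q := Q) (K := K) (Γ := Γ) B C i j).natAbs) +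
      (∑ i, ∑ j, (M.matchRow B i j).natAbs) + (∑ i, ∑ j, (M.actRow B i j).natAbs) +
      (∑ i, ∑ j, (M.outRow B i j).natAbs) + 1, by omega, fun i j => ?_, fun i j => ?_,
      fun i j => ?_, fun i j => ?_⟩
    · have := key (readRow (Q := Q) (K := K) (Γ := Γ) B C) i j
      omega
    · have := key (M.matchRow B) i j
      omega
    · have := key (M.actRow B) i j
      omega
    · have := key (M.outRow B) i j
      omega
  set c₁ := ∑ i : ReadIx Q K Γ, readCopies R i * ∑ j, (readRow B C i j).natAbs
  set c₂ := ∑ i, R * ∑ j, (M.matchRow B i j).natAbs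
  set c₃ := ∑ i, R * ∑ j, (M.actRow B i j).natAbs
  set c₄ := ∑ i, R * ∑ j, (M.outRow B i j).natAbs
  -- The tape costs `5 * tapeLen l + 1` weights, two per cell in the first layer and one in each
  -- other layer, and `5 * tapeLen l ≤ l.length + 5`; hence `6`.
  refine ⟨c₁ + R + c₂ + c₃ + c₄ + 6, fun l s hrun => ?_⟩
  obtain ⟨N, hN, hch, hnorm⟩ := exists_network_of_int hδ hδP
    (readMat (Q := Q) (K := K) B C (tapeBlock l)) (readBias (tapeLen l))
    (fun i => by rcases i with i | i; cases i; all_goals simp [readBias])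
    (copyMat (tapeLen l) (M.matchRow B)) (copyMat (tapeLen l) (M.actRow B))
    (M.outMat B (tapeLen l)) (Sum.elim (fun _ => R) fun _ => 1)
    (Sum.elim (readCopies R) fun _ => 1) (Sum.elim (fun _ => R) fun _ => 1)
    (Sum.elim (fun _ => R) fun _ => 1)
    (fun i j => by
      rcases i with i | i <;> rcases j with j | j
      · exact hr1 i j
      · simp only [readMat]; split_ifs <;> simp
      · simp [readMat]
      · simp only [readMat]; split_ifs <;> simp)
    (copyMat_le (M.matchRow_le B hr2)) (copyMat_le hr3)
    (fun i j => by
      rcases i with i | i <;> rcases j with j | j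
      · exact hr4 i j
      · simp [outMat]
      · simp only [outMat, Sum.elim_inl]; split_ifs <;> simp; omega
      · simp only [outMat]; split_ifs <;> simp)
    (f := fun i => .inl (.ch i)) (fun i j h => by simpa using h) (fun i => hR0)
  have hsign : ∀ t (x : ℝ), 0 < (δ ^ 4) ^ t * x ↔ 0 < x := fun t x =>
    mul_pos_iff_of_pos_left (by positivity)
  refine ⟨N, hN, ?_, ?_⟩
  · obtain ⟨T, hT, hT1, hT2, hT3⟩ := netState_run_halts (M := M) (l := l) hB hε hB5 hC hrun _
      (netState_start hB hε hB5 hC).2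
    have hzero := fun t ht i => netState_ch_eq_zero (M := M) (l := l) hB hε hB5 hC (t := t) ht i
    refine ⟨T, ?_, fun i hi => ?_, ?_⟩
    · rw [(hch _).1, hsign]
      exact hT1
    · rw [(hch _).1, hsign]
      rcases Nat.lt_or_ge (2 * tapeLen l + 1) i with h | h
      · exact hT2 i h hi
      · have := hzero (i + 1) (by omega) 0
        exact fun h' => h'.ne' this
    · rw [← LNN.emittedBits_state]
      refine Eq.trans (emittedBits_congr (fun t => ?_) (fun t => ?_) T)
        (hT3.trans ?_)
      · rw [(hch t).2.1, hsign]
        rfl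
      · rw [(hch t).2.2, hsign]
        rfl
      · rw [emittedBits_eq_nil, List.nil_append]
        intro i hi
        rw [hzero i hi]
        exact lt_irrefl _
  · have hbias : ∑ i, Sum.elim (readCopies R) (fun _ => 1) i *
        readBias (Q := Q) (K := K) (Γ := Γ) (tapeLen l) i = R := by
      rw [Finset.sum_eq_single (.inl .init)]
      · simp [readCopies, readBias]
      · intro i _ hi
        rcases i with i | i
        · cases i <;> simp_all [readBias]
        · simp [readBias]
      · simp
    rw [sum_readMat, sum_copyMat, sum_copyMat, hbias] at hnorm
    have h4 := M.sum_outMat_le B (tapeLen l) fun _ => R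
    have h5 : 5 * tapeLen l ≤ l.length + 5 := by rw [tapeLen]; omega
    omega

end StackMachine

end LoopedNet

namespace LoopedNet

/-! ### Stack machines for partial recursive functions -/

namespace StackMachine

variable {Q K Γ : Type} [DecidableEq K]

/-- The restriction of a machine to a set of states that is closed under transitions. -/
def restrict (M : StackMachine Q K Γ) (P : Set Q) (h₀ : M.start ∈ P)
    (h : ∀ q ∈ P, ∀ o, M.next q o ∈ P) : StackMachine P K Γ where
  start := ⟨M.start, h₀⟩
  input := M.input
  stack q := M.stack q
  next q o := ⟨M.next q o, h q q.2 o⟩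
  act q := M.act q
  halts q := M.halts q
  emits q := M.emits q

/-- A network needs a finite type of states, whereas the type of program statements is infinite. -/
theorem Run.restrict {M : StackMachine Q K Γ} {P : Set Q} {h₀ : M.start ∈ P}
    {h : ∀ q ∈ P, ∀ o, M.next q o ∈ P} {c : Q × (K → List Γ)} {s : List Bool} (hrun : M.Run c s)
    (hc : c.1 ∈ P) : (M.restrict P h₀ h).Run (⟨c.1, hc⟩, c.2) s := by
  induction hrun with
  | halt hh => exact .halt hh
  | @step c s hh _ ih => exact .step (M := M.restrict P h₀ h) (c := (⟨c.1, hc⟩, c.2)) hh (ih _)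

end StackMachine

open Turing Turing.PartrecToTM2

instance : Fintype K' := ⟨{.main, .rev, .aux, .stack}, fun k => by cases k <;> simp⟩

/-- The phases in which the result of a computation is emitted. -/
inductive EmitPhase
  | read
  | hold (b : Bool)
  | out (b c : Bool)
  | done
  deriving DecidableEq, Fintype

/-- The symbol of a bit. -/
def bitSymbol (b : Bool) : Γ' := bif b then .bit1 else .bit0

/-- The phase after a symbol has been read. -/
def EmitPhase.next (f : Bool → EmitPhase) : Option Γ' → EmitPhase
  | some .bit0 => f false
  | some .bit1 => f true
  | _ => .done

/-- The statements of programs. -/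
abbrev CodeStmt : Type := TM2.Stmt (fun _ : K' => Γ') Λ' (Option Γ')

/-- The configurations of programs. -/
abbrev CodeCfg : Type := TM2.Cfg (fun _ : K' => Γ') Λ' (Option Γ')

open TM2.Stmt in
/-- The machine that performs the elementary statements of a program one by one, and then emits
the binary digits of the result except for the leading one. -/
def codeMachine (c : ToPartrec.Code) : StackMachine ((CodeStmt × Option Γ') ⊕ EmitPhase) K' Γ' where
  start := .inl (tr (trNormal c .halt), none)
  input := .main
  stack
    | .inl (push k _ _, _) => k
    | .inl (peek k _ _, _) => k
    | .inl (pop k _ _, _) => k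
    | _ => .main
  next
    | .inl (push _ _ q, v), _ => .inl (q, v)
    | .inl (peek _ f q, v), o => .inl (q, f v o)
    | .inl (pop _ f q, v), o => .inl (q, f v o)
    | .inl (load f q, v), _ => .inl (q, f v)
    | .inl (branch f q₁ q₂, v), _ => .inl (bif f v then q₁ else q₂, v)
    | .inl (goto l, v), _ => .inl (tr (l v), v)
    | .inl (.halt, _), _ => .inr .read
    | .inr .read, o => .inr (EmitPhase.next .hold o)
    | .inr (.hold b), o => .inr (EmitPhase.next (.out b) o)
    | .inr (.out _ c), _ => .inr (.hold c)
    | .inr .done, _ => .inr .done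
  act
    | .inl (push _ f _, v), _ => some (some (f v))
    | .inl (pop _ _ _, _), _ => some none
    | .inr .read, _ => some none
    | .inr (.hold _), _ => some none
    | _, _ => none
  halts
    | .inr .done => true
    | _ => false
  emits
    | .inr (.out b _) => some b
    | _ => none

/-- The configuration of `codeMachine` that corresponds to a configuration of a program. -/
def codeCfg : CodeCfg → ((CodeStmt × Option Γ') ⊕ EmitPhase) × (K' → List Γ')
  | ⟨some l, v, S⟩ => (.inl (tr l, v), S)
  | ⟨none, _, S⟩ => (.inr .read, S)

variable {c : ToPartrec.Code}

theorem run_stmt {s : List Bool} (q : CodeStmt) (v : Option Γ') (S : K' → List Γ')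
    (h : (codeMachine c).Run (codeCfg (TM2.stepAux q v S)) s) :
    (codeMachine c).Run (.inl (q, v), S) s := by
  -- A statement that changes no stack becomes a step that writes some stack back unchanged.
  have hkeep : ∀ (q : CodeStmt) (v : Option Γ') (S : K' → List Γ') (k : K')
      (p : CodeStmt × Option Γ' ⊕ EmitPhase),
      (codeMachine c).step (.inl (q, v), S) = (p, Function.update S k (S k)) →
      (codeMachine c).Run (p, S) s → (codeMachine c).Run (.inl (q, v), S) s := by
    intro q v S k p h1 h2
    rw [Function.update_eq_self] at h1
    rw [← h1] at h2
    exact .step rfl h2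
  induction q generalizing v S with
  | push k f q ih => exact .step (s := s) rfl (ih v _ h)
  | peek k f q ih => exact hkeep _ _ _ _ _ rfl (ih _ _ h)
  | pop k f q ih => exact .step (s := s) rfl (ih _ _ h)
  | load f q ih => exact hkeep _ _ _ _ _ rfl (ih _ _ h)
  | branch f q₁ q₂ ih₁ ih₂ =>
    refine hkeep _ _ _ _ (.inl (bif f v then q₁ else q₂, v)) rfl ?_
    rw [TM2.stepAux] at h
    cases hf : f v
    · rw [hf] at h
      exact ih₂ _ _ h
    · rw [hf] at h
      exact ih₁ _ _ h
  | goto l => exact hkeep _ _ _ _ _ rfl h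
  | halt => exact hkeep _ _ _ _ _ rfl h

theorem run_reaches {s : List Bool} {a b : CodeCfg} (h : StateTransition.Reaches (TM2.step tr) a b)
    (hb : (codeMachine c).Run (codeCfg b) s) : (codeMachine c).Run (codeCfg a) s := by
  induction h using Relation.ReflTransGen.head_induction_on with
  | refl => exact hb
  | @head a a' h _ ih =>
    rcases a with ⟨_ | l, v, S⟩
    · cases h
    · obtain rfl : TM2.stepAux (tr l) v S = a' := Option.some.inj h
      exact run_stmt _ _ _ ih

/-- A digit is held back until another digit is seen behind it, so the last one, the leading `1` of
the number, is never emitted. -/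
theorem run_hold (L : List Bool) (r : List Γ') : ∀ (b : Bool) (S : K' → List Γ'),
    S .main = L.map bitSymbol ++ .cons :: r →
    (codeMachine c).Run (.inr (.hold b), S) (b :: L).dropLast := by
  induction L with
  | nil =>
    intro b S hS
    refine .step (s := []) rfl (.halt ?_)
    simp [StackMachine.step, codeMachine, hS, EmitPhase.next]
  | cons a L ih =>
    intro b S hS
    have h := ih a (Function.update S .main (L.map bitSymbol ++ .cons :: r)) (by simp)
    have h1 : (codeMachine c).step (.inr (.hold b), S) =
        (.inr (.out b a), Function.update S .main (L.map bitSymbol ++ .cons :: r)) := by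
      cases a <;> simp [StackMachine.step, codeMachine, hS, EmitPhase.next, bitSymbol, applyAct]
    have h2 : (codeMachine c).step (.inr (.out b a),
        Function.update S .main (L.map bitSymbol ++ .cons :: r)) =
        (.inr (.hold a), Function.update S .main (L.map bitSymbol ++ .cons :: r)) := by
      simp [StackMachine.step, codeMachine, applyAct]
    rw [← h2] at h
    have h3 : (codeMachine c).Run _ (b :: (a :: L).dropLast) := .step rfl h
    rw [← h1] at h3
    exact .step rfl h3

/-- The states of `codeMachine` that are reached from the start lie in a finite set. -/
theorem exists_finite_states (c : ToPartrec.Code) :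
    ∃ P : Set ((CodeStmt × Option Γ') ⊕ EmitPhase), P.Finite ∧ (codeMachine c).start ∈ P ∧
      ∀ q ∈ P, ∀ o, (codeMachine c).next q o ∈ P := by
  classical
  set T := TM2.stmts tr (codeSupp c .halt)
  have hsupp := tr_supports c .halt
  have htr : ∀ l ∈ codeSupp c .halt, some (tr l) ∈ T := by
    intro l hl
    refine Finset.some_mem_insertNone.2 (Finset.mem_biUnion.2 ⟨l, hl, TM2.stmts₁_self⟩)
  have hsub : ∀ {q q' : CodeStmt}, some q ∈ T → q' ∈ TM2.stmts₁ q → some q' ∈ T := fun h h' =>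
    TM2.stmts_trans h' h
  refine ⟨{x | ∀ y, x = .inl y → some y.1 ∈ T}, ?_, ?_, ?_⟩
  · refine Set.Finite.subset (((T.eraseNone ×ˢ Finset.univ).finite_toSet.image Sum.inl).union
      (Set.finite_range Sum.inr)) ?_
    rintro (⟨q, v⟩ | e) h
    · exact Or.inl ⟨(q, v), by simpa using h _ rfl, rfl⟩
    · exact Or.inr ⟨e, rfl⟩
  · rintro y hy
    cases hy
    exact htr _ hsupp.1
  · rintro (⟨q, v⟩ | e) h o y hy
    · have hq : some q ∈ T := h _ rfl
      cases q with
      | push k f q =>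
        cases hy
        exact hsub hq (by simp [TM2.stmts₁, TM2.stmts₁_self])
      | peek k f q =>
        cases hy
        exact hsub hq (by simp [TM2.stmts₁, TM2.stmts₁_self])
      | pop k f q =>
        cases hy
        exact hsub hq (by simp [TM2.stmts₁, TM2.stmts₁_self])
      | load f q =>
        cases hy
        exact hsub hq (by simp [TM2.stmts₁, TM2.stmts₁_self])
      | branch f q₁ q₂ =>
        cases hy
        refine hsub hq ?_
        cases f v <;> simp [TM2.stmts₁, TM2.stmts₁_self]
      | goto l =>
        cases hy
        exact htr _ (@TM2.stmts_supportsStmt _ _ _ _ ⟨trNormal c .halt⟩ _ _ _ hsupp hq v)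
      | halt => cases hy
    · cases e <;> cases hy

/-- The number with the given binary digits below a leading digit `1`. -/
def binary (l : List Bool) : ℕ := l.foldr (fun b n => 2 * n + cond b 1 0) 1

theorem trNat_binary (l : List Bool) : trNat (binary l) = (l ++ [true]).map bitSymbol := by
  have h : ∃ p : PosNum, (p : ℕ) = binary l ∧ trPosNum p = (l ++ [true]).map bitSymbol := by
    induction l with
    | nil => exact ⟨1, rfl, rfl⟩
    | cons b l ih =>
      obtain ⟨p, hp, h⟩ := ih
      cases b
      · refine ⟨.bit0 p, ?_, ?_⟩
        · rw [PosNum.cast_bit0, hp, binary, binary, List.foldr_cons]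
          simp
          ring
        · rw [trPosNum, h]; rfl
      · refine ⟨.bit1 p, ?_, ?_⟩
        · rw [PosNum.cast_bit1, hp, binary, binary, List.foldr_cons]
          simp
          ring
        · rw [trPosNum, h]; rfl
  obtain ⟨p, hp, h⟩ := h
  rw [← h, ← hp, trNat, PosNum.of_to_nat]
  rfl

theorem binary_injective : Function.Injective binary := by
  intro l l' h
  have h1 := congrArg trNat h
  rw [trNat_binary, trNat_binary] at h1
  have h2 : Function.Injective bitSymbol := by decide
  exact List.append_cancel_right (List.map_injective_iff.2 h2 h1)

theorem computable_binary : Computable binary := by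
  refine Primrec.to_comp ?_
  refine Primrec.list_foldr Primrec.id (Primrec.const 1) (h := fun _ p => 2 * p.2 + cond p.1 1 0) ?_
  exact Primrec.nat_add.comp (Primrec.nat_mul.comp (Primrec.const 2)
    (Primrec.snd.comp Primrec.snd))
    (Primrec.cond (Primrec.fst.comp Primrec.snd) (Primrec.const 1) (Primrec.const 0))

theorem run_code {w s : List Bool} (h : c.eval [binary w] = pure [binary s]) :
    (codeMachine c).Run ((codeMachine c).start,
      Function.update (fun _ => []) (codeMachine c).input (trList [binary w])) s := by
  have h1 : halt [binary s] ∈ StateTransition.eval (TM2.step tr) (init c [binary w]) := by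
    rw [tr_eval, h]
    exact Part.mem_map _ (Part.mem_some _)
  have h2 := run_reaches (c := c) (s := s) (StateTransition.mem_eval.1 h1).1 ?_
  · have h3 : Function.update (fun _ => []) (codeMachine c).input (trList [binary w]) =
        K'.elim (trList [binary w]) [] [] [] := by
      funext k
      cases k <;> rfl
    rw [h3]
    exact h2
  · have hS : K'.elim (trList [binary s]) [] [] [] .main = (s ++ [true]).map bitSymbol ++ [.cons] := by
      rw [K'.elim_main, trList, trNat_binary]
      rfl
    obtain ⟨b, L, hL⟩ := List.exists_cons_of_ne_nil (l := s ++ [true]) (by simp)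
    have h3 : s = (b :: L).dropLast := by rw [← hL]; simp
    rw [hL] at hS
    have h4 : (codeMachine c).step (.inr .read, K'.elim (trList [binary s]) [] [] []) =
        (.inr (.hold b), Function.update (K'.elim (trList [binary s]) [] [] []) .main
          (L.map bitSymbol ++ [.cons])) := by
      simp only [StackMachine.step, codeMachine]
      rw [hS]
      cases b <;> rfl
    have h5 := run_hold (c := c) L [] b _ (Function.update_self K'.main (L.map bitSymbol ++ [.cons])
      (K'.elim (trList [binary s]) [] [] []))
    rw [← h4] at h5
    have h6 : (codeMachine c).Run (.inr .read, K'.elim (trList [binary s]) [] [] [])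
      (b :: L).dropLast := .step rfl h5
    rw [← h3] at h6
    exact h6

end LoopedNet

/-! ### From a universal machine to networks -/

namespace LoopedNet

open Turing Turing.PartrecToTM2

/-- `ToPartrec.Code` computes with lists of numbers. The extra leading `1` in `binary` makes the
passage from strings to numbers injective at the cost of one symbol. -/
theorem exists_code {U : List Bool →. List Bool} (hU : Partrec U) :
    ∃ c : ToPartrec.Code, ∀ w s, s ∈ U w → c.eval [binary w] = pure [binary s] := by
  obtain ⟨g, hg, hg'⟩ := exists_partrec_inverse computable_binary binary_injective
  have h1 : Partrec fun n => ((g n).bind U).map binary :=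
    (hg.bind (hU.comp Computable.snd).to₂).map (computable_binary.comp Computable.snd).to₂
  obtain ⟨c, hc⟩ := ToPartrec.Code.exists_code (Nat.Partrec'.part_iff₁.2 h1)
  refine ⟨c, fun w s hs => ?_⟩
  have h2 : ((g (binary w)).bind U).map binary = Part.some (binary s) :=
    Part.eq_some_iff.2 (Part.mem_map _ (Part.mem_bind ((hg' _ _).2 rfl) hs))
  have h3 := hc ⟨[binary w], rfl⟩
  refine h3.trans ?_
  change _ <$> ((g (binary w)).bind U).map binary = _
  rw [h2]
  simp

/-- Every string is the output of a looped network whose number of nonzero parameters exceeds its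
complexity by at most a constant. -/
theorem exists_network {U : List Bool →. List Bool} (hU : IsUniversal U) {δ M : ℝ} (hδ : 0 < δ)
    (hδM : δ ≤ M) : ∃ c : ℕ, ∀ s, ∃ N : LNN, N.FixedPrecision δ M ∧ N.Outputs s ∧
      N.zeroNorm ≤ kolmogorov U s + c := by
  classical
  obtain ⟨c, hc⟩ := exists_code hU.isPrefixMachine.partrec
  obtain ⟨P, hP, h₀, h⟩ := exists_finite_states c
  have := hP.fintype
  obtain ⟨k, hk⟩ := ((codeMachine c).restrict P h₀ h).exists_network_of_run hδ hδM
  -- The input on the stack is `w` followed by two symbols, the leading digit and the separator.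
  refine ⟨k + 2, fun s => ?_⟩
  obtain ⟨w, hw, hs⟩ := Nat.sInf_mem (s := {k | ∃ p : List Bool, p.length = k ∧ s ∈ U p})
    (let ⟨p, hp⟩ := hU.exists_program s; ⟨_, p, rfl, hp⟩)
  obtain ⟨N, hN, hout, hnorm⟩ := hk _ s ((run_code (hc w s hs)).restrict h₀)
  refine ⟨N, hN, hout, hnorm.trans ?_⟩
  rw [kolmogorov, ← hw, trList, trNat_binary]
  simp [trList]
  omega

end LoopedNet

namespace LoopedNet

/-! ### Norms -/

namespace LNN

theorem lpNorm_rpow (N : LNN) {p : ℝ} (hp : 1 ≤ p) :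
    N.lpNorm p ^ p = (N.block.params.map fun a => |a| ^ p).sum := by
  have h : 0 ≤ (N.block.params.map fun a => |a| ^ p).sum :=
    List.sum_nonneg fun x hx => by
      obtain ⟨a, _, rfl⟩ := List.mem_map.1 hx
      positivity
  rw [lpNorm, ← Real.rpow_mul h, one_div, inv_mul_cancel₀ (by linarith), Real.rpow_one]

theorem lpNorm_bounds {N : LNN} {δ M p : ℝ} (hδ : 0 < δ) (hN : N.FixedPrecision δ M)
    (hp : 1 ≤ p) : δ ^ p * (N.zeroNorm : ℝ) ≤ N.lpNorm p ^ p ∧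
      N.lpNorm p ^ p ≤ M ^ p * (N.zeroNorm : ℝ) := by
  classical
  rw [lpNorm_rpow N hp, zeroNorm]
  have h : ∀ a ∈ N.block.params, (∃ z : ℤ, a = δ * z) ∧ |a| ≤ M := hN
  generalize N.block.params = l at h
  induction l with
  | nil => simp
  | cons a l ih =>
    have ih := ih fun b hb => h b (List.mem_cons_of_mem _ hb)
    obtain ⟨⟨z, hz⟩, hM⟩ := h a List.mem_cons_self
    rw [List.map_cons, List.sum_cons, List.countP_cons]
    by_cases h0 : a = 0
    · simpa [h0, Real.zero_rpow (by linarith : p ≠ 0)] using ih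
    · have h1 : δ ≤ |a| := by
        rw [hz, abs_mul, abs_of_pos hδ]
        have : (1 : ℝ) ≤ |(z : ℝ)| := by
          have hz0 : z ≠ 0 := fun h => h0 (by simp [hz, h])
          exact_mod_cast Int.one_le_abs hz0
        nlinarith
      have h2 : δ ^ p ≤ |a| ^ p := Real.rpow_le_rpow hδ.le h1 (by linarith)
      have h3 : |a| ^ p ≤ M ^ p := Real.rpow_le_rpow (abs_nonneg a) hM (by linarith)
      rw [if_pos (decide_eq_true h0), Nat.cast_add, Nat.cast_one, mul_add, mul_add, mul_one,
        mul_one]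
      exact ⟨by linarith [ih.1], by linarith [ih.2]⟩

theorem lpNorm_nonneg (N : LNN) (p : ℝ) : 0 ≤ N.lpNorm p :=
  Real.rpow_nonneg (List.sum_nonneg fun x hx => by
    obtain ⟨a, _, rfl⟩ := List.mem_map.1 hx
    positivity) _

end LNN

theorem FFNet.eval_eq_zero {m k : ℕ} (N : FFNet m k) (h : ∀ a ∈ N.params, a = 0)
    (x : Fin m → ℝ) : N.eval x = 0 := by
  induction N with
  | last W b =>
    obtain ⟨h1, h2⟩ := mem_layerParams W b
    funext i
    simp [FFNet.eval, Matrix.mulVec, dotProduct, fun i j => h _ (h1 i j), fun i => h _ (h2 i)]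
  | cons W b rest ih => exact ih (fun a ha => h a (List.mem_append_right _ ha)) _

/-- With all parameters zero the state stays at `0` and the halt channel never fires. -/
theorem LNN.Outputs.one_le_zeroNorm {N : LNN} {s : List Bool} (h : N.Outputs s) :
    1 ≤ N.zeroNorm := by
  classical
  obtain ⟨t, ht, _⟩ := h
  by_contra h0
  have h1 : N.zeroNorm = 0 := by omega
  rw [LNN.zeroNorm, List.countP_eq_zero] at h1
  rw [LNN.state, FFNet.eval_eq_zero _ fun a ha => by simpa using h1 a ha] at ht
  exact lt_irrefl _ ht

end LoopedNet

/-! ### Assembly of the three bounds -/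

theorem mainTheorem4 (U : List Bool →. List Bool) (hU : LoopedNet.IsUniversal U)
    (δ M : ℝ) (hδ : 0 < δ) (hδM : δ ≤ M) :
    ∃ c_U c_d : ℝ, 0 ≤ c_U ∧ 0 ≤ c_d ∧ ∀ p : ℝ, 1 ≤ p →
      (∀ N : LoopedNet.LNN, N.FixedPrecision δ M →
        δ ^ p * (N.zeroNorm : ℝ) ≤ N.lpNorm p ^ p ∧
          N.lpNorm p ^ p ≤ M ^ p * (N.zeroNorm : ℝ)) ∧
      ∀ s : List Bool,
        LoopedNet.minLpNorm δ M p s ≠ ⊤ ∧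
        (LoopedNet.minLpNorm δ M p s).toReal ^ p
          ≤ M ^ p * ((LoopedNet.kolmogorov U s : ℝ) + c_U) ∧
        (LoopedNet.IsComputableReal δ →
          (LoopedNet.kolmogorov U s : ℝ)
            ≤ c_d / δ ^ p * (LoopedNet.minLpNorm δ M p s).toReal ^ p
                * Real.logb 2 ((LoopedNet.minLpNorm δ M p s).toReal ^ p / δ ^ p) + c_d) := by
  classical
  obtain ⟨c, hc⟩ := LoopedNet.exists_network hU hδ hδM
  obtain ⟨C, hC0, hC⟩ : ∃ C : ℝ, 0 ≤ C ∧ (LoopedNet.IsComputableReal δ →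
      ∀ (N : LoopedNet.LNN) (s : List Bool), N.FixedPrecision δ M → N.Outputs s →
        1 ≤ N.zeroNorm → (LoopedNet.kolmogorov U s : ℝ) ≤
          C * (N.zeroNorm * Real.logb 2 N.zeroNorm) + C) := by
    by_cases h : LoopedNet.IsComputableReal δ
    · obtain ⟨C, hC0, hC⟩ := LoopedNet.exists_kolmogorov_le_zeroNorm (M := M) hU hδ h
      exact ⟨C, hC0, fun _ => hC⟩
    · exact ⟨0, le_rfl, fun h' => absurd h' h⟩
  refine ⟨c, C, c.cast_nonneg, hC0, fun p hp => ⟨fun N hN => N.lpNorm_bounds hδ hN hp,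
    fun s => ?_⟩⟩
  have hp0 : 0 ≤ p := by linarith
  have hδp : 0 < δ ^ p := Real.rpow_pos_of_pos hδ p
  have hle : ∀ N : LoopedNet.LNN, N.FixedPrecision δ M → N.Outputs s →
      LoopedNet.minLpNorm δ M p s ≤ ENNReal.ofReal (N.lpNorm p) := fun N h1 h2 =>
    (iInf_le _ N).trans ((iInf_le _ h1).trans (iInf_le _ h2))
  obtain ⟨N, hN, hNs, hNc⟩ := hc s
  have htop : LoopedNet.minLpNorm δ M p s ≠ ⊤ :=
    ne_top_of_le_ne_top ENNReal.ofReal_ne_top (hle N hN hNs)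
  refine ⟨htop, ?_, fun hcomp => ?_⟩
  · have h1 : (LoopedNet.minLpNorm δ M p s).toReal ≤ N.lpNorm p :=
      (ENNReal.toReal_mono ENNReal.ofReal_ne_top (hle N hN hNs)).trans
        (ENNReal.toReal_ofReal (N.lpNorm_nonneg p)).le
    calc (LoopedNet.minLpNorm δ M p s).toReal ^ p ≤ N.lpNorm p ^ p :=
          Real.rpow_le_rpow ENNReal.toReal_nonneg h1 hp0
      _ ≤ M ^ p * (N.zeroNorm : ℝ) := (N.lpNorm_bounds hδ hN hp).2
      _ ≤ M ^ p * ((LoopedNet.kolmogorov U s : ℝ) + c) := by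
          refine mul_le_mul_of_nonneg_left ?_ (Real.rpow_nonneg (hδ.le.trans hδM) p)
          exact_mod_cast hNc
  -- The complexity bound is applied to a network with the fewest nonzero parameters, which exists
  -- because these are natural numbers. Whether the infimum of the norms is attained plays no role.
  · have hex : ∃ k, ∃ N : LoopedNet.LNN, N.FixedPrecision δ M ∧ N.Outputs s ∧ N.zeroNorm = k :=
      ⟨_, N, hN, hNs, rfl⟩
    obtain ⟨N₀, hN₀, hN₀s, hk⟩ := Nat.find_spec hex
    have hmin : ∀ N : LoopedNet.LNN, N.FixedPrecision δ M → N.Outputs s →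
        N₀.zeroNorm ≤ N.zeroNorm := fun N h1 h2 =>
      hk ▸ Nat.find_min' hex ⟨N, h1, h2, rfl⟩
    have hk1 : (1 : ℝ) ≤ N₀.zeroNorm := by exact_mod_cast hN₀s.one_le_zeroNorm
    set k : ℝ := (N₀.zeroNorm : ℝ)
    have hlow : (δ ^ p * k) ^ (1 / p) ≤ (LoopedNet.minLpNorm δ M p s).toReal := by
      rw [← ENNReal.ofReal_le_iff_le_toReal htop]
      refine le_iInf fun N => le_iInf fun h1 => le_iInf fun h2 => ENNReal.ofReal_le_ofReal ?_
      have h3 : δ ^ p * k ≤ N.lpNorm p ^ p :=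
        (mul_le_mul_of_nonneg_left (Nat.cast_le.2 (hmin N h1 h2)) hδp.le).trans
          (N.lpNorm_bounds hδ h1 hp).1
      calc (δ ^ p * k) ^ (1 / p) ≤ (N.lpNorm p ^ p) ^ (1 / p) :=
            Real.rpow_le_rpow (by positivity) h3 (by positivity)
        _ = N.lpNorm p := by
            rw [← Real.rpow_mul (N.lpNorm_nonneg p), mul_one_div_cancel (by linarith),
              Real.rpow_one]
    have hX : δ ^ p * k ≤ (LoopedNet.minLpNorm δ M p s).toReal ^ p := by
      calc δ ^ p * k = ((δ ^ p * k) ^ (1 / p)) ^ p := by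
            rw [← Real.rpow_mul (by positivity), one_div_mul_cancel (by linarith), Real.rpow_one]
        _ ≤ _ := Real.rpow_le_rpow (by positivity) hlow hp0
    set X : ℝ := (LoopedNet.minLpNorm δ M p s).toReal ^ p / δ ^ p with hXdef
    have hkX : k ≤ X := by rwa [hXdef, le_div_iff₀ hδp, mul_comm]
    have hlog : Real.logb 2 k ≤ Real.logb 2 X :=
      Real.logb_le_logb_of_le one_lt_two (by linarith) hkX
    have hlog0 : 0 ≤ Real.logb 2 k := Real.logb_nonneg one_lt_two hk1
    have h := hC hcomp N₀ s hN₀ hN₀s hN₀s.one_le_zeroNorm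
    calc (LoopedNet.kolmogorov U s : ℝ) ≤ C * (k * Real.logb 2 k) + C := h
      _ ≤ C * (X * Real.logb 2 X) + C := by
          gcongr
      _ = C / δ ^ p * (LoopedNet.minLpNorm δ M p s).toReal ^ p * Real.logb 2 X + C := by
          rw [hXdef]
          ring
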